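/- **Proposition 4.2.** *Setting.* Let $D,M\ge 1$, and let $T,\alpha,\sigma_1,\sigma_2,\sigma_3,\bar V_\infty>0$, $u_{\max}\in\mathbb R$, $E_{\rm des}\in\mathbb R^D$. For $j=1,2$ let $\Phi_j:\mathbb R^D\to\mathbb R$ be radially symmetric and continuously differentiable with $\nabla\Phi_j$ locally Lipschitz and globally bounded, and put $K_j(x,y)=(\nabla\Phi_j)(x-y)$. Write $z=(x,v)\in\mathbb R^{2D}$. Let $\Omega\subset\mathbb R^{2D}$ be a bounded, open, convex set, and let $I=[I_L,I_R]\subset[0,T]$, $I_L<I_R$, be a time slice. Functions in $L^2(\Omega)$ are extended by zero to $\mathbb R^{2D}$. For $f\in L^2(\Omega)$ and $d=(d_1,\dots,d_M)\in\mathbb R^{MD}$ set $$S(f)(x,v,d)=-\int_\Omega K_1(x,\bar x)f(\bar z)\,d\bar z-\frac1M\sum_{m=1}^M K_2(x,d_m)-\alpha v,$$ $$\mathbb E_\infty(f)=\int_\Omega x\,f\,dz,\qquad \mathbb V_\infty(f)=\int_\Omega|x-\mathbb E_\infty(f)|^2 f\,dz.$$ The admissible controls are $\mathcal U_{ad}=\{\mathbf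 w\in L^2(I,\mathbb R^{MD}) : |w_m(t)|\le u_{\max}\text{ for a.e. }t\in I,\ m=1,\dots,M\}$. Let $f_{L}\in L^2(\Omega)$ be a probability density and $d_{L}\in\mathbb R^{MD}$. A *state* for the control $\mathbf w$ is a pair $p=(f,d)\in\mathcal Y:=H^1(I,L^2(\Omega))\times H^1(I,\mathbb R^{MD})$ such that each $f_t$ is a probability density and $$\partial_t f_t+v\cdot\nabla_x f_t+\nabla_v\cdot\big(S(f_t)f_t\big)=0\ \text{ weakly on }\mathbb R^{2D},\qquad \frac{d}{dt}d=\mathbf w,\qquad f_{I_L}=f_L,\quad d(I_L)=d_L.$$ Assume that every $\mathbf w\in\mathcal U_{ad}$ has a state in $\mathcal Y$. Problem 2 on the slice $I$ is to minimize $$J_\infty(p,\mathbf w)=\int_I \frac{\sigma_1}{4T}\,|\mathbb V_\infty(f_t)-\bar V_\infty|^2+\frac{\sigma_2}{2T}\,|\mathbb E_\infty(f_t)-E_{\rm des}|^2+\frac{\sigma_3}{2M}\,|\mathbf w(t)|^2\,dt$$ over all pairs $(p,\mathbf w)\in\mathcal Y\times\mathcal U_{ad}$ such that $p$ is a state for $\mathbf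 w$. *Statement.* Let $(p_*,\mathbf w_*)$, $p_*=(f_*,d_*)$, be an optimal pair for Problem 2 on $I$. Then there is a pair $\varphi=(g,\varphi_d)\in\mathcal Y$, with in addition $g\in L^2(I,H^1(\Omega))$, such that $$\int_I\Big(\frac{\sigma_3}{M}\mathbf w_*(t)-\varphi_d(t)\Big)\cdot\big(\mathbf w(t)-\mathbf w_*(t)\big)\,dt\ \ge 0\qquad\text{for all }\mathbf w\in\mathcal U_{ad},$$ and such that $\varphi$ satisfies, with weak derivatives, almost everywhere in $I\times\Omega$ and in $I$ respectively, the adjoint system $$\partial_t g_t+v\cdot\nabla_x g_t=-S(f_{t,*})\cdot\nabla_v g_t-D_f(f_{t,*})[g_t]+d_{\mathbf x}J_\infty(t),\qquad \frac{d}{dt}\varphi_d=-D_{\mathbf d}(f_{t,*})[g_t],$$ with the terminal conditions $g_{I_R}=0$ and $\varphi_d(I_R)=0$. Here $S(f_{t,*})$ is evaluated at $d=d_*(t)$, $$D_f(f)[g](\bar z)=\int_\Omega K_1(\bar x,x)\cdot\nabla_v g(z)\,f(z)\,dz,\qquad D_{\mathbf d}(f_{t,*})[g]=\Big(\frac1M\int_\Omega(\nabla^2\Phi_2)(x-d_{m,*}(t))\,\nabla_v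 g(z)\,f_{t,*}(z)\,dz\Big)_{m=1,\dots,M}$$ (the Hessian $\nabla^2\Phi_2$ exists almost everywhere), and $$d_{\mathbf x}J_\infty(t)=\frac{\sigma_1}{2T}\big(\mathbb V_\infty(f_{t,*})-\bar V_\infty\big)\,|x-\mathbb E_\infty(f_{t,*})|^2+\frac{\sigma_2}{T}\big(\mathbb E_\infty(f_{t,*})-E_{\rm des}\big)\cdot x .$$ -/

import Mathlib

open MeasureTheory Set
open scoped ContDiff RealInnerProductSpace

namespace MeanFieldControl

/-- Position space and velocity space `ℝ^D` with the Euclidean norm. -/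
abbrev Space (D : ℕ) := EuclideanSpace ℝ (Fin D)

/-- Phase space `ℝ^{2D}`; a point is `z = (x, v)`. -/
abbrev Phase (D : ℕ) := Space D × Space D

/-- `ℝ^{MD}` with the Euclidean norm: positions, or velocities, of the `M` external agents. -/
abbrev Agents (M D : ℕ) := PiLp 2 (fun _ : Fin M => Space D)

/-- `L²(Ω; F)`. -/
noncomputable abbrev L2 {D : ℕ} (Ω : Set (Phase D)) (F : Type*) [NormedAddCommGroup F] :=
  Lp F 2 ((volume : Measure (Phase D)).restrict Ω)

/-- `u ∈ H¹((a,b); H)` (as its continuous representative on `[a,b]`) with weak derivative `u'`: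
`u' ∈ L²((a,b); H)` and `u(t) = u(a) + ∫_a^t u'(s) ds`. -/
def IsH1With {H : Type*} [NormedAddCommGroup H] [NormedSpace ℝ H] (a b : ℝ) (u u' : ℝ → H) :
    Prop :=
  MemLp u' 2 (volume.restrict (Icc a b)) ∧ ∀ t ∈ Icc a b, u t = u a + ∫ s in a..t, u' s

/-- `(ux, uv)` is the weak gradient `(∇_x u, ∇_v u)` of `u` on the open set `Ω`. -/
def IsWeakGradient {D : ℕ} (Ω : Set (Phase D)) (u : Phase D → ℝ) (ux uv : Phase D → Space D) :
    Prop :=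
  ∀ ψ : Phase D → ℝ, ContDiff ℝ ∞ ψ → HasCompactSupport ψ → tsupport ψ ⊆ Ω →
    ∀ e : Phase D, ∫ z in Ω, u z * fderiv ℝ ψ z e
      = - ∫ z in Ω, (⟪ux z, e.1⟫ + ⟪uv z, e.2⟫) * ψ z

/-- Assumption on an interaction potential: radially symmetric, continuously differentiable,
with locally Lipschitz and globally bounded gradient. -/
structure IsPotential {D : ℕ} (Φ : Space D → ℝ) : Prop where
  radial : ∀ x y, ‖x‖ = ‖y‖ → Φ x = Φ y
  contDiff : ContDiff ℝ 1 Φ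
  locallyLipschitz : LocallyLipschitz (gradient Φ)
  bounded : ∃ C, ∀ x, ‖gradient Φ x‖ ≤ C

/-- The parameters of the controlled mean-field model. -/
structure Model (D : ℕ) where
  /-- potential of the interaction among the individuals -/
  Φ₁ : Space D → ℝ
  /-- potential of the interaction of the individuals with the agents -/
  Φ₂ : Space D → ℝ
  /-- friction -/
  α : ℝ
  /-- time horizon -/
  T : ℝ
  σ₁ : ℝ
  σ₂ : ℝ
  σ₃ : ℝ
  /-- desired variance -/
  Vdes : ℝ
  /-- desired destination -/
  Edes : Space D
  /-- bound on the speed of each agent -/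
  umax : ℝ
  hΦ₁ : IsPotential Φ₁
  hΦ₂ : IsPotential Φ₂
  hα : 0 < α
  hT : 0 < T
  hσ₁ : 0 < σ₁
  hσ₂ : 0 < σ₂
  hσ₃ : 0 < σ₃
  hVdes : 0 < Vdes

/-- Center of mass `∬ x f dx dv`. -/
noncomputable def mean {D : ℕ} (Ω : Set (Phase D)) (f : Phase D → ℝ) : Space D :=
  ∫ z in Ω, f z • z.1

/-- Variance `∬ |x - E(f)|² f dx dv`. -/
noncomputable def variance {D : ℕ} (Ω : Set (Phase D)) (f : Phase D → ℝ) : ℝ :=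
  ∫ z in Ω, ‖z.1 - mean Ω f‖ ^ 2 * f z

/-- `f` is (on `Ω`) the density of a Borel probability measure that is carried by `Ω`. -/
def IsDensity {D : ℕ} (Ω : Set (Phase D)) (f : Phase D → ℝ) : Prop :=
  (∀ᵐ z ∂(volume.restrict Ω), 0 ≤ f z) ∧ ∫ z in Ω, f z = 1

namespace Model

variable {D : ℕ} (P : Model D)

/-- `K₁(x,y) = (∇Φ₁)(x - y)`. -/
noncomputable def K₁ (x y : Space D) : Space D := gradient P.Φ₁ (x - y)

/-- `K₂(x,y) = (∇Φ₂)(x - y)`. -/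
noncomputable def K₂ (x y : Space D) : Space D := gradient P.Φ₂ (x - y)

/-- The force `S(f)(x,v,d) = -(K₁ * ρ)(x) - (1/M) ∑_m K₂(x,d_m) - α v`. -/
noncomputable def S {M : ℕ} (Ω : Set (Phase D)) (f : Phase D → ℝ) (d : Agents M D)
    (z : Phase D) : Space D :=
  - (∫ y in Ω, f y • P.K₁ z.1 y.1) - (1 / (M : ℝ)) • ∑ m, P.K₂ z.1 (d m) - P.α • z.2

/-- Admissible controls on `[a,b]`: `w ∈ L²((a,b); ℝ^{MD})` with `|w_m(t)| ≤ umax` for a.e. `t`. -/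
def Admissible {M : ℕ} (a b : ℝ) (w : ℝ → Agents M D) : Prop :=
  MemLp w 2 (volume.restrict (Icc a b)) ∧
    ∀ᵐ t ∂(volume.restrict (Icc a b)), ∀ m, ‖w t m‖ ≤ P.umax

/-- `p = (f,d)` is a solution in `H¹((a,b); L²(Ω)) × H¹((a,b); ℝ^{MD})` of the state system
`∂_t f + v·∇_x f + ∇_v·(S(f) f) = 0`, `d' = w`, with `f(a) = fa`, `d(a) = da`.
Each `f(t)` is extended by zero to `ℝ^{2D}` and the equation holds weakly on all of `ℝ^{2D}`,
tested with `h ∈ C_c^∞((-∞,b) × ℝ^{2D})`. The number `fderiv ℝ h (t,z) (1, (v, S))` is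
`∂_t h + v·∇_x h + S·∇_v h`. -/
structure IsState {M : ℕ} (Ω : Set (Phase D)) (a b : ℝ) (fa : L2 Ω ℝ) (da : Agents M D)
    (f : ℝ → L2 Ω ℝ) (d : ℝ → Agents M D) (w : ℝ → Agents M D) : Prop where
  memH1 : ∃ f' : ℝ → L2 Ω ℝ, IsH1With a b f f'
  density : ∀ t ∈ Icc a b, IsDensity Ω (f t)
  init : f a = fa
  vlasov : ∀ h : ℝ × Phase D → ℝ, ContDiff ℝ ∞ h → HasCompactSupport h →
    (∀ q ∈ tsupport h, q.1 < b) →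
    (∫ t in Icc a b, ∫ z in Ω, fderiv ℝ h (t, z) (1, (z.2, P.S Ω (f t) (d t) z)) * f t z)
      + ∫ z in Ω, h (a, z) * f a z = 0
  agents : IsH1With a b d w
  agents_init : d a = da

/-- The cost functional on the time slice `[a,b]`. -/
noncomputable def J {M : ℕ} (Ω : Set (Phase D)) (a b : ℝ) (f : ℝ → L2 Ω ℝ)
    (w : ℝ → Agents M D) : ℝ :=
  ∫ t in Icc a b, (P.σ₁ / (4 * P.T) * |variance Ω (f t) - P.Vdes| ^ 2
    + P.σ₂ / (2 * P.T) * ‖mean Ω (f t) - P.Edes‖ ^ 2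
    + P.σ₃ / (2 * M) * ‖w t‖ ^ 2)

/-- `((f,d),w)` is an optimal pair of the mean-field control problem on `[a,b]`. -/
def IsOptimal {M : ℕ} (Ω : Set (Phase D)) (a b : ℝ) (fa : L2 Ω ℝ) (da : Agents M D)
    (f : ℝ → L2 Ω ℝ) (d : ℝ → Agents M D) (w : ℝ → Agents M D) : Prop :=
  (P.IsState Ω a b fa da f d w ∧ P.Admissible a b w) ∧
    ∀ (f₁ : ℝ → L2 Ω ℝ) (d₁ w₁ : ℝ → Agents M D),
      P.IsState Ω a b fa da f₁ d₁ w₁ → P.Admissible a b w₁ →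
        P.J Ω a b f w ≤ P.J Ω a b f₁ w₁

/-- The nonlocal term `D_f(f)[g](z̄) = ∫ K₁(x̄,x)·∇_v g(z) f(z) dz`, where `gv = ∇_v g`. -/
noncomputable def Df (Ω : Set (Phase D)) (f : Phase D → ℝ) (gv : Phase D → Space D)
    (y : Phase D) : ℝ :=
  ∫ z in Ω, ⟪P.K₁ y.1 z.1, gv z⟫ * f z

/-- `D_d(f)[g] = ∫ d_d S(f)[∇_v g] f dz`, where `gv = ∇_v g`; its `m`-th component is
`(1/M) ∫ (∇²Φ₂)(x - d_m) ∇_v g f dz`. The Hessian `∇²Φ₂` exists almost everywhere, as `∇Φ₂` is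
locally Lipschitz; exceptional points form a null set and do not matter in the integral. -/
noncomputable def Dd {M : ℕ} (Ω : Set (Phase D)) (f : Phase D → ℝ) (d : Agents M D)
    (gv : Phase D → Space D) : Agents M D :=
  WithLp.toLp 2 fun m =>
    (1 / (M : ℝ)) • ∫ z in Ω, f z • fderiv ℝ (gradient P.Φ₂) (z.1 - d m) (gv z)

/-- The density, at time `t` and at `z = (x,v)`, of the derivative of the cost with respect to
`f`. -/
noncomputable def dJ (Ω : Set (Phase D)) (f : Phase D → ℝ) (z : Phase D) : ℝ :=
  P.σ₁ / (2 * P.T) * (variance Ω f - P.Vdes) * ‖z.1 - mean Ω f‖ ^ 2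
    + P.σ₂ / P.T * ⟪mean Ω f - P.Edes, z.1⟫

/-- `(g, φ)` is a solution of the backward adjoint system along `(f,d)` on `[a,b]`:
`g ∈ H¹((a,b); L²(Ω)) ∩ L²((a,b); H¹(Ω))`, `φ ∈ H¹((a,b); ℝ^{MD})`,
`∂_t g + v·∇_x g = - S(f)·∇_v g - D_f(f)[g] + dJ`, `φ' = - D_d(f)[g]`, `g(b) = 0`, `φ(b) = 0`.
Here `gt = ∂_t g`, `gx = ∇_x g`, `gv = ∇_v g` are weak derivatives. -/
def IsAdjoint {M : ℕ} (Ω : Set (Phase D)) (a b : ℝ) (f : ℝ → L2 Ω ℝ) (d : ℝ → Agents M D)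
    (g : ℝ → L2 Ω ℝ) (φ : ℝ → Agents M D) : Prop :=
  ∃ (gt : ℝ → L2 Ω ℝ) (gx gv : ℝ → L2 Ω (Space D)),
    IsH1With a b g gt ∧
    MemLp gx 2 (volume.restrict (Icc a b)) ∧
    MemLp gv 2 (volume.restrict (Icc a b)) ∧
    (∀ᵐ t ∂(volume.restrict (Icc a b)), IsWeakGradient Ω (g t) (gx t) (gv t)) ∧
    (∀ᵐ t ∂(volume.restrict (Icc a b)), ∀ᵐ z ∂(volume.restrict Ω),
      gt t z + ⟪z.2, gx t z⟫ =
        - ⟪P.S Ω (f t) (d t) z, gv t z⟫ - P.Df Ω (f t) (gv t) z + P.dJ Ω (f t) z) ∧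
    IsH1With a b φ (fun t => - P.Dd Ω (f t) (d t) (gv t)) ∧
    g b = 0 ∧ φ b = 0

end Model

end MeanFieldControl

open Filter Topology
open scoped NNReal ENNReal

set_option linter.unusedSectionVars false

/-! The adjoint state can be constructed as a Lipschitz function. It then serves as a test function
for every state, so the optimality condition follows from a first order expansion of the cost,
without differentiating the control-to-state map.

Since `Ω` is bounded and the speed bound keeps the agents in a fixed ball, the kernels may be
replaced by globally Lipschitz ones (`exists_agreesWith`, `isRegState_of_isState`). The driving
field is then Lipschitz with a constant independent of the state, has a bi-Lipschitz flow, and has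
constant divergence `-αD`. Mollification admits Lipschitz test functions in the weak formulation
(`IsWeakSolution.integral_lipschitz`). Test functions that are constant along trajectories show that
each state is its initial density transported by its own flow (`IsWeakSolution.ae_eq_transported`).
Hence, if the agents of two states stay within `η` of each other, the flows differ by `O(η)`
(`displacement_le`, `norm_X_sub_le`). The densities differ in `L¹` by a quantity tending to zero
with `η`, without a rate because the initial density is only `L²` (`exists_integral_abs_sub_le`).

The adjoint equation is a transport equation along the optimal flow, whose source sees `g` only
through an average of `∇_v g` against a Lipschitz kernel. A bounded field `G` in place of `∇_v g`
therefore gives a source that is bounded and Lipschitz in `z`, and integrating it backward along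
characteristics gives a locally Lipschitz `g`. The map from `G` to `∇_v g` contracts in an
exponentially weighted `L^∞` norm (`AdjointData.exists_fixedPoint`). By Rademacher the resulting
equation holds almost everywhere, and the classical derivatives are the weak ones.

Now vary the control to `w + ε(u - w)` and take any state for it. Test both weak formulations with
`g` and subtract. Since `K₁` is odd, the nonlocal adjoint term cancels the variation of the force
exerted by the crowd (`AdjointData.fixed_time_identity`). What remains is the linear variation of
the cost, the coupling of `∇_v g` with the variation of the agents' force, and an error of size
`O(ε)` (field) times `o(1)` (density in `L¹`), which is `o(ε)` (`abs_duality_le`). The running cost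
is quadratic in mean and variance, which are Lipschitz in the agents' displacement, so its remainder
is `O(ε²)` (`exists_runCost_sub_le`). Dividing by `ε` and passing to the limit gives
`variation_nonneg`. The coupling converges by dominated convergence, because the Hessian of `Φ₂`
exists almost everywhere and the states are densities; symmetry of the Hessian identifies the limit.
Fubini in time finally moves the primitive of `u - w` onto `φ` (`inner_control_nonneg`). -/

namespace MeanFieldControl

/-! ### Flows of globally Lipschitz time-dependent fields. -/

section Flow

variable {E : Type*} [NormedAddCommGroup E] [NormedSpace ℝ E]

/-- The constant in the two-sided Grönwall estimate. -/
noncomputable def gronwallConst (K T : ℝ) : ℝ := Real.exp (K * T) * (1 + T)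

lemma one_le_gronwallConst {K T : ℝ} (hK : 0 ≤ K) (hT : 0 ≤ T) : 1 ≤ gronwallConst K T := by
  have h1 : 1 ≤ Real.exp (K * T) := Real.one_le_exp (by positivity)
  unfold gronwallConst
  nlinarith

/-- From `e^x - 1 ≤ x e^x` one gets a bound that is linear in `δ + ε` and needs no case distinction
at `K = 0`. -/
lemma gronwallBound_le_gronwallConst {δ K ε x T : ℝ} (hδ : 0 ≤ δ) (hK : 0 ≤ K) (hε : 0 ≤ ε)
    (hx : 0 ≤ x) (hxT : x ≤ T) : gronwallBound δ K ε x ≤ (δ + ε) * gronwallConst K T := by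
  have h1 : gronwallBound δ K ε x ≤ gronwallBound δ K ε T := gronwallBound_mono hδ hε hK hxT
  refine h1.trans ?_
  have hT : 0 ≤ T := hx.trans hxT
  unfold gronwallConst
  rcases eq_or_lt_of_le hK with h0 | h0
  · subst h0
    rw [gronwallBound_K0]
    simp only [zero_mul, Real.exp_zero, one_mul]
    nlinarith [mul_nonneg hδ hT]
  · rw [gronwallBound_of_K_ne_0 h0.ne']
    have h2 : Real.exp (K * T) - 1 ≤ (K * T) * Real.exp (K * T) := by
      have := Real.add_one_le_exp (-(K * T))
      have h3 : Real.exp (-(K * T)) * Real.exp (K * T) = 1 := by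
        rw [← Real.exp_add]; simp
      nlinarith [Real.exp_pos (K * T)]
    have h4 : ε / K * (Real.exp (K * T) - 1) ≤ ε * (T * Real.exp (K * T)) := by
      calc ε / K * (Real.exp (K * T) - 1) ≤ ε / K * ((K * T) * Real.exp (K * T)) := by gcongr
        _ = ε * (T * Real.exp (K * T)) := by field_simp
    have h5 : 0 ≤ δ * T * Real.exp (K * T) := by positivity
    have h6 : 0 ≤ ε * Real.exp (K * T) := by positivity
    nlinarith

lemma norm_le_gronwallConst_of_le {γ γ' : ℝ → E} {a b K ε : ℝ} (hK : 0 ≤ K) (hε : 0 ≤ ε)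
    (hγ : ∀ t ∈ Icc a b, HasDerivWithinAt γ (γ' t) (Icc a b) t)
    (hb : ∀ t ∈ Icc a b, ‖γ' t‖ ≤ K * ‖γ t‖ + ε) {s t : ℝ} (hs : s ∈ Icc a b) (ht : t ∈ Icc a b)
    (hst : s ≤ t) : ‖γ t‖ ≤ (‖γ s‖ + ε) * gronwallConst K (b - a) := by
  have hsub : Icc s t ⊆ Icc a b := Icc_subset_Icc hs.1 ht.2
  have h1 := norm_le_gronwallBound_of_norm_deriv_right_le (f := γ) (f' := γ') (δ := ‖γ s‖)
    (K := K) (ε := ε) (a := s) (b := t)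
    (fun x hx => ((hγ x (hsub hx)).continuousWithinAt).mono hsub)
    (fun x hx => by
      have hx' : x ∈ Icc a b := hsub ⟨hx.1, hx.2.le⟩
      refine (hγ x hx').mono_of_mem_nhdsWithin ?_
      refine mem_of_superset (Icc_mem_nhdsGE (hx.2)) (Icc_subset_Icc (hs.1.trans hx.1) ht.2))
    le_rfl (fun x hx => hb x (hsub ⟨hx.1, hx.2.le⟩)) t ⟨hst, le_rfl⟩
  exact h1.trans (gronwallBound_le_gronwallConst (norm_nonneg _) hK hε (by linarith)
    (by linarith [hs.1, ht.2]))

/-- Two-sided Grönwall inequality. -/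
lemma norm_le_gronwallConst {γ γ' : ℝ → E} {a b K ε : ℝ} (hK : 0 ≤ K) (hε : 0 ≤ ε)
    (hγ : ∀ t ∈ Icc a b, HasDerivWithinAt γ (γ' t) (Icc a b) t)
    (hb : ∀ t ∈ Icc a b, ‖γ' t‖ ≤ K * ‖γ t‖ + ε) {s t : ℝ} (hs : s ∈ Icc a b) (ht : t ∈ Icc a b) :
    ‖γ t‖ ≤ (‖γ s‖ + ε) * gronwallConst K (b - a) := by
  rcases le_total s t with hst | hst
  · exact norm_le_gronwallConst_of_le hK hε hγ hb hs ht hst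
  -- Backward in time, the estimate is the forward one for `τ ↦ γ (-τ)`.
  · have hmem : ∀ τ, τ ∈ Icc (-b) (-a) → -τ ∈ Icc a b := fun τ hτ =>
      ⟨by linarith [hτ.2], by linarith [hτ.1]⟩
    have := norm_le_gronwallConst_of_le (γ := fun τ => γ (-τ)) (γ' := fun τ => -γ' (-τ))
      (a := -b) (b := -a) hK hε
      (fun τ hτ => by
        have h1 := (hγ (-τ) (hmem τ hτ)).scomp τ (hasDerivAt_neg τ).hasDerivWithinAt
          (fun x hx => hmem x hx)
        simpa [Function.comp_def] using h1)
      (fun τ hτ => by simpa using hb _ (hmem τ hτ))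
      (s := -s) (t := -t) ⟨by linarith [hs.2], by linarith [hs.1]⟩
      ⟨by linarith [ht.2], by linarith [ht.1]⟩ (by linarith)
    simp only [neg_neg] at this
    convert this using 3
    ring

/-- `X` is the flow of `F` on `[a,b]` started at time `a`, and `Y t` is the inverse of `X t`; both
are extended to all times by clamping. -/
structure IsFlow (F : ℝ → E → E) (L : ℝ≥0) (a b : ℝ) (X Y : ℝ → E → E) : Prop where
  le : a ≤ b
  lip : ∀ t, LipschitzWith L (F t)
  cont : Continuous (Function.uncurry F)
  init : ∀ y, X a y = y
  deriv : ∀ y, ∀ t ∈ Icc a b, HasDerivWithinAt (fun s => X s y) (F t (X t y)) (Icc a b) t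
  right_inv : ∀ t z, X t (Y t z) = z
  left_inv : ∀ t z, Y t (X t z) = z
  clampX : ∀ t z, X t z = X (projIcc a b le t) z
  clampY : ∀ t z, Y t z = Y (projIcc a b le t) z

lemma exists_bound_zero {F : ℝ → E → E} (hc : Continuous (Function.uncurry F)) (a b : ℝ) :
    ∃ A, 0 ≤ A ∧ ∀ t ∈ Icc a b, ‖F t 0‖ ≤ A := by
  have h : Continuous fun t => F t 0 := hc.comp (Continuous.prodMk_left (0 : E))
  obtain ⟨A, hA⟩ := isCompact_Icc.exists_bound_of_continuousOn (h.continuousOn (s := Icc a b))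
  exact ⟨max A 0, le_max_right _ _, fun t ht => (hA t ht).trans (le_max_left _ _)⟩

lemma norm_le_of_lip {F : ℝ → E → E} {L : ℝ≥0} (hL : ∀ t, LipschitzWith L (F t)) {A t : ℝ}
    (hA : ‖F t 0‖ ≤ A) (z : E) : ‖F t z‖ ≤ L * ‖z‖ + A := by
  have h := (hL t).norm_sub_le z 0
  rw [sub_zero] at h
  have h2 := norm_sub_norm_le (F t z) (F t 0)
  linarith

/-- Picard–Lindelöf on the whole interval in one step needs a bounded field, while `F` may grow
linearly. So `F` is cut off outside a ball, and the a priori Grönwall bound `R` shows that the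
solution never leaves the region where the cutoff equals one. -/
lemma exists_solution_of_lipschitz [CompleteSpace E] {F : ℝ → E → E} {L : ℝ≥0} {a b : ℝ}
    (hL : ∀ t, LipschitzWith L (F t)) (hc : Continuous (Function.uncurry F)) {s : ℝ}
    (hs : s ∈ Icc a b) (z : E) :
    ∃ γ : ℝ → E, γ s = z ∧ ∀ t ∈ Icc a b, HasDerivWithinAt γ (F t (γ t)) (Icc a b) t := by
  obtain ⟨A, hA0, hA⟩ := exists_bound_zero hc a b
  set R : ℝ := (‖z‖ + A) * gronwallConst L (b - a) with hR
  have hab : 0 ≤ b - a := by linarith [hs.1, hs.2]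
  have hR0 : 0 ≤ R := by
    have := one_le_gronwallConst L.coe_nonneg hab
    positivity
  let χ : E → ℝ := fun x => max 0 (min 1 (R + 1 - ‖x‖))
  have χ0 : ∀ x, 0 ≤ χ x := fun x => le_max_left _ _
  have χ1 : ∀ x, χ x ≤ 1 := fun x => max_le zero_le_one (min_le_left _ _)
  have χz : ∀ x, R + 1 ≤ ‖x‖ → χ x = 0 := fun x hx =>
    max_eq_left ((min_le_right _ _).trans (by linarith))
  have χo : ∀ x, ‖x‖ ≤ R → χ x = 1 := fun x hx => by
    simp only [χ]
    rw [min_eq_left (by linarith), max_eq_right zero_le_one]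
  have χl : ∀ x y, |χ x - χ y| ≤ ‖x - y‖ := fun x y => by
    refine (abs_max_sub_max_le_max _ _ _ _).trans ?_
    refine max_le (by simp) ?_
    refine (abs_min_sub_min_le_max _ _ _ _).trans (max_le (by simp) ?_)
    have h1 : R + 1 - ‖x‖ - (R + 1 - ‖y‖) = ‖y‖ - ‖x‖ := by ring
    rw [h1, norm_sub_rev x y]
    exact abs_norm_sub_norm_le y x
  set B : ℝ := L * (R + 1) + A with hB
  have hB0 : 0 ≤ B := by positivity
  have hFb : ∀ t ∈ Icc a b, ∀ x, ‖x‖ ≤ R + 1 → ‖F t x‖ ≤ B := fun t ht x hx =>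
    (norm_le_of_lip hL (hA t ht) x).trans (by rw [hB]; gcongr)
  let G : ℝ → E → E := fun t x => χ x • F t x
  have hGle : ∀ t x, ‖G t x‖ ≤ ‖F t x‖ := fun t x => by
    simp only [G]
    rw [norm_smul, Real.norm_of_nonneg (χ0 x)]
    exact mul_le_of_le_one_left (norm_nonneg _) (χ1 x)
  have hGb : ∀ t ∈ Icc a b, ∀ x, ‖G t x‖ ≤ B := fun t ht x => by
    rcases le_total ‖x‖ (R + 1) with h | h
    · exact (hGle t x).trans (hFb t ht x h)
    · simp [G, χz x h, hB0]
  -- Only the point at which `F` is evaluated next to the difference of cutoffs has to lie in the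
  -- ball. If neither point does, both values of `G` vanish.
  have key : ∀ t ∈ Icc a b, ∀ x y, ‖y‖ ≤ R + 1 → ‖G t x - G t y‖ ≤ (L + B) * ‖x - y‖ := by
    intro t ht x y hy
    have e : G t x - G t y = χ x • (F t x - F t y) + (χ x - χ y) • F t y := by
      simp only [G]; module
    rw [e]
    refine (norm_add_le _ _).trans ?_
    rw [norm_smul, norm_smul, Real.norm_of_nonneg (χ0 x), Real.norm_eq_abs, add_mul]
    have h1 := (hL t).norm_sub_le x y
    have h2 := hFb t ht y hy
    have h3 := χl x y
    refine add_le_add ?_ ?_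
    · calc χ x * ‖F t x - F t y‖ ≤ 1 * ‖F t x - F t y‖ := by gcongr; exact χ1 x
        _ ≤ _ := by rw [one_mul]; exact h1
    · calc |χ x - χ y| * ‖F t y‖ ≤ ‖x - y‖ * B := by gcongr
        _ = _ := mul_comm _ _
  have hGl : ∀ t ∈ Icc a b, ∀ x y, ‖G t x - G t y‖ ≤ (L + B) * ‖x - y‖ := by
    intro t ht x y
    rcases le_total ‖y‖ (R + 1) with hy | hy
    · exact key t ht x y hy
    · rcases le_total ‖x‖ (R + 1) with hx | hx
      · rw [norm_sub_rev, norm_sub_rev x]; exact key t ht y x hx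
      · simp only [G, χz x hx, χz y hy, zero_smul, sub_zero, norm_zero]; positivity
  have hPL : IsPicardLindelof G (⟨s, hs⟩ : Icc a b) z (B.toNNReal * (b - a).toNNReal) 0
      B.toNNReal (L + B.toNNReal) := by
    refine ⟨fun t ht => ?_, fun x _ => ?_, fun t ht x _ => ?_, ?_⟩
    · refine LipschitzOnWith.of_dist_le_mul fun x _ y _ => ?_
      rw [dist_eq_norm, dist_eq_norm]
      simpa [Real.coe_toNNReal _ hB0] using hGl t ht x y
    · exact (continuous_const.smul (hc.comp (Continuous.prodMk_left x))).continuousOn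
    · rw [Real.coe_toNNReal _ hB0]; exact hGb t ht x
    · simp only [NNReal.coe_mul, Real.coe_toNNReal _ hB0, Real.coe_toNNReal _ hab,
        NNReal.coe_zero, sub_zero]
      gcongr
      exact max_le (by linarith [hs.1]) (by linarith [hs.2])
  obtain ⟨γ, hγs, hγ⟩ := hPL.exists_eq_forall_mem_Icc_hasDerivWithinAt₀
  have hγR : ∀ t ∈ Icc a b, ‖γ t‖ ≤ R := fun t ht => by
    have := norm_le_gronwallConst L.coe_nonneg hA0 hγ
      (fun t ht => (hGle t _).trans (norm_le_of_lip hL (hA t ht) _)) hs ht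
    rwa [show γ s = z from hγs] at this
  refine ⟨γ, hγs, fun t ht => ?_⟩
  have := hγ t ht
  simpa [G, χo _ (hγR t ht)] using this

/-- Grönwall for the difference of the two curves. The fields are compared along `γ₂` only, and only
`F₁` has to be Lipschitz; the comparison time `s` may lie on either side of `t`. -/
lemma norm_sub_le_of_solutions {F₁ F₂ : ℝ → E → E} {L : ℝ≥0} {a b ε : ℝ} {γ₁ γ₂ : ℝ → E}
    (hL : ∀ t, LipschitzWith L (F₁ t)) (hε : 0 ≤ ε)
    (h₁ : ∀ t ∈ Icc a b, HasDerivWithinAt γ₁ (F₁ t (γ₁ t)) (Icc a b) t)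
    (h₂ : ∀ t ∈ Icc a b, HasDerivWithinAt γ₂ (F₂ t (γ₂ t)) (Icc a b) t)
    (h : ∀ t ∈ Icc a b, ‖F₁ t (γ₂ t) - F₂ t (γ₂ t)‖ ≤ ε) {s t : ℝ} (hs : s ∈ Icc a b)
    (ht : t ∈ Icc a b) :
    ‖γ₁ t - γ₂ t‖ ≤ (‖γ₁ s - γ₂ s‖ + ε) * gronwallConst L (b - a) :=
  norm_le_gronwallConst (γ := fun t => γ₁ t - γ₂ t) L.coe_nonneg hε
    (fun t ht => (h₁ t ht).sub (h₂ t ht))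
    (fun t ht => by
      have h1 := (hL t).norm_sub_le (γ₁ t) (γ₂ t)
      have h2 := norm_sub_le_norm_sub_add_norm_sub (F₁ t (γ₁ t)) (F₁ t (γ₂ t)) (F₂ t (γ₂ t))
      linarith [h t ht]) hs ht

lemma exists_flow [CompleteSpace E] {F : ℝ → E → E} {L : ℝ≥0} {a b : ℝ} (hab : a ≤ b)
    (hL : ∀ t, LipschitzWith L (F t)) (hc : Continuous (Function.uncurry F)) :
    ∃ X Y, IsFlow F L a b X Y := by
  -- `Γ s z` is the solution through `z` at time `s`. The forward map reads the solution started at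
  -- `a`; the inverse map reads at time `a` the solution through the given point. Uniqueness makes
  -- them inverse to each other.
  choose! Γ hΓ0 hΓ using fun (s : ℝ) (z : E) (hs : s ∈ Icc a b) =>
    exists_solution_of_lipschitz (a := a) (b := b) hL hc hs z
  have hΓ0 : ∀ s ∈ Icc a b, ∀ z, Γ s z s = z := fun s hs z => hΓ0 s z hs
  have hΓ : ∀ s ∈ Icc a b, ∀ z, ∀ t ∈ Icc a b,
    HasDerivWithinAt (Γ s z) (F t (Γ s z t)) (Icc a b) t := fun s hs z => hΓ s z hs
  have ha : a ∈ Icc a b := ⟨le_rfl, hab⟩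
  have uniq : ∀ {γ₁ γ₂ : ℝ → E}, (∀ t ∈ Icc a b, HasDerivWithinAt γ₁ (F t (γ₁ t)) (Icc a b) t) →
      (∀ t ∈ Icc a b, HasDerivWithinAt γ₂ (F t (γ₂ t)) (Icc a b) t) → ∀ s ∈ Icc a b,
      γ₁ s = γ₂ s → ∀ t ∈ Icc a b, γ₁ t = γ₂ t := by
    intro γ₁ γ₂ h₁ h₂ s hs h t ht
    have := norm_sub_le_of_solutions hL le_rfl h₁ h₂ (fun t _ => by simp) hs ht
    rw [h, sub_self, norm_zero, add_zero, zero_mul] at this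
    exact sub_eq_zero.1 (norm_le_zero_iff.1 this)
  let p : ℝ → ℝ := fun t => projIcc a b hab t
  have hp : ∀ t, p t ∈ Icc a b := fun t => (projIcc a b hab t).2
  have hp' : ∀ t ∈ Icc a b, p t = t := fun t ht => by simp [p, projIcc_of_mem hab ht]
  refine ⟨fun t y => Γ a y (p t), fun t z => Γ (p t) z a, ⟨hab, hL, hc, fun y => ?_,
    fun y t ht => ?_, fun t z => ?_, fun t z => ?_, fun t z => ?_, fun t z => ?_⟩⟩
  · simp only [hp' a ha]; exact hΓ0 a ha y
  · simp only [hp' t ht]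
    exact (hΓ a ha y t ht).congr (fun s hs => by simp only [hp' s hs]) (by simp only [hp' t ht])
  · exact (uniq (hΓ a ha _) (hΓ (p t) (hp t) z) a ha (hΓ0 a ha _) (p t) (hp t)).trans
      (hΓ0 (p t) (hp t) z)
  · exact (uniq (hΓ (p t) (hp t) _) (hΓ a ha z) (p t) (hp t) (hΓ0 (p t) (hp t) _) a ha).trans
      (hΓ0 a ha z)
  · simp only [p]; congr 1; simp
  · simp only [p]; congr 1; simp

namespace IsFlow

variable {F : ℝ → E → E} {L : ℝ≥0} {a b : ℝ} {X Y : ℝ → E → E}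

lemma dist_X (h : IsFlow F L a b X Y) (t : ℝ) (y z : E) :
    ‖X t y - X t z‖ ≤ gronwallConst L (b - a) * ‖y - z‖ := by
  rw [h.clampX t y, h.clampX t z]
  have := norm_sub_le_of_solutions (s := a) h.lip le_rfl (h.deriv y) (h.deriv z)
    (fun t _ => by simp) ⟨le_rfl, h.le⟩ (projIcc a b h.le t).2
  simpa [h.init, mul_comm] using this

lemma dist_Y (h : IsFlow F L a b X Y) (t : ℝ) (y z : E) :
    ‖Y t y - Y t z‖ ≤ gronwallConst L (b - a) * ‖y - z‖ := by
  rw [h.clampY t y, h.clampY t z]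
  have hs := (projIcc a b h.le t).2
  generalize (projIcc a b h.le t : ℝ) = s at hs ⊢
  have := norm_sub_le_of_solutions (s := s) (t := a) h.lip le_rfl (h.deriv (Y s y))
    (h.deriv (Y s z)) (fun t _ => by simp) hs ⟨le_rfl, h.le⟩
  simpa [h.init, h.right_inv, mul_comm] using this

lemma const_nonneg (h : IsFlow F L a b X Y) : 0 ≤ gronwallConst L (b - a) :=
  zero_le_one.trans (one_le_gronwallConst L.coe_nonneg (sub_nonneg.2 h.le))

lemma lipX (h : IsFlow F L a b X Y) (t : ℝ) :
    LipschitzWith (gronwallConst L (b - a)).toNNReal (X t) :=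
  LipschitzWith.of_dist_le_mul fun y z => by
    rw [dist_eq_norm, dist_eq_norm, Real.coe_toNNReal _ h.const_nonneg]; exact h.dist_X t y z

lemma lipY (h : IsFlow F L a b X Y) (t : ℝ) :
    LipschitzWith (gronwallConst L (b - a)).toNNReal (Y t) :=
  LipschitzWith.of_dist_le_mul fun y z => by
    rw [dist_eq_norm, dist_eq_norm, Real.coe_toNNReal _ h.const_nonneg]; exact h.dist_Y t y z

/-- Trajectories through a point of a fixed ball stay in a fixed ball. -/
lemma exists_bound (h : IsFlow F L a b X Y) (R : ℝ) : ∃ B, 0 ≤ B ∧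
    ∀ s t y, ‖X s y‖ ≤ R → ‖X t y‖ ≤ B := by
  obtain ⟨A, hA0, hA⟩ := exists_bound_zero h.cont a b
  refine ⟨(max R 0 + A) * gronwallConst L (b - a), ?_, fun s t y hy => ?_⟩
  · have := h.const_nonneg
    have := le_max_right R 0
    positivity
  · rw [h.clampX t y]
    rw [h.clampX s y] at hy
    refine (norm_le_gronwallConst L.coe_nonneg hA0 (h.deriv y)
      (fun t ht => norm_le_of_lip h.lip (hA t ht) _) (projIcc a b h.le s).2
      (projIcc a b h.le t).2).trans ?_
    have := h.const_nonneg
    gcongr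
    exact hy.trans (le_max_left _ _)

lemma exists_bound_X (h : IsFlow F L a b X Y) (R : ℝ) : ∃ B, 0 ≤ B ∧
    ∀ t y, ‖y‖ ≤ R → ‖X t y‖ ≤ B := by
  obtain ⟨B, hB0, hB⟩ := h.exists_bound R
  exact ⟨B, hB0, fun t y hy => hB a t y (by rwa [h.init])⟩

/-- A trajectory that meets a ball at some time stays in a larger ball, on which the field is
bounded. The time `r` of the meeting is free, so that the estimate also applies to the inverse flow.
-/
lemma exists_time_lipschitz (h : IsFlow F L a b X Y) (R : ℝ) : ∃ C, 0 ≤ C ∧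
    ∀ r, ∀ y, ‖X r y‖ ≤ R → ∀ s t, ‖X s y - X t y‖ ≤ C * |s - t| := by
  obtain ⟨B, hB0, hB⟩ := h.exists_bound R
  obtain ⟨A, hA0, hA⟩ := exists_bound_zero h.cont a b
  refine ⟨L * B + A, by positivity, fun r y hy s t => ?_⟩
  rw [h.clampX s y, h.clampX t y]
  have := (convex_Icc a b).norm_image_sub_le_of_norm_hasDerivWithin_le (C := L * B + A)
    (h.deriv y) (fun τ hτ => (norm_le_of_lip h.lip (hA τ hτ) _).trans (by
      gcongr
      exact hB r τ y hy)) (projIcc a b h.le t).2 (projIcc a b h.le s).2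
  refine this.trans ?_
  gcongr
  rw [Real.norm_eq_abs]
  have := (LipschitzWith.projIcc h.le).dist_le_mul s t
  simpa [Subtype.dist_eq, Real.dist_eq] using this

lemma exists_lipschitz_X (h : IsFlow F L a b X Y) (R : ℝ) : ∃ C, 0 ≤ C ∧
    ∀ s t y z, ‖y‖ ≤ R → ‖X s y - X t z‖ ≤ C * (|s - t| + ‖y - z‖) := by
  obtain ⟨C, hC0, hC⟩ := h.exists_time_lipschitz R
  have hg := h.const_nonneg
  refine ⟨C + gronwallConst L (b - a), by positivity, fun s t y z hy => ?_⟩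
  have h1 := hC a y (by rwa [h.init]) s t
  have h2 := h.dist_X t y z
  have h3 := norm_sub_le_norm_sub_add_norm_sub (X s y) (X t y) (X t z)
  nlinarith [abs_nonneg (s - t), norm_nonneg (y - z)]

/-- The identity `Y s y = Y t (X t (Y s y))` reduces a change of time in `Y` to the displacement
along one trajectory between the times `s` and `t`, where the trajectory passes through `y` at time
`s`. -/
lemma exists_lipschitz_Y (h : IsFlow F L a b X Y) (R : ℝ) : ∃ C, 0 ≤ C ∧
    ∀ s t y z, ‖y‖ ≤ R → ‖Y s y - Y t z‖ ≤ C * (|s - t| + ‖y - z‖) := by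
  obtain ⟨C, hC0, hC⟩ := h.exists_time_lipschitz R
  have hg := h.const_nonneg
  refine ⟨gronwallConst L (b - a) * (C + 1), by positivity, fun s t y z hy => ?_⟩
  have h1 := hC s (Y s y) (by rwa [h.right_inv]) t s
  rw [h.right_inv] at h1
  have h2 := h.dist_Y t (X t (Y s y)) z
  rw [h.left_inv] at h2
  have h3 := norm_sub_le_norm_sub_add_norm_sub (X t (Y s y)) y z
  rw [abs_sub_comm] at h1
  refine h2.trans ?_
  rw [mul_assoc]
  gcongr
  nlinarith [abs_nonneg (s - t), norm_nonneg (y - z)]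

/-- Only one of the two points is required to lie in the ball, so the radius can be taken to be the
norm of the base point. -/
lemma continuous_of_exists_lipschitz {Z : ℝ → E → E}
    (h : ∀ R : ℝ, ∃ C, 0 ≤ C ∧ ∀ s t y z, ‖y‖ ≤ R → ‖Z s y - Z t z‖ ≤ C * (|s - t| + ‖y - z‖)) :
    Continuous (Function.uncurry Z) := by
  refine continuous_iff_continuousAt.2 fun ⟨t, z⟩ => ?_
  obtain ⟨C, hC0, hC⟩ := h ‖z‖
  rw [ContinuousAt, tendsto_iff_norm_sub_tendsto_zero]
  refine squeeze_zero (g := fun p : ℝ × E => C * (|t - p.1| + ‖z - p.2‖))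
    (fun _ => norm_nonneg _) (fun p => ?_) ?_
  · rw [norm_sub_rev]; exact hC t p.1 z p.2 le_rfl
  · have : Continuous fun p : ℝ × E => C * (|t - p.1| + ‖z - p.2‖) := by fun_prop
    simpa using this.tendsto (t, z)

lemma continuous_X (h : IsFlow F L a b X Y) : Continuous (Function.uncurry X) :=
  continuous_of_exists_lipschitz h.exists_lipschitz_X

lemma continuous_Y (h : IsFlow F L a b X Y) : Continuous (Function.uncurry Y) :=
  continuous_of_exists_lipschitz h.exists_lipschitz_Y

lemma hasDerivAt (h : IsFlow F L a b X Y) (y : E) {t : ℝ} (ht : t ∈ Ioo a b) :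
    HasDerivAt (fun s => X s y) (F t (X t y)) t :=
  (h.deriv y t (Ioo_subset_Icc_self ht)).hasDerivAt (Icc_mem_nhds ht.1 ht.2)

end IsFlow

end Flow

/-! ### Smooth approximation of Lipschitz functions. -/

section Mollification

variable {V : Type*} [NormedAddCommGroup V] [NormedSpace ℝ V] [FiniteDimensional ℝ V]
  [MeasurableSpace V] [BorelSpace V] {μ : Measure V} [μ.IsAddHaarMeasure]

-- Translation invariance moves the difference quotient of the convolution onto `h`. The quotients
-- of `h` converge weakly to its line derivative, and the limit of the quotients is unique.
open ContinuousLinearMap in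
lemma lineDeriv_convolution_eq {φ : ContDiffBump (0 : V)} {h : V → ℝ} {C : ℝ≥0}
    (hh : LipschitzWith C h) (x e : V) :
    fderiv ℝ (convolution (φ.normed μ) h (lsmul ℝ ℝ) μ) x e
      = convolution (φ.normed μ) (fun y => lineDeriv ℝ h y e) (lsmul ℝ ℝ) μ x := by
  have hsm : ContDiff ℝ ∞ (convolution (φ.normed μ) h (lsmul ℝ ℝ) μ) :=
    φ.hasCompactSupport_normed.contDiff_convolution_left (n := ⊤) (lsmul ℝ ℝ) φ.contDiff_normed
      hh.continuous.locallyIntegrable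
  have hd : DifferentiableAt ℝ (convolution (φ.normed μ) h (lsmul ℝ ℝ) μ) x :=
    hsm.differentiable (by simp) x
  have hφi : Integrable (fun y => φ.normed μ (x - y)) μ := by
    have := (φ.integrable_normed (μ := μ)).comp_sub_left x
    exact this
  have h1 := hh.integral_inv_smul_sub_mul_tendsto_integral_lineDeriv_mul hφi e
  have h2 : Tendsto (fun t : ℝ => t⁻¹ • (convolution (φ.normed μ) h (lsmul ℝ ℝ) μ (x + t • e)
      - convolution (φ.normed μ) h (lsmul ℝ ℝ) μ x)) (𝓝[>] 0)
      (𝓝 (fderiv ℝ (convolution (φ.normed μ) h (lsmul ℝ ℝ) μ) x e)) := by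
    have := (hd.hasFDerivAt.hasLineDerivAt e).tendsto_slope_zero_right
    simpa using this
  have hcomp : ∀ z, convolution (φ.normed μ) h (lsmul ℝ ℝ) μ z
      = ∫ y, φ.normed μ (z - y) * h y ∂μ := fun z => by
    rw [convolution_lsmul_swap]; rfl
  have hint : ∀ z : V, ∀ w : V, Integrable (fun y => φ.normed μ (z - y) * h (y + w)) μ := by
    intro z w
    refine Continuous.integrable_of_hasCompactSupport ?_ ?_
    · exact (φ.continuous_normed.comp (by fun_prop)).mul (hh.continuous.comp (by fun_prop))
    · refine HasCompactSupport.mul_right ?_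
      exact φ.hasCompactSupport_normed.comp_homeomorph (Homeomorph.subLeft z)
  have h3 : ∀ t : ℝ, t⁻¹ • (convolution (φ.normed μ) h (lsmul ℝ ℝ) μ (x + t • e)
      - convolution (φ.normed μ) h (lsmul ℝ ℝ) μ x)
      = ∫ y, (t⁻¹ • (h (y + t • e) - h y)) * φ.normed μ (x - y) ∂μ := by
    intro t
    have e1 : ∫ y, φ.normed μ (x + t • e - y) * h y ∂μ
        = ∫ y, φ.normed μ (x - y) * h (y + t • e) ∂μ := by
      rw [← integral_add_right_eq_self _ (t • e)]
      congr 1 with y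
      rw [add_sub_add_right_eq_sub]
    rw [hcomp, hcomp, e1, ← integral_sub (hint x _) (by simpa using hint x 0), smul_eq_mul,
      ← integral_const_mul]
    congr 1 with y
    simp only [smul_eq_mul]; ring
  have h4 := tendsto_nhds_unique (h2.congr h3) h1
  rw [h4, convolution_lsmul_swap]
  congr 1 with y
  simp [mul_comm]

/-- Approximation of a Lipschitz function by smooth functions with the same Lipschitz constant,
uniformly and with a.e. convergence of the derivatives. -/
lemma exists_smooth_approx (μ : Measure V) [μ.IsAddHaarMeasure] {h : V → ℝ} {C : ℝ≥0}
    (hh : LipschitzWith C h) :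
    ∃ u : ℕ → V → ℝ, (∀ n, ContDiff ℝ ∞ (u n)) ∧ (∀ n x, ‖fderiv ℝ (u n) x‖ ≤ C) ∧
      (∀ n x, |u n x - h x| ≤ C * (1 / ((n : ℝ) + 1))) ∧
      ∀ᵐ x ∂μ, ∀ e, Tendsto (fun n => fderiv ℝ (u n) x e) atTop (𝓝 (fderiv ℝ h x e)) := by
  -- The inner radius is half the outer one: a bounded ratio of the radii is what convergence at
  -- almost every point requires.
  let φ : ℕ → ContDiffBump (0 : V) := fun n =>
    ⟨1 / ((n : ℝ) + 1) / 2, 1 / ((n : ℝ) + 1), by positivity, half_lt_self (by positivity)⟩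
  have hφ : Tendsto (fun n => (φ n).rOut) atTop (𝓝 0) := tendsto_one_div_add_atTop_nhds_zero_nat
  have hφ' : ∀ᶠ n in atTop, (φ n).rOut ≤ 2 * (φ n).rIn := Eventually.of_forall fun n => by
    simp only [φ]; linarith
  refine ⟨fun n => convolution ((φ n).normed μ) h (ContinuousLinearMap.lsmul ℝ ℝ) μ,
    fun n => ?_, fun n x => ?_, fun n x => ?_, ?_⟩
  · exact (φ n).hasCompactSupport_normed.contDiff_convolution_left (n := ⊤) _
      (φ n).contDiff_normed hh.continuous.locallyIntegrable
  · refine norm_fderiv_le_of_lipschitz ℝ (LipschitzWith.of_dist_le_mul fun x y => ?_)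
    have hcs : ∀ x, Integrable (fun t => (φ n).normed μ t * h (x - t)) μ := fun x => by
      refine Continuous.integrable_of_hasCompactSupport ?_ ?_
      · exact (φ n).continuous_normed.mul (hh.continuous.comp (by fun_prop))
      · exact (φ n).hasCompactSupport_normed.mul_right
    rw [Real.dist_eq]
    simp only [convolution_def]
    simp only [ContinuousLinearMap.lsmul_apply, smul_eq_mul]
    rw [← integral_sub (hcs x) (hcs y)]
    calc |∫ t, ((φ n).normed μ t * h (x - t) - (φ n).normed μ t * h (y - t)) ∂μ|
        ≤ ∫ t, (φ n).normed μ t * (C * dist x y) ∂μ := by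
          rw [← Real.norm_eq_abs]
          refine norm_integral_le_of_norm_le ?_ (Eventually.of_forall fun t => ?_)
          · exact (φ n).integrable_normed.mul_const _
          · rw [← mul_sub, norm_mul, Real.norm_of_nonneg ((φ n).nonneg_normed t)]
            refine mul_le_mul_of_nonneg_left ?_ ((φ n).nonneg_normed t)
            have := hh.dist_le_mul (x - t) (y - t)
            rwa [dist_sub_right] at this
      _ = C * dist x y := by rw [integral_mul_const, (φ n).integral_normed, one_mul]
  · rw [← Real.dist_eq]
    refine ContDiffBump.dist_normed_convolution_le hh.continuous.aestronglyMeasurable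
      fun y hy => ?_
    refine (hh.dist_le_mul y x).trans ?_
    gcongr
    exact (Metric.mem_ball.1 hy).le
  -- Convergence in finitely many basis directions, together with differentiability of `h` almost
  -- everywhere, gives one null set for all directions.
  · let B := Module.finBasis ℝ V
    have h1 : ∀ᵐ x ∂μ, ∀ i, Tendsto (fun n => fderiv ℝ
        (convolution ((φ n).normed μ) h (ContinuousLinearMap.lsmul ℝ ℝ) μ) x (B i)) atTop
        (𝓝 (lineDeriv ℝ h x (B i))) := by
      refine ae_all_iff.2 fun i => ?_
      have := ContDiffBump.ae_convolution_tendsto_right_of_locallyIntegrable (μ := μ) hφ hφ'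
        (hh.locallyIntegrable_lineDeriv (μ := μ) (B i))
      filter_upwards [this] with x hx
      exact hx.congr fun n => (lineDeriv_convolution_eq hh x (B i)).symm
    filter_upwards [h1, hh.ae_differentiableAt (μ := μ)] with x hx hd e
    have h2 : ∀ i, Tendsto (fun n => fderiv ℝ
        (convolution ((φ n).normed μ) h (ContinuousLinearMap.lsmul ℝ ℝ) μ) x (B i)) atTop
        (𝓝 (fderiv ℝ h x (B i))) := fun i => by
      rw [← hd.lineDeriv_eq_fderiv]; exact hx i
    rw [← B.sum_repr e]
    simp only [map_sum, map_smul]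
    exact tendsto_finsetSum _ fun i _ => (h2 i).const_smul _

end Mollification

instance instIsAddHaarMeasurePhase (D : ℕ) : (volume : Measure (Phase D)).IsAddHaarMeasure :=
  Measure.prod.instIsAddHaarMeasure _ _

instance instIsAddHaarMeasureTimePhase (D : ℕ) :
    (volume : Measure (ℝ × Phase D)).IsAddHaarMeasure :=
  Measure.prod.instIsAddHaarMeasure _ _

/-! ### Continuity of pairings of an `L²` path with a continuous kernel. -/

section Pairing

variable {Z : Type*} [MeasurableSpace Z] {μ : Measure Z} [IsFiniteMeasure μ]

lemma integrable_L2 (f : Lp ℝ 2 μ) : Integrable f μ :=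
  (Lp.memLp f).integrable one_le_two

lemma exists_L1_le_L2 (μ : Measure Z) [IsFiniteMeasure μ] :
    ∃ C : ℝ, 0 ≤ C ∧ ∀ f : Lp ℝ 2 μ, ∫ z, ‖f z‖ ∂μ ≤ C * ‖f‖ := by
  refine ⟨(μ univ ^ (1 / (1 : ℝ≥0∞).toReal - 1 / (2 : ℝ≥0∞).toReal)).toReal,
    ENNReal.toReal_nonneg, fun f => ?_⟩
  have h := eLpNorm_le_eLpNorm_mul_rpow_measure_univ (μ := μ) (f := f) (p := 1) (q := 2)
    one_le_two (Lp.aestronglyMeasurable f)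
  rw [integral_norm_eq_lintegral_enorm (Lp.aestronglyMeasurable f), ← eLpNorm_one_eq_lintegral_enorm,
    Lp.norm_def, ← ENNReal.toReal_mul, mul_comm]
  refine ENNReal.toReal_mono ?_ h
  refine ENNReal.mul_ne_top (Lp.eLpNorm_ne_top f) ?_
  refine ENNReal.rpow_ne_top_of_nonneg (by norm_num) (measure_ne_top _ _)

end Pairing

section PairingPhase

variable {Z : Type*} [MeasurableSpace Z] [TopologicalSpace Z] [BorelSpace Z] [T2Space Z]
  {H : Type*} [NormedAddCommGroup H] [NormedSpace ℝ H] [SecondCountableTopology H]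
  [MeasurableSpace H] [BorelSpace H]
  {P : Type*} [TopologicalSpace P] {μ : Measure Z} [IsFiniteMeasure μ] {K : Set Z}

lemma integrable_smul_of_continuous (hK : IsCompact K) (hμ : ∀ᵐ z ∂μ, z ∈ K) {f : Z → ℝ}
    (hf : Integrable f μ) {c : Z → H} (hc : Continuous c) : Integrable (fun z => f z • c z) μ := by
  obtain ⟨B, hB⟩ := hK.exists_bound_of_continuousOn hc.continuousOn
  refine Integrable.mono' (hf.norm.mul_const B) (hf.aestronglyMeasurable.smul
    hc.measurable.aestronglyMeasurable) ?_
  filter_upwards [hμ] with z hz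
  rw [norm_smul]
  gcongr
  exact hB z hz

/-- The measure lives on a compact set, on which the kernels converge uniformly as the parameter
tends to `p₀`. The `L²` convergence of the functions gives `L¹` convergence by finiteness of the
measure. -/
lemma continuous_pairing (hK : IsCompact K) (hμ : ∀ᵐ z ∂μ, z ∈ K) {f : P → Lp ℝ 2 μ}
    (hf : Continuous f) {c : P → Z → H} (hc : Continuous (Function.uncurry c)) :
    Continuous fun p => ∫ z, f p z • c p z ∂μ := by
  obtain ⟨C, hC0, hC⟩ := exists_L1_le_L2 μ
  refine continuous_iff_continuousAt.2 fun p₀ => ?_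
  have hcp : ∀ p, Continuous (c p) := fun p => hc.comp (Continuous.prodMk_right p)
  obtain ⟨B, hB⟩ := hK.exists_bound_of_continuousOn (hcp p₀).continuousOn
  have hB' : ∀ᵐ z ∂μ, ‖c p₀ z‖ ≤ B := hμ.mono hB
  have hunif : ∀ ε > 0, ∀ᶠ p in 𝓝 p₀, ∀ z ∈ K, ‖c p z - c p₀ z‖ < ε := by
    intro ε hε
    refine hK.eventually_forall_of_forall_eventually fun z _ => ?_
    have : Continuous fun q : P × Z => ‖c q.1 q.2 - c p₀ q.2‖ := by
      have h2 : Continuous fun q : P × Z => c p₀ q.2 := (hcp p₀).comp continuous_snd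
      exact (hc.sub h2).norm
    have h1 := this.tendsto (p₀, z)
    simp only [sub_self, norm_zero] at h1
    exact h1.eventually (gt_mem_nhds hε)
  rw [ContinuousAt, Metric.tendsto_nhds]
  intro ε hε
  set A : ℝ := ∫ z, ‖f p₀ z‖ ∂μ
  have hA : 0 ≤ A := integral_nonneg fun _ => norm_nonneg _
  have hft : ∀ᶠ p in 𝓝 p₀, C * ‖f p - f p₀‖ * (|B| + 1) < ε / 2 := by
    have : Continuous fun p => C * ‖f p - f p₀‖ * (|B| + 1) := by fun_prop
    have h1 := this.tendsto p₀
    simp only [sub_self, norm_zero, mul_zero, zero_mul] at h1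
    exact h1.eventually (gt_mem_nhds (half_pos hε))
  filter_upwards [hft, hunif 1 one_pos, hunif (ε / 2 / (A + 1)) (by positivity)] with p h1 h2 h3
  rw [dist_eq_norm, ← integral_sub (integrable_smul_of_continuous hK hμ (integrable_L2 _) (hcp p))
    (integrable_smul_of_continuous hK hμ (integrable_L2 _) (hcp p₀))]
  have hle : ∀ᵐ z ∂μ, ‖f p z • c p z - f p₀ z • c p₀ z‖
      ≤ ‖(f p - f p₀) z‖ * (|B| + 1) + ‖f p₀ z‖ * (ε / 2 / (A + 1)) := by
    filter_upwards [hμ, hB', Lp.coeFn_sub (f p) (f p₀)] with z hz hbz hs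
    rw [hs, Pi.sub_apply]
    have e : f p z • c p z - f p₀ z • c p₀ z
        = (f p z - f p₀ z) • c p z + f p₀ z • (c p z - c p₀ z) := by module
    rw [e]
    refine (norm_add_le _ _).trans ?_
    rw [norm_smul, norm_smul]
    have h4 : ‖c p z‖ ≤ |B| + 1 := by
      have := norm_le_norm_add_norm_sub' (c p z) (c p₀ z)
      have := h2 z hz
      have := le_abs_self B
      linarith
    have h5 := (h3 z hz).le
    gcongr
  have hi1 : Integrable (fun z => ‖(f p - f p₀) z‖ * (|B| + 1)) μ :=
    (integrable_L2 (f p - f p₀)).norm.mul_const _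
  have hi2 : Integrable (fun z => ‖f p₀ z‖ * (ε / 2 / (A + 1))) μ :=
    (integrable_L2 (f p₀)).norm.mul_const _
  calc ‖∫ z, (f p z • c p z - f p₀ z • c p₀ z) ∂μ‖
      ≤ ∫ z, (‖(f p - f p₀) z‖ * (|B| + 1) + ‖f p₀ z‖ * (ε / 2 / (A + 1))) ∂μ :=
        norm_integral_le_of_norm_le (hi1.add hi2) hle
    _ = (∫ z, ‖(f p - f p₀) z‖ ∂μ) * (|B| + 1) + A * (ε / 2 / (A + 1)) := by
        rw [integral_add hi1 hi2, integral_mul_const, integral_mul_const]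
    _ ≤ C * ‖f p - f p₀‖ * (|B| + 1) + ε / 2 := by
        refine add_le_add ?_ ?_
        · gcongr; exact hC _
        · rw [← mul_div_assoc, div_le_iff₀ (by positivity)]
          nlinarith
    _ < ε := by linarith

end PairingPhase

/-! ### Truncation of the kernels to bounded, globally Lipschitz ones. -/

section Clamp

variable {D : ℕ}

/-- Coordinatewise projection to the cube `[-R,R]^D`. -/
noncomputable def clampVec (R : ℝ) (x : Space D) : Space D :=
  WithLp.toLp 2 fun i => max (-R) (min R (x i))

lemma lipschitzWith_clampVec (R : ℝ) : LipschitzWith 1 (clampVec (D := D) R) := by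
  refine LipschitzWith.of_dist_le_mul fun x y => ?_
  rw [NNReal.coe_one, one_mul, EuclideanSpace.dist_eq, EuclideanSpace.dist_eq]
  refine Real.sqrt_le_sqrt (Finset.sum_le_sum fun i _ => ?_)
  gcongr
  simp only [clampVec, Real.dist_eq]
  refine (abs_max_sub_max_le_max _ _ _ _).trans (max_le (by simp) ?_)
  exact (abs_min_sub_min_le_max _ _ _ _).trans (max_le (by simp) le_rfl)

lemma clampVec_of_norm_le {R : ℝ} {x : Space D} (hx : ‖x‖ ≤ R) : clampVec R x = x := by
  ext i
  have h1 : |x i| ≤ R := (PiLp.norm_apply_le x i).trans hx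
  rw [abs_le] at h1
  simp [clampVec, min_eq_right h1.2, max_eq_right h1.1]

lemma exists_bound_clampVec (D : ℕ) (R : ℝ) :
    ∃ B, 0 ≤ B ∧ ∀ x : Space D, ‖clampVec R x‖ ≤ B := by
  refine ⟨Real.sqrt (∑ _i : Fin D, |R| ^ 2), Real.sqrt_nonneg _, fun x => ?_⟩
  rw [EuclideanSpace.norm_eq]
  refine Real.sqrt_le_sqrt (Finset.sum_le_sum fun i _ => ?_)
  gcongr
  simp only [clampVec, Real.norm_eq_abs]
  exact abs_le.2 ⟨(neg_le_neg (le_abs_self R)).trans (le_max_left _ _),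
    max_le (neg_le_abs R) ((min_le_left _ _).trans (le_abs_self R))⟩

/-- A gradient field agrees on any ball with a bounded and globally Lipschitz field. -/
lemma exists_lipschitz_bounded_eqOn {Φ : Space D → ℝ} (hΦ : IsPotential Φ) (R : ℝ) :
    ∃ (K : Space D → Space D) (L : ℝ≥0) (B : ℝ), LipschitzWith L K ∧ (∀ x, ‖K x‖ ≤ B) ∧
      ∀ x, ‖x‖ ≤ R → K x = gradient Φ x := by
  obtain ⟨B₀, -, hB₀⟩ := exists_bound_clampVec D R
  obtain ⟨B, hB⟩ := hΦ.bounded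
  obtain ⟨L, hL⟩ := hΦ.locallyLipschitz.locallyLipschitzOn.exists_lipschitzOnWith_of_compact
    (isCompact_closedBall (0 : Space D) B₀)
  refine ⟨fun x => gradient Φ (clampVec R x), L, B, ?_, fun x => hB _, fun x hx => ?_⟩
  · have h := hL.comp ((lipschitzWith_clampVec (D := D) R).lipschitzOnWith (s := univ))
      (fun x _ => by simpa using hB₀ x)
    simpa [Function.comp_def] using h
  · simp only [clampVec_of_norm_le hx]

/-- A radial potential is even, so its gradient is odd. This is the only use of radial symmetry, and
it is needed to exchange the variables in the nonlocal adjoint term. -/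
lemma gradient_neg_of_radial {Φ : Space D → ℝ} (hΦ : IsPotential Φ) (x : Space D) :
    gradient Φ (-x) = - gradient Φ x := by
  have h1 : (fun y => Φ (-y)) = Φ := funext fun y => hΦ.radial _ _ (by simp)
  have h2 : fderiv ℝ Φ x = - fderiv ℝ Φ (-x) := by
    have h3 : HasFDerivAt Φ (fderiv ℝ Φ (-x)) (-x) :=
      (hΦ.contDiff.differentiable (by simp) _).hasFDerivAt
    have h4 := h3.comp x (hasFDerivAt_id x).neg
    have h5 : Φ ∘ Neg.neg = Φ := h1
    rw [h5] at h4
    rw [h4.fderiv]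
    ext y; simp
  simp only [gradient, h2, map_neg, neg_neg]

end Clamp

/-! ### The force and the driving field of a path of densities. -/

section Field

variable {D M : ℕ} {Ω : Set (Phase D)}

/-- The force exerted at the position `x`, without friction. -/
noncomputable def force (Ω : Set (Phase D)) (K₁ K₂ : Space D → Space D) (f : ℝ → L2 Ω ℝ)
    (d : ℝ → Agents M D) (t : ℝ) (x : Space D) : Space D :=
  - (∫ y in Ω, f t y • K₁ (x - y.1)) - (1 / (M : ℝ)) • ∑ m, K₂ (x - d t m)

/-- The vector field on phase space that drives the individuals. -/
noncomputable def field (Ω : Set (Phase D)) (K₁ K₂ : Space D → Space D) (α : ℝ) (f : ℝ → L2 Ω ℝ)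
    (d : ℝ → Agents M D) (t : ℝ) (z : Phase D) : Phase D :=
  (z.2, force Ω K₁ K₂ f d t z.1 - α • z.2)

/-- A continuous path of densities and agents' positions. -/
structure IsPath (Ω : Set (Phase D)) (f : ℝ → L2 Ω ℝ) (d : ℝ → Agents M D) : Prop where
  contf : Continuous f
  contd : Continuous d
  density : ∀ t, IsDensity Ω (f t)

lemma isFiniteMeasure_restrict (hb : Bornology.IsBounded Ω) :
    IsFiniteMeasure ((volume : Measure (Phase D)).restrict Ω) :=
  ⟨by rw [Measure.restrict_apply_univ]; exact hb.measure_lt_top⟩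

lemma ae_mem_closure : ∀ᵐ z ∂((volume : Measure (Phase D)).restrict Ω), z ∈ closure Ω := by
  have h : ∀ᵐ z ∂((volume : Measure (Phase D)).restrict (closure Ω)), z ∈ closure Ω :=
    ae_restrict_mem isClosed_closure.measurableSet
  exact ae_mono (Measure.restrict_mono subset_closure le_rfl) h

lemma continuous_pairing_set (hb : Bornology.IsBounded Ω) {P : Type*} [TopologicalSpace P]
    {H : Type*} [NormedAddCommGroup H] [NormedSpace ℝ H] [SecondCountableTopology H]
    [MeasurableSpace H] [BorelSpace H] {f : P → L2 Ω ℝ} (hf : Continuous f)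
    {c : P → Phase D → H} (hc : Continuous (Function.uncurry c)) :
    Continuous fun p => ∫ z in Ω, f p z • c p z := by
  have := isFiniteMeasure_restrict hb
  exact continuous_pairing hb.isCompact_closure ae_mem_closure hf hc

namespace IsPath

variable {f : ℝ → L2 Ω ℝ} {d : ℝ → Agents M D} {K₁ K₂ : Space D → Space D} {L₁ L₂ : ℝ≥0}
  {α : ℝ}

lemma integrable (hb : Bornology.IsBounded Ω) (f : L2 Ω ℝ) :
    Integrable f ((volume : Measure (Phase D)).restrict Ω) := by
  have := isFiniteMeasure_restrict hb
  exact integrable_L2 _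

lemma integrable_smul (hb : Bornology.IsBounded Ω) (f : L2 Ω ℝ)
    {H : Type*} [NormedAddCommGroup H] [NormedSpace ℝ H] [SecondCountableTopology H]
    [MeasurableSpace H] [BorelSpace H] {c : Phase D → H} (hc : Continuous c) :
    Integrable (fun z => f z • c z) ((volume : Measure (Phase D)).restrict Ω) := by
  have := isFiniteMeasure_restrict hb
  exact integrable_smul_of_continuous hb.isCompact_closure ae_mem_closure (integrable_L2 _) hc

lemma integral_norm_eq_one {f : Phase D → ℝ} (hf : IsDensity Ω f) : ∫ z in Ω, ‖f z‖ = 1 := by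
  rw [← hf.2]
  refine integral_congr_ae ?_
  filter_upwards [hf.1] with z hz using Real.norm_of_nonneg hz

/-- Averages of a Lipschitz kernel against a density are Lipschitz. -/
lemma continuous_force (hb : Bornology.IsBounded Ω) (h : IsPath Ω f d) (h₁ : Continuous K₁)
    (h₂ : Continuous K₂) : Continuous (Function.uncurry (force Ω K₁ K₂ f d)) := by
  have hc := h.contd
  have e1 : Continuous fun p : ℝ × Space D => ∫ y in Ω, f p.1 y • K₁ (p.2 - y.1) :=
    continuous_pairing_set hb (f := fun p : ℝ × Space D => f p.1) (h.contf.comp continuous_fst)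
      (c := fun p y => K₁ (p.2 - y.1)) (by
        exact h₁.comp (by fun_prop))
  have e2 : ∀ m, Continuous fun p : ℝ × Space D => K₂ (p.2 - d p.1 m) := fun m =>
    h₂.comp (by fun_prop)
  have : Continuous fun p : ℝ × Space D => - (∫ y in Ω, f p.1 y • K₁ (p.2 - y.1))
      - (1 / (M : ℝ)) • ∑ m, K₂ (p.2 - d p.1 m) := by fun_prop
  exact this

lemma continuous_field (hb : Bornology.IsBounded Ω) (h : IsPath Ω f d) (h₁ : Continuous K₁)
    (h₂ : Continuous K₂) : Continuous (Function.uncurry (field Ω K₁ K₂ α f d)) := by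
  have e := continuous_force hb h h₁ h₂
  have e' : Continuous fun p : ℝ × Phase D => force Ω K₁ K₂ f d p.1 p.2.1 :=
    e.comp (f := fun p : ℝ × Phase D => (p.1, p.2.1)) (by fun_prop)
  have : Continuous fun p : ℝ × Phase D =>
    ((p.2.2, force Ω K₁ K₂ f d p.1 p.2.1 - α • p.2.2) : Phase D) := by fun_prop
  exact this

/-- With `M = 0` both averages are zero, so no positivity of `M` is needed. -/
lemma norm_average_sub_le {M : ℕ} {u v : Fin M → Space D} {C : ℝ} (hC : 0 ≤ C)
    (h : ∀ m, ‖u m - v m‖ ≤ C) :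
    ‖(1 / (M : ℝ)) • ∑ m, u m - (1 / (M : ℝ)) • ∑ m, v m‖ ≤ C := by
  rw [← smul_sub, ← Finset.sum_sub_distrib, norm_smul]
  have h1 : ‖∑ m, (u m - v m)‖ ≤ M * C := by
    refine (norm_sum_le_of_le _ fun m _ => h m).trans ?_
    simp
  rcases Nat.eq_zero_or_pos M with h0 | h0
  · subst h0; simpa using hC
  · have : (0 : ℝ) < M := by exact_mod_cast h0
    rw [Real.norm_of_nonneg (by positivity), one_div, inv_mul_le_iff₀ this]
    exact h1

/-- A density has mass one, so the Lipschitz constant is that of the kernels and does not depend on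
the state. -/
lemma norm_force_sub_le (hb : Bornology.IsBounded Ω) (h : IsPath Ω f d) (h₁ : LipschitzWith L₁ K₁)
    (h₂ : LipschitzWith L₂ K₂) (t : ℝ) (x y : Space D) :
    ‖force Ω K₁ K₂ f d t x - force Ω K₁ K₂ f d t y‖ ≤ (L₁ + L₂) * ‖x - y‖ := by
  have hi : ∀ x, Integrable (fun z => f t z • K₁ (x - z.1))
      ((volume : Measure (Phase D)).restrict Ω) := fun x =>
    integrable_smul hb (f t) (c := fun z => K₁ (x - z.1)) (h₁.continuous.comp (by fun_prop))
  have e1 : ‖(∫ z in Ω, f t z • K₁ (x - z.1)) - ∫ z in Ω, f t z • K₁ (y - z.1)‖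
      ≤ L₁ * ‖x - y‖ := by
    rw [← integral_sub (hi x) (hi y)]
    calc _ ≤ ∫ z in Ω, ‖f t z‖ * (L₁ * ‖x - y‖) := by
          refine norm_integral_le_of_norm_le ((integrable hb (f t)).norm.mul_const _)
            (Eventually.of_forall fun z => ?_)
          rw [← smul_sub, norm_smul]
          have := h₁.norm_sub_le (x - z.1) (y - z.1)
          rw [sub_sub_sub_cancel_right] at this
          gcongr
      _ = L₁ * ‖x - y‖ := by
          rw [integral_mul_const, integral_norm_eq_one (h.density t), one_mul]
  have e2 := norm_average_sub_le (M := M) (u := fun m => K₂ (y - d t m))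
    (v := fun m => K₂ (x - d t m)) (C := L₂ * ‖x - y‖) (by positivity) (fun m => by
      have := h₂.norm_sub_le (y - d t m) (x - d t m)
      rwa [sub_sub_sub_cancel_right, norm_sub_rev y x] at this)
  have e3 : force Ω K₁ K₂ f d t x - force Ω K₁ K₂ f d t y
      = -((∫ z in Ω, f t z • K₁ (x - z.1)) - ∫ z in Ω, f t z • K₁ (y - z.1))
        + ((1 / (M : ℝ)) • ∑ m, K₂ (y - d t m) - (1 / (M : ℝ)) • ∑ m, K₂ (x - d t m)) := by
    simp only [force]; abel
  rw [e3]
  refine (norm_add_le _ _).trans ?_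
  rw [norm_neg]
  linarith

lemma lipschitz_field (hb : Bornology.IsBounded Ω) (h : IsPath Ω f d) (h₁ : LipschitzWith L₁ K₁)
    (h₂ : LipschitzWith L₂ K₂) (t : ℝ) :
    LipschitzWith (1 + L₁ + L₂ + ‖α‖₊) (field Ω K₁ K₂ α f d t) := by
  refine LipschitzWith.of_dist_le_mul fun z w => ?_
  rw [dist_eq_norm, dist_eq_norm, Prod.norm_def]
  have hx : ‖z.1 - w.1‖ ≤ ‖z - w‖ := norm_fst_le (z - w)
  have hv : ‖z.2 - w.2‖ ≤ ‖z - w‖ := norm_snd_le (z - w)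
  push_cast
  have h0 := norm_nonneg (z - w)
  refine max_le ?_ ?_
  · refine hv.trans (le_mul_of_one_le_left h0 ?_)
    have := L₁.coe_nonneg
    have := L₂.coe_nonneg
    have := norm_nonneg α
    linarith
  · have e : (field Ω K₁ K₂ α f d t z - field Ω K₁ K₂ α f d t w).2
        = (force Ω K₁ K₂ f d t z.1 - force Ω K₁ K₂ f d t w.1) - α • (z.2 - w.2) := by
      simp only [field, Prod.snd_sub, smul_sub]; abel
    rw [e]
    refine (norm_sub_le _ _).trans ?_
    rw [norm_smul]
    have h3 := norm_force_sub_le hb h h₁ h₂ t z.1 w.1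
    have h4 : (L₁ + L₂ : ℝ) * ‖z.1 - w.1‖ ≤ (L₁ + L₂) * ‖z - w‖ := by gcongr
    have h5 : ‖α‖ * ‖z.2 - w.2‖ ≤ ‖α‖ * ‖z - w‖ := by gcongr
    nlinarith

end IsPath

end Field

/-! ### Weak solutions tested with smooth and with Lipschitz functions. -/

section WeakSolution

variable {D : ℕ} {Ω : Set (Phase D)} {a b : ℝ} {f : ℝ → L2 Ω ℝ} {F : ℝ → Phase D → Phase D}

/-- Weak solutions on `[a,b]` of the continuity equation `∂_t f + ∇·(F f) = 0`. -/
def IsWeakSolution (Ω : Set (Phase D)) (a b : ℝ) (f : ℝ → L2 Ω ℝ) (F : ℝ → Phase D → Phase D) :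
    Prop :=
  ∀ h : ℝ × Phase D → ℝ, ContDiff ℝ ∞ h → HasCompactSupport h → (∀ q ∈ tsupport h, q.1 < b) →
    (∫ t in Icc a b, ∫ z in Ω, f t z * fderiv ℝ h (t, z) (1, F t z))
      + ∫ z in Ω, f a z * h (a, z) = 0

lemma continuous_integral_test (hbd : Bornology.IsBounded Ω) (hf : Continuous f)
    {h : ℝ × Phase D → ℝ} (hh : Continuous h) : Continuous fun t => ∫ z in Ω, f t z * h (t, z) :=
  continuous_pairing_set hbd hf (c := fun t z => h (t, z)) (by
    have : Continuous fun p : ℝ × Phase D => h (p.1, p.2) := by simpa using hh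
    exact this)

lemma continuous_deriv_along (hF : Continuous (Function.uncurry F)) {h : ℝ × Phase D → ℝ}
    (hh : ContDiff ℝ ∞ h) :
    Continuous fun p : ℝ × Phase D => fderiv ℝ h (p.1, p.2) (1, F p.1 p.2) := by
  have h1 : Continuous (fderiv ℝ h) := hh.continuous_fderiv (by simp)
  have h2 : Continuous fun p : ℝ × Phase D => F p.1 p.2 := hF
  simp only [Prod.mk.eta]
  fun_prop

lemma continuous_integral_deriv_along (hbd : Bornology.IsBounded Ω) (hf : Continuous f)
    (hF : Continuous (Function.uncurry F)) {h : ℝ × Phase D → ℝ} (hh : ContDiff ℝ ∞ h) :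
    Continuous fun t => ∫ z in Ω, f t z * fderiv ℝ h (t, z) (1, F t z) :=
  continuous_pairing_set hbd hf (c := fun t z => fderiv ℝ h (t, z) (1, F t z))
    (continuous_deriv_along hF hh)

/-- The primitive is based at the right end point, so it vanishes near `b`, as test functions in the
weak formulation must. -/
lemma exists_primitive {η : ℝ → ℝ} (hη : ContDiff ℝ ∞ η) {a b : ℝ} (hab : a < b)
    (hc : HasCompactSupport η) (hs : tsupport η ⊆ Ioo a b) :
    ∃ θ : ℝ → ℝ, ContDiff ℝ ∞ θ ∧ (∀ t, HasDerivAt θ (η t) t) ∧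
      ∃ c < b, ∀ t, c ≤ t → θ t = 0 := by
  have hcont := hη.continuous
  have hd : ∀ t, HasDerivAt (fun t => ∫ s in b..t, η s) (η t) t := fun t =>
    intervalIntegral.integral_hasDerivAt_right (hcont.intervalIntegrable _ _)
      (hcont.stronglyMeasurableAtFilter _ _) hcont.continuousAt
  obtain ⟨c, hcb, hcs⟩ : ∃ c < b, ∀ x, c ≤ x → η x = 0 := by
    rcases (tsupport η).eq_empty_or_nonempty with he | hne
    · exact ⟨a, hab, fun x _ => image_eq_zero_of_notMem_tsupport (by simp [he])⟩
    · obtain ⟨m, hm, hmax⟩ := hc.isCompact.exists_isGreatest hne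
      refine ⟨(m + b) / 2, by linarith [(hs hm).2], fun x hx =>
        image_eq_zero_of_notMem_tsupport fun hx' => ?_⟩
      have := hmax hx'
      linarith [(hs hm).2]
  refine ⟨fun t => ∫ s in b..t, η s, ?_, hd, c, hcb, fun t ht => ?_⟩
  · refine contDiff_infty_iff_deriv.2 ⟨fun t => (hd t).differentiableAt, ?_⟩
    have : deriv (fun t => ∫ s in b..t, η s) = η := funext fun t => (hd t).deriv
    rwa [this]
  · refine intervalIntegral.integral_zero_ae (Eventually.of_forall fun x hx => hcs x ?_)
    rcases le_total b t with h | h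
    · rw [uIoc_of_le h] at hx; linarith [hx.1]
    · rw [uIoc_of_ge h] at hx; linarith [hx.1]

/-- Test with `θ(t) h(t,z)`, where `θ' = η` and `η` has compact support in `(a,b)`. Integration by
parts in time shows that the moment of `f` and its candidate formula have the same integral against
every `η`. They therefore agree almost everywhere, and everywhere by continuity. -/
lemma IsWeakSolution.integral_smooth (hw : IsWeakSolution Ω a b f F) (hab : a < b)
    (hΩ : MeasurableSet Ω) (hbd : Bornology.IsBounded Ω) (hf : Continuous f)
    (hF : Continuous (Function.uncurry F)) {h : ℝ × Phase D → ℝ} (hh : ContDiff ℝ ∞ h) :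
    ∀ t ∈ Icc a b, ∫ z in Ω, f t z * h (t, z) = (∫ z in Ω, f a z * h (a, z))
      + ∫ s in a..t, ∫ z in Ω, f s z * fderiv ℝ h (s, z) (1, F s z) := by
  set m : ℝ → ℝ := fun t => ∫ z in Ω, f t z * h (t, z) with hm
  set r : ℝ → ℝ := fun t => ∫ z in Ω, f t z * fderiv ℝ h (t, z) (1, F t z) with hr
  have hmc : Continuous m := continuous_integral_test hbd hf hh.continuous
  have hrc : Continuous r := continuous_integral_deriv_along hbd hf hF hh
  set n : ℝ → ℝ := fun t => m a + ∫ s in a..t, r s with hn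
  have hnd : ∀ t, HasDerivAt n (r t) t := fun t =>
    (intervalIntegral.integral_hasDerivAt_right (hrc.intervalIntegrable _ _)
      (hrc.stronglyMeasurableAtFilter _ _) hrc.continuousAt).const_add _
  have hnc : Continuous n := continuous_iff_continuousAt.2 fun t => (hnd t).continuousAt
  obtain ⟨ρ, hρ0, hρ⟩ : ∃ ρ, 0 < ρ ∧ ∀ t ∈ Icc a b, ∀ z ∈ Ω, ‖(t, z)‖ < ρ := by
    obtain ⟨ρ, hρ⟩ := ((Metric.isBounded_Icc a b).prod hbd).exists_norm_le
    exact ⟨|ρ| + 1, by positivity, fun t ht z hz =>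
      (hρ (t, z) ⟨ht, hz⟩).trans_lt (by linarith [le_abs_self ρ])⟩
  -- The cutoff is one near `[a,b] × Ω`. It supplies compact support without changing any value or
  -- derivative that is integrated.
  let χ : ContDiffBump (0 : ℝ × Phase D) := ⟨ρ, ρ + 1, hρ0, by linarith⟩
  have key : ∀ η : ℝ → ℝ, ContDiff ℝ ∞ η → HasCompactSupport η → tsupport η ⊆ Ioo a b →
      ∫ t, η t • (m t - n t) = 0 := by
    intro η hη hηc hηs
    obtain ⟨θ, hθ, hθd, c, hcb, hθc⟩ := exists_primitive hη hab hηc hηs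
    have hH : ContDiff ℝ ∞ fun q : ℝ × Phase D => χ q * (θ q.1 * h q) :=
      χ.contDiff.mul ((hθ.comp contDiff_fst).mul hh)
    have h1 := hw (fun q => χ q * (θ q.1 * h q)) hH χ.hasCompactSupport.mul_right (by
      intro q hq
      have : tsupport (fun q : ℝ × Phase D => χ q * (θ q.1 * h q)) ⊆ {q | q.1 ≤ c} := by
        refine closure_minimal (fun q hq => ?_) (isClosed_le continuous_fst continuous_const)
        by_contra hcon
        exact hq (by simp [hθc q.1 (not_le.1 hcon).le])
      exact (this hq).trans_lt hcb)
    have hχ1 : ∀ t ∈ Icc a b, ∀ z ∈ Ω, (fun q : ℝ × Phase D => χ q * (θ q.1 * h q))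
        =ᶠ[𝓝 (t, z)] fun q => θ q.1 * h q := fun t ht z hz => by
      have : Metric.ball (0 : ℝ × Phase D) ρ ∈ 𝓝 (t, z) :=
        Metric.isOpen_ball.mem_nhds (by simpa using hρ t ht z hz)
      filter_upwards [this] with q hq
      rw [χ.one_of_mem_closedBall (Metric.ball_subset_closedBall hq), one_mul]
    have hder : ∀ t ∈ Icc a b, ∀ z ∈ Ω, fderiv ℝ (fun q : ℝ × Phase D => χ q * (θ q.1 * h q))
        (t, z) (1, F t z) = η t * h (t, z) + θ t * fderiv ℝ h (t, z) (1, F t z) := by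
      intro t ht z hz
      rw [(hχ1 t ht z hz).fderiv_eq]
      have e1 : HasFDerivAt (fun q : ℝ × Phase D => θ q.1)
          ((ContinuousLinearMap.toSpanSingleton ℝ (η t)).comp
            (ContinuousLinearMap.fst ℝ ℝ (Phase D))) (t, z) :=
        (hθd t).hasFDerivAt.comp (t, z) hasFDerivAt_fst
      have e2 : HasFDerivAt h (fderiv ℝ h (t, z)) (t, z) :=
        (hh.differentiable (by simp) _).hasFDerivAt
      rw [(e1.fun_mul e2).fderiv]
      simp
      ring
    have h2 : ∫ t in Icc a b, ∫ z in Ω, f t z *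
        fderiv ℝ (fun q : ℝ × Phase D => χ q * (θ q.1 * h q)) (t, z) (1, F t z)
        = ∫ t in a..b, (η t * m t + θ t * r t) := by
      rw [intervalIntegral.integral_of_le hab.le, ← integral_Icc_eq_integral_Ioc]
      refine setIntegral_congr_fun measurableSet_Icc fun t ht => ?_
      have hc1 : Continuous fun z => h (t, z) := hh.continuous.comp (Continuous.prodMk_right t)
      have hc2 : Continuous fun z => fderiv ℝ h (t, z) (1, F t z) :=
        (continuous_deriv_along hF hh).comp (Continuous.prodMk_right t)
      have i1 := IsPath.integrable_smul hbd (f t) hc1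
      have i2 := IsPath.integrable_smul hbd (f t) hc2
      simp only [smul_eq_mul] at i1 i2
      simp only [hm, hr]
      rw [← integral_const_mul, ← integral_const_mul, ← integral_add (i1.const_mul _)
        (i2.const_mul _)]
      refine setIntegral_congr_fun hΩ fun z hz => ?_
      rw [hder t ht z hz]
      ring
    have h3 : ∫ z in Ω, f a z * (χ (a, z) * (θ a * h (a, z))) = θ a * m a := by
      rw [hm, ← integral_const_mul]
      refine setIntegral_congr_fun hΩ fun z hz => ?_
      have e := (hχ1 a ⟨le_rfl, hab.le⟩ z hz).self_of_nhds
      simp only at e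
      rw [e]
      ring
    rw [h2, h3] at h1
    have hηcont := hη.continuous
    have hθcont := hθ.continuous
    have h4 := intervalIntegral.integral_mul_deriv_eq_deriv_mul (a := a) (b := b)
      (fun t _ => hθd t) (fun t _ => hnd t) (hηcont.intervalIntegrable _ _)
      (hrc.intervalIntegrable _ _)
    have h5 : n a = m a := by simp [hn]
    rw [hθc b hcb.le, h5, zero_mul, zero_sub] at h4
    have hc1 : Continuous fun t => η t * m t := hηcont.mul hmc
    have hc2 : Continuous fun t => θ t * r t := hθcont.mul hrc
    have hc3 : Continuous fun t => η t * n t := hηcont.mul hnc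
    rw [intervalIntegral.integral_add (hc1.intervalIntegrable _ _)
      (hc2.intervalIntegrable _ _), h4] at h1
    have h6 : ∫ t, η t • (m t - n t) = ∫ t in a..b, (η t * m t - η t * n t) := by
      rw [intervalIntegral.integral_of_le hab.le, ← integral_Icc_eq_integral_Ioc,
        setIntegral_eq_integral_of_forall_compl_eq_zero]
      · simp only [smul_eq_mul, mul_sub]
      · intro x hx
        have : η x = 0 := image_eq_zero_of_notMem_tsupport fun h =>
          hx (Ioo_subset_Icc_self (hηs h))
        simp [this]
    rw [h6, intervalIntegral.integral_sub (hc1.intervalIntegrable _ _)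
      (hc3.intervalIntegrable _ _)]
    linarith
  have hz := isOpen_Ioo.ae_eq_zero_of_integral_contDiff_smul_eq_zero (U := Ioo a b)
    (μ := (volume : Measure ℝ))
    ((hmc.sub hnc).locallyIntegrable.locallyIntegrableOn _) key
  have hae : m =ᵐ[volume.restrict (Icc a b)] n := by
    rw [← restrict_Ioo_eq_restrict_Icc]
    filter_upwards [(ae_restrict_iff' measurableSet_Ioo).2 hz] with t ht
    exact sub_eq_zero.1 ht
  exact fun t ht => Measure.eqOn_Icc_of_ae_eq volume hab.ne hae hmc.continuousOn
    hnc.continuousOn ht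

/-- Lipschitz functions are admissible in the weak formulation. -/
lemma IsWeakSolution.integral_lipschitz (hw : IsWeakSolution Ω a b f F) (hab : a < b)
    (hΩ : MeasurableSet Ω) (hbd : Bornology.IsBounded Ω) (hf : Continuous f)
    (hF : Continuous (Function.uncurry F)) {h : ℝ × Phase D → ℝ} {C : ℝ≥0}
    (hh : LipschitzWith C h) :
    ∀ t ∈ Icc a b, ∫ z in Ω, f t z * h (t, z) = (∫ z in Ω, f a z * h (a, z))
      + ∫ s in a..t, ∫ z in Ω, f s z * fderiv ℝ h (s, z) (1, F s z) := by
  have := isFiniteMeasure_restrict hbd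
  intro t ht
  obtain ⟨u, hu1, hu2, hu3, hu4⟩ := exists_smooth_approx
    (volume : Measure (ℝ × Phase D)) hh
  obtain ⟨A, hA⟩ := (isCompact_Icc.prod hbd.isCompact_closure).exists_bound_of_continuousOn
    (hF.continuousOn (s := Icc a b ×ˢ closure Ω))
  obtain ⟨C₁, hC₁, hL1⟩ := exists_L1_le_L2 ((volume : Measure (Phase D)).restrict Ω)
  have hlim : ∀ s, Tendsto (fun n => ∫ z in Ω, f s z * u n (s, z)) atTop
      (𝓝 (∫ z in Ω, f s z * h (s, z))) := by
    intro s
    have hi := IsPath.integrable_smul hbd (f s) (c := fun z => h (s, z))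
      (hh.continuous.comp (Continuous.prodMk_right s))
    simp only [smul_eq_mul] at hi
    refine tendsto_integral_of_dominated_convergence (fun z => ‖f s z * h (s, z)‖ + ‖f s z‖ * C)
      (fun n => ?_) (hi.norm.add ((IsPath.integrable hbd (f s)).norm.mul_const _)) (fun n => ?_) ?_
    · exact (IsPath.integrable hbd (f s)).aestronglyMeasurable.mul
        ((hu1 n).continuous.comp (Continuous.prodMk_right s)).aestronglyMeasurable
    · refine Eventually.of_forall fun z => ?_
      have e : f s z * u n (s, z) = f s z * h (s, z) + f s z * (u n (s, z) - h (s, z)) := by ring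
      rw [e]
      refine (norm_add_le _ _).trans ?_
      rw [norm_mul (f s z) (u n (s, z) - h (s, z))]
      gcongr
      refine (hu3 n _).trans ?_
      refine mul_le_of_le_one_right C.coe_nonneg ?_
      rw [div_le_one (by positivity)]
      linarith [n.cast_nonneg (α := ℝ)]
    · refine Eventually.of_forall fun z => Tendsto.const_mul _ ?_
      rw [tendsto_iff_norm_sub_tendsto_zero]
      refine squeeze_zero (fun _ => norm_nonneg _) (fun n => hu3 n _) ?_
      simpa using tendsto_one_div_add_atTop_nhds_zero_nat.const_mul (C : ℝ)
  have hbound : ∀ n, ∀ s ∈ Icc a b, ∀ᵐ z ∂(volume.restrict Ω),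
      ‖f s z * fderiv ℝ (u n) (s, z) (1, F s z)‖ ≤ ‖f s z‖ * (C * (1 + |A|)) := by
    intro n s hs
    filter_upwards [ae_mem_closure] with z hz
    rw [norm_mul]
    gcongr
    refine (ContinuousLinearMap.le_opNorm _ _).trans ?_
    gcongr
    · exact hu2 n _
    · rw [Prod.norm_def]
      have := hA (s, z) ⟨hs, hz⟩
      have h2 := le_abs_self A
      refine max_le (by simp) ?_
      exact this.trans (by linarith)
  have hR : Tendsto (fun n => ∫ s in a..t, ∫ z in Ω, f s z * fderiv ℝ (u n) (s, z) (1, F s z))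
      atTop (𝓝 (∫ s in a..t, ∫ z in Ω, f s z * fderiv ℝ h (s, z) (1, F s z))) := by
    have hnc : Continuous fun s => C₁ * ‖f s‖ * (C * (1 + |A|)) := by fun_prop
    have hsub : Set.uIoc a t ⊆ Icc a b := by
      rw [uIoc_of_le ht.1]; exact Ioc_subset_Icc_self.trans (Icc_subset_Icc_right ht.2)
    refine intervalIntegral.tendsto_integral_filter_of_dominated_convergence
      (fun s => C₁ * ‖f s‖ * (C * (1 + |A|))) (Eventually.of_forall fun n => ?_)
      (Eventually.of_forall fun n => Eventually.of_forall fun s hs => ?_)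
      (hnc.intervalIntegrable _ _) ?_
    · exact (continuous_integral_deriv_along hbd hf hF (hu1 n)).aestronglyMeasurable
    · calc _ ≤ ∫ z in Ω, ‖f s z‖ * (C * (1 + |A|)) :=
          norm_integral_le_of_norm_le ((IsPath.integrable hbd (f s)).norm.mul_const _)
            (hbound n s (hsub hs))
        _ ≤ _ := by
          rw [integral_mul_const]
          gcongr
          exact hL1 (f s)
    · have h1 : ∀ᵐ s : ℝ, ∀ᵐ z : Phase D, ∀ e,
          Tendsto (fun n => fderiv ℝ (u n) (s, z) e) atTop (𝓝 (fderiv ℝ h (s, z) e)) :=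
        Measure.ae_ae_of_ae_prod hu4
      filter_upwards [h1] with s hs hsm
      refine tendsto_integral_of_dominated_convergence (fun z => ‖f s z‖ * (C * (1 + |A|)))
        (fun n => ?_) ((IsPath.integrable hbd (f s)).norm.mul_const _)
        (fun n => hbound n s (hsub hsm)) ?_
      · exact (IsPath.integrable hbd (f s)).aestronglyMeasurable.mul
          ((continuous_deriv_along hF (hu1 n)).comp
            (Continuous.prodMk_right s)).aestronglyMeasurable
      · filter_upwards [ae_restrict_of_ae hs] with z hz
        exact (hz _).const_mul _
  refine tendsto_nhds_unique (hlim t) ?_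
  refine ((hlim a).add hR).congr fun n => ?_
  exact (hw.integral_smooth hab hΩ hbd hf hF (hu1 n) t ht).symm

end WeakSolution

/-! ### Measures determined by test functions, and integration by parts for Lipschitz functions. -/

section MeasureExt

variable {V : Type*} [NormedAddCommGroup V] [NormedSpace ℝ V] [FiniteDimensional ℝ V]
  [MeasurableSpace V] [BorelSpace V]

/-- Locally finite measures are determined by their integrals of test functions. -/
lemma measure_ext_of_integral_smooth {μ ν : Measure V} [IsLocallyFiniteMeasure μ]
    [IsLocallyFiniteMeasure ν]
    (h : ∀ g : V → ℝ, ContDiff ℝ ∞ g → HasCompactSupport g → ∫ x, g x ∂μ = ∫ x, g x ∂ν) :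
    μ = ν := by
  have : ProperSpace V := FiniteDimensional.proper ℝ V
  refine Measure.ext_of_integral_eq_on_compactlySupported fun f => ?_
  obtain ⟨R, hR0, hR⟩ : ∃ R, 0 < R ∧ ∀ x, f x ≠ 0 → ‖x‖ ≤ R := by
    obtain ⟨R, hR⟩ := f.hasCompactSupport.isCompact.isBounded.exists_norm_le
    exact ⟨|R| + 1, by positivity, fun x hx =>
      (hR x (subset_tsupport _ hx)).trans (by linarith [le_abs_self R])⟩
  -- Since `χ f = f`, a uniform smooth approximation `g` of `f` may be replaced by `χ g`, which has
  -- compact support, with an error of at most `ε ∫ χ`.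
  let χ : ContDiffBump (0 : V) := ⟨R, R + 1, hR0, by linarith⟩
  have hχ : ∀ x, f x ≠ 0 → χ x = 1 := fun x hx =>
    χ.one_of_mem_closedBall (by simpa using hR x hx)
  have hχi : ∀ (m : Measure V) [IsLocallyFiniteMeasure m], Integrable χ m := fun m _ =>
    χ.continuous.integrable_of_hasCompactSupport χ.hasCompactSupport
  have hfi : ∀ (m : Measure V) [IsLocallyFiniteMeasure m], Integrable f m := fun m _ =>
    f.continuous.integrable_of_hasCompactSupport f.hasCompactSupport
  have hle : ∀ ε > 0, |∫ x, f x ∂μ - ∫ x, f x ∂ν| ≤ ε * (∫ x, χ x ∂μ + ∫ x, χ x ∂ν) := by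
    intro ε hε
    obtain ⟨g, hg, hgf⟩ := (f.hasCompactSupport.uniformContinuous_of_continuous
      f.continuous).exists_contDiff_dist_le hε
    have hgi : ∀ (m : Measure V) [IsLocallyFiniteMeasure m], Integrable (fun x => χ x * g x) m :=
      fun m _ => (χ.continuous.mul hg.continuous).integrable_of_hasCompactSupport
        χ.hasCompactSupport.mul_right
    have h1 : ∀ (m : Measure V) [IsLocallyFiniteMeasure m],
        |∫ x, f x ∂m - ∫ x, χ x * g x ∂m| ≤ ε * ∫ x, χ x ∂m := fun m _ => by
      rw [← integral_sub (hfi m) (hgi m), ← integral_const_mul, ← Real.norm_eq_abs]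
      refine norm_integral_le_of_norm_le ((hχi m).const_mul _) (Eventually.of_forall fun x => ?_)
      have h2 : f x - χ x * g x = χ x * (f x - g x) := by
        by_cases hx : f x = 0
        · rw [hx]; ring
        · rw [hχ x hx]; ring
      rw [h2, norm_mul, Real.norm_of_nonneg χ.nonneg, mul_comm]
      have h3 := (hgf x).le
      rw [dist_comm, dist_eq_norm] at h3
      exact mul_le_mul_of_nonneg_right h3 χ.nonneg
    have h2 := h (fun x => χ x * g x) (χ.contDiff.mul hg) χ.hasCompactSupport.mul_right
    have h3 := h1 μ
    have h4 := h1 ν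
    rw [← h2] at h4
    rw [abs_le] at *
    constructor <;> linarith [h3.1, h3.2, h4.1, h4.2]
  have h0 : |∫ x, f x ∂μ - ∫ x, f x ∂ν| ≤ 0 := by
    have hA : 0 ≤ ∫ x, χ x ∂μ + ∫ x, χ x ∂ν :=
      add_nonneg (integral_nonneg fun _ => χ.nonneg) (integral_nonneg fun _ => χ.nonneg)
    refine le_of_forall_pos_le_add fun ε hε => ?_
    have := hle (ε / (∫ x, χ x ∂μ + ∫ x, χ x ∂ν + 1)) (by positivity)
    refine this.trans ?_
    rw [zero_add, div_mul_eq_mul_div, div_le_iff₀ (by positivity)]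
    nlinarith
  exact sub_eq_zero.1 (abs_nonpos_iff.1 h0)

variable {μ : Measure V} [μ.IsAddHaarMeasure]

lemma hasCompactSupport_lineDeriv {h : V → ℝ} (hc : HasCompactSupport h) (w : V) :
    HasCompactSupport fun z => lineDeriv ℝ h z w := by
  refine HasCompactSupport.intro (K := tsupport h) hc fun z hz => ?_
  have h1 : h =ᶠ[𝓝 z] fun _ => 0 := notMem_tsupport_iff_eventuallyEq.1 hz
  have h2 := h1.lineDeriv_eq (𝕜 := ℝ) (v := w)
  rw [h2]
  simp [lineDeriv]

lemma integrable_mul_lineDeriv {h p : V → ℝ} {C : ℝ≥0} (hh : LipschitzWith C h)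
    (hc : HasCompactSupport h) (hp : Continuous p) (w : V) :
    Integrable (fun z => p z * lineDeriv ℝ h z w) μ := by
  have hm := measurable_lineDeriv (𝕜 := ℝ) hh.continuous (v := w)
  have hcs := hasCompactSupport_lineDeriv hc w
  have h1 : IntegrableOn (fun z => p z * lineDeriv ℝ h z w) (tsupport fun z => lineDeriv ℝ h z w)
      μ := by
    refine Integrable.mul_bdd (c := C * ‖w‖) (hp.continuousOn.integrableOn_compact hcs)
      hm.aestronglyMeasurable (Eventually.of_forall fun z => norm_lineDeriv_le_of_lipschitz ℝ hh)
  refine (integrableOn_iff_integrable_of_support_subset ?_).1 h1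
  refine (Function.support_mul_subset_right _ _).trans (subset_tsupport _)

/-- Integration by parts against a function that is affine in the direction `w`. -/
lemma integral_mul_lineDeriv_eq {h p : V → ℝ} {C C' : ℝ≥0} (hh : LipschitzWith C h)
    (hc : HasCompactSupport h) (hp : LipschitzWith C' p) {w : V} {c : ℝ}
    (hpw : ∀ z, ∀ t : ℝ, p (z + t • w) = p z + t * c) :
    ∫ z, p z * lineDeriv ℝ h z w ∂μ = - c * ∫ z, h z ∂μ := by
  have h1 := hp.integral_lineDeriv_mul_eq (μ := μ) hh hc w
  have h2 : ∀ z, lineDeriv ℝ p z w = c := fun z => by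
    have : HasLineDerivAt ℝ p c z w := by
      simp only [HasLineDerivAt, hpw]
      simpa using ((hasDerivAt_id (0 : ℝ)).mul_const c).const_add (p z)
    exact this.lineDeriv
  simp only [h2, lineDeriv_neg] at h1
  rw [integral_const_mul] at h1
  rw [neg_mul, h1, ← integral_neg]
  congr 1 with z
  simp; ring

end MeasureExt

/-! ### The divergence of the driving field. -/

section Divergence

variable {D : ℕ}

lemma fst_eq_sum (x : Space D) :
    ((x, 0) : Phase D) = ∑ i, x i • ((EuclideanSpace.single i 1, 0) : Phase D) := by
  refine Prod.ext ?_ ?_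
  · rw [Prod.fst_sum]
    simp only [Prod.smul_mk]
    ext j
    simp [Finset.sum_apply, Pi.single_apply]
  · rw [Prod.snd_sum]; simp

lemma snd_eq_sum (x : Space D) :
    ((0, x) : Phase D) = ∑ i, x i • ((0, EuclideanSpace.single i 1) : Phase D) := by
  refine Prod.ext ?_ ?_
  · rw [Prod.fst_sum]; simp
  · rw [Prod.snd_sum]
    simp only [Prod.smul_mk]
    ext j
    simp [Finset.sum_apply, Pi.single_apply]

lemma lipschitz_coord (i : Fin D) : LipschitzWith 1 fun x : Space D => x i :=
  LipschitzWith.of_dist_le_mul fun x y => by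
    simpa [dist_eq_norm] using PiLp.norm_apply_le (x - y) i

/-- The divergence of `(v, S(x) - α v)` is the constant `- α D`. -/
lemma integral_fderiv_field {h : Phase D → ℝ} {C : ℝ≥0} (hh : LipschitzWith C h)
    (hc : HasCompactSupport h) {S : Space D → Space D} {L : ℝ≥0} (hS : LipschitzWith L S) (α : ℝ) :
    ∫ z, fderiv ℝ h z (z.2, S z.1 - α • z.2) = α * D * ∫ z, h z := by
  have hae : ∀ᵐ z : Phase D, fderiv ℝ h z (z.2, S z.1 - α • z.2)
      = ∑ i, (z.2 i * lineDeriv ℝ h z (EuclideanSpace.single i 1, 0)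
        + ((S z.1) i - α * z.2 i) * lineDeriv ℝ h z (0, EuclideanSpace.single i 1)) := by
    filter_upwards [hh.ae_differentiableAt (μ := (volume : Measure (Phase D)))] with z hz
    have e : ((z.2, S z.1 - α • z.2) : Phase D) = (z.2, 0) + (0, S z.1 - α • z.2) := by simp
    rw [e, fst_eq_sum, snd_eq_sum, map_add, map_sum, map_sum, ← Finset.sum_add_distrib]
    refine Finset.sum_congr rfl fun i _ => ?_
    rw [hz.lineDeriv_eq_fderiv, hz.lineDeriv_eq_fderiv, map_smul, map_smul]
    simp
  have hSi : ∀ i, LipschitzWith L fun z : Phase D => (S z.1) i := fun i => by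
    have := (lipschitz_coord i).comp (hS.comp (LipschitzWith.prod_fst (α := Space D)
      (β := Space D)))
    simpa [Function.comp_def] using this
  have hvi : ∀ i, LipschitzWith 1 fun z : Phase D => z.2 i := fun i => by
    have := (lipschitz_coord i).comp (LipschitzWith.prod_snd (α := Space D) (β := Space D))
    simpa [Function.comp_def] using this
  have i1 : ∀ i : Fin D, Integrable (fun z : Phase D =>
      z.2 i * lineDeriv ℝ h z (EuclideanSpace.single i 1, 0)) := fun i =>
    integrable_mul_lineDeriv hh hc (hvi i).continuous _
  have i2 : ∀ i : Fin D, Integrable (fun z : Phase D =>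
      (S z.1) i * lineDeriv ℝ h z (0, EuclideanSpace.single i 1)) := fun i =>
    integrable_mul_lineDeriv hh hc (hSi i).continuous _
  have i3 : ∀ i : Fin D, Integrable (fun z : Phase D =>
      z.2 i * lineDeriv ℝ h z (0, EuclideanSpace.single i 1)) := fun i =>
    integrable_mul_lineDeriv hh hc (hvi i).continuous _
  have i4 : ∀ i : Fin D, Integrable (fun z : Phase D =>
      ((S z.1) i - α * z.2 i) * lineDeriv ℝ h z (0, EuclideanSpace.single i 1)) := fun i => by
    refine ((i2 i).sub ((i3 i).const_mul α)).congr (Eventually.of_forall fun z => ?_)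
    simp only [Pi.sub_apply]; ring
  rw [integral_congr_ae hae, integral_finsetSum _ fun i _ => Integrable.fun_add (i1 i) (i4 i)]
  have hi : ∀ i : Fin D, ∫ z : Phase D, (z.2 i * lineDeriv ℝ h z (EuclideanSpace.single i 1, 0)
        + ((S z.1) i - α * z.2 i) * lineDeriv ℝ h z (0, EuclideanSpace.single i 1))
      = α * ∫ z, h z := fun i => by
    rw [integral_add (i1 i) (i4 i)]
    have e1 : ∫ z : Phase D, ((S z.1) i - α * z.2 i) * lineDeriv ℝ h z
        (0, EuclideanSpace.single i 1)
        = (∫ z : Phase D, (S z.1) i * lineDeriv ℝ h z (0, EuclideanSpace.single i 1))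
          - α * ∫ z : Phase D, z.2 i * lineDeriv ℝ h z (0, EuclideanSpace.single i 1) := by
      rw [← integral_const_mul, ← integral_sub (i2 i) ((i3 i).const_mul α)]
      congr 1 with z; ring
    -- The components `v_i` do not vary with `x`, nor `S_i` with `v`, hence the slopes `c = 0`. Only
    -- the friction term has slope one and contributes `α` for each coordinate.
    rw [e1, integral_mul_lineDeriv_eq hh hc (hvi i) (c := 0) (fun z t => by simp),
      integral_mul_lineDeriv_eq hh hc (hSi i) (c := 0) (fun z t => by simp),
      integral_mul_lineDeriv_eq hh hc (hvi i) (c := 1) (fun z t => by simp)]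
    ring
  rw [Finset.sum_congr rfl fun i _ => hi i]
  simp
  ring

end Divergence

/-! ### Functions transported along trajectories. -/

namespace IsFlow

section Transport

variable {E : Type*} [NormedAddCommGroup E] [NormedSpace ℝ E] {F : ℝ → E → E} {L : ℝ≥0} {a b : ℝ}
  {X Y : ℝ → E → E}

/-- Chain rule along trajectories. -/
lemma hasDerivAt_along (hfl : IsFlow F L a b X Y) {h : ℝ × E → ℝ} {s : ℝ} {z : E}
    (hs : s ∈ Ioo a b) (hd : DifferentiableAt ℝ h (s, z)) :
    HasDerivAt (fun r => h (r, X r (Y s z))) (fderiv ℝ h (s, z) (1, F s z)) s := by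
  have h1 := hfl.hasDerivAt (Y s z) hs
  rw [hfl.right_inv] at h1
  have h2 : HasDerivAt (fun r => (r, X r (Y s z))) ((1 : ℝ), F s z) s :=
    (hasDerivAt_id s).prodMk h1
  have h3 : HasFDerivAt h (fderiv ℝ h (s, z)) ((fun r => (r, X r (Y s z))) s) := by
    simp only [hfl.right_inv]; exact hd.hasFDerivAt
  exact h3.comp_hasDerivAt s h2

/-- A function that is constant along trajectories has vanishing derivative along the field. -/
lemma fderiv_transport_eq_zero (hfl : IsFlow F L a b X Y) {ψ : E → ℝ} {s : ℝ} {z : E}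
    (hs : s ∈ Ioo a b) (hd : DifferentiableAt ℝ (fun q : ℝ × E => ψ (Y q.1 q.2)) (s, z)) :
    fderiv ℝ (fun q : ℝ × E => ψ (Y q.1 q.2)) (s, z) (1, F s z) = 0 := by
  have h1 := hfl.hasDerivAt_along hs hd
  simp only [hfl.left_inv] at h1
  exact h1.unique (hasDerivAt_const _ _)

/-- Transporting a compactly supported Lipschitz function gives a Lipschitz function of `(t,z)`. -/
lemma exists_lipschitz_transport (hfl : IsFlow F L a b X Y) {ψ : E → ℝ} {C : ℝ≥0}
    (hψ : LipschitzWith C ψ) (hc : HasCompactSupport ψ) :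
    ∃ (C' : ℝ≥0) (B : ℝ), LipschitzWith C' (fun q : ℝ × E => ψ (Y q.1 q.2)) ∧
      ∀ t z, ψ (Y t z) ≠ 0 → ‖z‖ ≤ B := by
  obtain ⟨R, hR⟩ := hc.isCompact.isBounded.exists_norm_le
  obtain ⟨B, hB0, hB⟩ := hfl.exists_bound_X R
  have hsupp : ∀ t z, ψ (Y t z) ≠ 0 → ‖z‖ ≤ B := fun t z hz => by
    have := hB t (Y t z) (hR _ (subset_tsupport _ hz))
    rwa [hfl.right_inv] at this
  obtain ⟨C₁, hC₁, hY⟩ := hfl.exists_lipschitz_Y B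
  have key : ∀ s t y z, ‖y‖ ≤ B → |ψ (Y s y) - ψ (Y t z)| ≤ C * (C₁ * (2 * dist (s, y) (t, z))) := by
    intro s t y z hy
    refine (hψ.dist_le_mul _ _).trans ?_
    rw [dist_eq_norm]
    gcongr
    refine (hY s t y z hy).trans ?_
    gcongr
    rw [Prod.dist_eq]
    have h1 := le_max_left (dist s t) (dist y z)
    have h2 := le_max_right (dist s t) (dist y z)
    rw [← Real.dist_eq, ← dist_eq_norm y z]
    linarith
  refine ⟨C * (C₁.toNNReal * 2), B, LipschitzWith.of_dist_le_mul ?_, hsupp⟩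
  rintro ⟨s, y⟩ ⟨t, z⟩
  rw [Real.dist_eq]
  push_cast
  rw [Real.coe_toNNReal _ hC₁, mul_assoc, mul_assoc]
  rcases le_or_gt ‖y‖ B with hy | hy
  · exact key s t y z hy
  · rcases le_or_gt ‖z‖ B with hz | hz
    · rw [abs_sub_comm, dist_comm]; exact key t s z y hz
    · have h1 : ψ (Y s y) = 0 := by_contra fun h => hy.not_ge (hsupp s y h)
      have h2 : ψ (Y t z) = 0 := by_contra fun h => hz.not_ge (hsupp t z h)
      simp only [h1, h2, sub_zero, abs_zero]
      positivity

end Transport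

/-! ### Liouville's formula and change of variables along the flow. -/

section Volume

variable {D : ℕ} {S : ℝ → Space D → Space D} {α : ℝ} {L LS : ℝ≥0} {a b : ℝ}
  {X Y : ℝ → Phase D → Phase D}

/-- A function that is constant along trajectories has time derivative minus its derivative along
the field. Since the divergence of the field is `-αD`, its integral `I` satisfies `I' = -αD I` for
almost every time. -/
lemma integral_transport (hfl : IsFlow (fun t (z : Phase D) => (z.2, S t z.1 - α • z.2)) L a b X Y)
    (hS : ∀ t, LipschitzWith LS (S t)) {ψ : Phase D → ℝ} {C : ℝ≥0} (hψ : LipschitzWith C ψ)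
    (hc : HasCompactSupport ψ) {t : ℝ} (ht : t ∈ Icc a b) :
    Real.exp (α * D * (t - a)) * ∫ z, ψ (Y t z) = ∫ z, ψ z := by
  obtain ⟨C', B, hC', hB⟩ := hfl.exists_lipschitz_transport hψ hc
  set h : ℝ × Phase D → ℝ := fun q => ψ (Y q.1 q.2) with hh
  set I : ℝ → ℝ := fun t => ∫ z, h (t, z) with hI
  have hcs : ∀ t, HasCompactSupport fun z => h (t, z) := fun t =>
    HasCompactSupport.intro (isCompact_closedBall (0 : Phase D) B) fun z hz => by
      by_contra hne
      exact hz (by simpa using hB t z hne)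
  have hlt : ∀ t, LipschitzWith C' fun z => h (t, z) := fun t => by
    have := hC'.comp (LipschitzWith.prodMk_left (α := ℝ) (β := Phase D) t)
    simpa [Function.comp_def] using this
  have hint : ∀ t, Integrable fun z => h (t, z) := fun t =>
    (hlt t).continuous.integrable_of_hasCompactSupport (hcs t)
  have hbi : Integrable ((Metric.closedBall (0 : Phase D) B).indicator fun _ => (C' : ℝ)) :=
    (integrable_indicator_iff Metric.isClosed_closedBall.measurableSet).2
      (integrableOn_const (measure_closedBall_lt_top.ne))
  have hlz : ∀ s t z, |h (s, z) - h (t, z)|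
      ≤ (Metric.closedBall (0 : Phase D) B).indicator (fun _ => (C' : ℝ)) z * |s - t| := by
    intro s t z
    by_cases hz : z ∈ Metric.closedBall (0 : Phase D) B
    · rw [indicator_of_mem hz]
      have := hC'.dist_le_mul (s, z) (t, z)
      simpa [Prod.dist_eq, Real.dist_eq] using this
    · rw [indicator_of_notMem hz]
      have h0 : ∀ t, h (t, z) = 0 := fun t => by
        by_contra hne
        exact hz (by simpa using hB t z hne)
      simp [h0]
  have hder : ∀ᵐ s : ℝ, s ∈ Ioo a b → HasDerivAt I (-(α * D) * I s) s := by
    have h1 : ∀ᵐ s : ℝ, ∀ᵐ z : Phase D, DifferentiableAt ℝ h (s, z) :=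
      Measure.ae_ae_of_ae_prod
        (hC'.ae_differentiableAt (μ := (volume : Measure (ℝ × Phase D))))
    filter_upwards [h1] with s hs hsm
    have h2 := hasDerivAt_integral_of_dominated_loc_of_lip (μ := (volume : Measure (Phase D)))
      (F := fun t z => h (t, z)) (x₀ := s) (F' := fun z => fderiv ℝ h (s, z) (1, 0))
      (s := univ) (bound := (Metric.closedBall (0 : Phase D) B).indicator fun _ => (C' : ℝ))
      univ_mem (Eventually.of_forall fun t => (hint t).aestronglyMeasurable) (hint s)
      ((measurable_fderiv_apply_const ℝ h (1, 0)).comp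
        (measurable_prodMk_left)).aestronglyMeasurable
      (Eventually.of_forall fun z => LipschitzOnWith.of_dist_le_mul fun p _ q _ => by
        rw [Real.dist_eq, Real.dist_eq, Real.coe_nnabs]
        exact (hlz p q z).trans (by gcongr; exact le_abs_self _))
      hbi (by
        filter_upwards [hs] with z hz
        have := hz.hasFDerivAt.comp_hasDerivAt s
          ((hasDerivAt_id s).prodMk (hasDerivAt_const s z))
        exact this)
    have h3 : ∫ z, fderiv ℝ h (s, z) (1, 0) = -(α * D) * I s := by
      have h4 := integral_fderiv_field (hlt s) (hcs s) (hS s) α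
      have h5 : ∀ᵐ z : Phase D, fderiv ℝ h (s, z) (1, 0)
          = - fderiv ℝ (fun z => h (s, z)) z (z.2, S s z.1 - α • z.2) := by
        filter_upwards [hs] with z hz
        have e1 := hfl.fderiv_transport_eq_zero hsm hz
        have e2 : HasFDerivAt (fun z => h (s, z)) ((fderiv ℝ h (s, z)).comp
            (ContinuousLinearMap.inr ℝ ℝ (Phase D))) z :=
          hz.hasFDerivAt.comp z (hasFDerivAt_prodMk_right s z)
        rw [e2.fderiv]
        have e3 : ((1 : ℝ), ((z.2, S s z.1 - α • z.2) : Phase D))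
            = (1, 0) + (0, (z.2, S s z.1 - α • z.2)) := by simp
        rw [e3, map_add] at e1
        simp only [ContinuousLinearMap.comp_apply, ContinuousLinearMap.inr_apply]
        exact eq_neg_of_add_eq_zero_left e1
      rw [integral_congr_ae h5, integral_neg, h4]
      simp only [hI]; ring
    rw [← h3]
    exact h2.2
  -- An equation for `I'` at almost every time does not determine `I` by itself; the Lipschitz bound
  -- excludes a singular part.
  have hIlip : AbsolutelyContinuousOnInterval I a b := by
    refine LipschitzOnWith.absolutelyContinuousOnInterval
      (K := (∫ z, (Metric.closedBall (0 : Phase D) B).indicator (fun _ => (C' : ℝ)) z).toNNReal)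
      (LipschitzOnWith.of_dist_le_mul fun s _ t _ => ?_)
    rw [Real.coe_toNNReal _ (integral_nonneg fun z => indicator_nonneg (fun _ _ => C'.coe_nonneg) z),
      dist_eq_norm, Real.dist_eq, hI, ← integral_sub (hint s) (hint t), ← integral_mul_const]
    exact norm_integral_le_of_norm_le (hbi.mul_const _) (Eventually.of_forall fun z => hlz s t z)
  have hexp : AbsolutelyContinuousOnInterval (fun s => Real.exp (α * D * (s - a))) a b := by
    have hcd : ContDiff ℝ 1 fun s => Real.exp (α * D * (s - a)) := by fun_prop
    obtain ⟨K, hK⟩ := hcd.locallyLipschitz.locallyLipschitzOn.exists_lipschitzOnWith_of_compact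
      (isCompact_uIcc (a := a) (b := b))
    exact hK.absolutelyContinuousOnInterval
  have hends : ∀ᵐ s : ℝ, s ≠ a ∧ s ≠ b := by
    have h1 : ∀ᵐ s : ℝ, s ≠ a := by simp [ae_iff]
    have h2 : ∀ᵐ s : ℝ, s ≠ b := by simp [ae_iff]
    exact h1.and h2
  obtain ⟨c, hcc⟩ := (hexp.mul hIlip).const_of_ae_hasDerivAt_zero (by
    filter_upwards [hder, hends] with s hs hse hsm
    rw [uIcc_of_le hfl.le] at hsm
    have hso : s ∈ Ioo a b := ⟨lt_of_le_of_ne hsm.1 hse.1.symm, lt_of_le_of_ne hsm.2 hse.2⟩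
    have h1 : HasDerivAt (fun s => Real.exp (α * D * (s - a)))
        (Real.exp (α * D * (s - a)) * (α * D * 1)) s :=
      (((hasDerivAt_id s).sub_const a).const_mul (α * D)).exp
    have h2 := h1.mul (hs hso)
    refine h2.congr_deriv ?_
    ring)
  rw [uIcc_of_le hfl.le] at hcc
  have h1 := hcc t ht
  rw [← hcc a ⟨le_rfl, hfl.le⟩] at h1
  have hYa : ∀ z, Y a z = z := fun z => by
    have := hfl.right_inv a z
    rwa [hfl.init] at this
  simpa [hI, hh, hYa] using h1

lemma measurable_X (hfl : IsFlow (fun t (z : Phase D) => (z.2, S t z.1 - α • z.2)) L a b X Y)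
    (t : ℝ) : Measurable (X t) := (hfl.lipX t).continuous.measurable

lemma measurable_Y (hfl : IsFlow (fun t (z : Phase D) => (z.2, S t z.1 - α • z.2)) L a b X Y)
    (t : ℝ) : Measurable (Y t) := (hfl.lipY t).continuous.measurable

/-- Liouville's formula for the inverse flow. -/
lemma map_Y_volume (hfl : IsFlow (fun t (z : Phase D) => (z.2, S t z.1 - α • z.2)) L a b X Y)
    (hS : ∀ t, LipschitzWith LS (S t)) {t : ℝ} (ht : t ∈ Icc a b) :
    ENNReal.ofReal (Real.exp (α * D * (t - a))) • Measure.map (Y t) volume = volume := by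
  have hlf : IsFiniteMeasureOnCompacts (Measure.map (Y t) volume) := by
    refine ⟨fun K hK => ?_⟩
    rw [Measure.map_apply (hfl.measurable_Y t) hK.measurableSet]
    obtain ⟨R, hR⟩ := hK.isBounded.exists_norm_le
    obtain ⟨B, -, hB⟩ := hfl.exists_bound_X R
    refine (measure_mono (t := Metric.closedBall 0 B) fun z hz => ?_).trans_lt
      measure_closedBall_lt_top
    have := hB t (Y t z) (hR _ hz)
    rw [hfl.right_inv] at this
    simpa using this
  have hlf2 : IsFiniteMeasureOnCompacts (ENNReal.ofReal (Real.exp (α * D * (t - a))) •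
      Measure.map (Y t) (volume : Measure (Phase D))) :=
    ⟨fun K hK => by
      rw [Measure.smul_apply, smul_eq_mul]
      exact ENNReal.mul_lt_top ENNReal.ofReal_lt_top hK.measure_lt_top⟩
  refine measure_ext_of_integral_smooth fun g hg hgc => ?_
  obtain ⟨C, hC⟩ := ContDiff.lipschitzWith_of_hasCompactSupport hgc hg (by simp)
  rw [integral_smul_measure, integral_map (hfl.measurable_Y t).aemeasurable
    hg.continuous.aestronglyMeasurable, ENNReal.toReal_ofReal (Real.exp_pos _).le, smul_eq_mul]
  exact hfl.integral_transport hS hC hgc ht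

/-- Liouville's formula. -/
lemma map_X_volume (hfl : IsFlow (fun t (z : Phase D) => (z.2, S t z.1 - α • z.2)) L a b X Y)
    (hS : ∀ t, LipschitzWith LS (S t)) {t : ℝ} (ht : t ∈ Icc a b) :
    Measure.map (X t) volume = ENNReal.ofReal (Real.exp (α * D * (t - a))) • volume := by
  conv_lhs => rw [← hfl.map_Y_volume hS ht]
  rw [Measure.map_smul, Measure.map_map (hfl.measurable_X t) (hfl.measurable_Y t)]
  have : X t ∘ Y t = id := funext fun z => hfl.right_inv t z
  rw [this, Measure.map_id]

/-- Change of variables along the flow. -/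
lemma integral_comp_X {H : Type*} [NormedAddCommGroup H] [NormedSpace ℝ H]
    (hfl : IsFlow (fun t (z : Phase D) => (z.2, S t z.1 - α • z.2)) L a b X Y)
    (hS : ∀ t, LipschitzWith LS (S t)) {t : ℝ} (ht : t ∈ Icc a b) {u : Phase D → H}
    (hu : AEStronglyMeasurable u volume) :
    ∫ z, u (X t z) = Real.exp (α * D * (t - a)) • ∫ z, u z := by
  have h1 := integral_map (μ := volume) (hfl.measurable_X t).aemeasurable (f := u) (by
    rw [hfl.map_X_volume hS ht]; exact hu.smul_measure _)
  rw [← h1, hfl.map_X_volume hS ht, integral_smul_measure,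
    ENNReal.toReal_ofReal (Real.exp_pos _).le]

lemma integrable_comp_Y {H : Type*} [NormedAddCommGroup H] [NormedSpace ℝ H]
    (hfl : IsFlow (fun t (z : Phase D) => (z.2, S t z.1 - α • z.2)) L a b X Y)
    (hS : ∀ t, LipschitzWith LS (S t)) {t : ℝ} (ht : t ∈ Icc a b) {u : Phase D → H}
    (hu : Integrable u) : Integrable fun z => u (Y t z) := by
  rw [← hfl.map_Y_volume hS ht, integrable_smul_measure (by simp [Real.exp_pos])
    ENNReal.ofReal_ne_top] at hu
  exact hu.comp_measurable (hfl.measurable_Y t)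

lemma integral_comp_Y {H : Type*} [NormedAddCommGroup H] [NormedSpace ℝ H]
    (hfl : IsFlow (fun t (z : Phase D) => (z.2, S t z.1 - α • z.2)) L a b X Y)
    (hS : ∀ t, LipschitzWith LS (S t)) {t : ℝ} (ht : t ∈ Icc a b) {u : Phase D → H}
    (hu : Integrable u) :
    Real.exp (α * D * (t - a)) • ∫ z, u (Y t z) = ∫ z, u z := by
  rw [← hfl.integral_comp_X hS ht (hfl.integrable_comp_Y hS ht hu).aestronglyMeasurable]
  simp only [hfl.left_inv]

/-- The image of Lebesgue measure under `Y t` is a positive multiple of Lebesgue measure, so null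
sets in Lagrangian and in Eulerian coordinates correspond. -/
lemma ae_of_ae_comp_X
    (hfl : IsFlow (fun t (z : Phase D) => (z.2, S t z.1 - α • z.2)) L a b X Y)
    (hS : ∀ t, LipschitzWith LS (S t)) {t : ℝ} (ht : t ∈ Icc a b) {p : Phase D → Prop}
    (h : ∀ᵐ y, p (X t y)) : ∀ᵐ z, p z := by
  have h1 : ∀ᵐ z ∂(Measure.map (Y t) (volume : Measure (Phase D))),  p (X t z) := by
    have h2 : Measure.map (Y t) (volume : Measure (Phase D)) ≪ volume := by
      conv_rhs => rw [← hfl.map_Y_volume hS ht]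
      refine Measure.absolutelyContinuous_smul ?_
      simp [Real.exp_pos]
    exact h2.ae_le h
  have h2 := ae_of_ae_map (hfl.measurable_Y t).aemeasurable h1
  simpa [hfl.right_inv] using h2

end Volume

end IsFlow

/-! ### Lagrangian representation of weak solutions. -/

section Representation

variable {D : ℕ} {Ω : Set (Phase D)} {S : ℝ → Space D → Space D} {α : ℝ} {L LS : ℝ≥0} {a b : ℝ}
  {X Y : ℝ → Phase D → Phase D} {f : ℝ → L2 Ω ℝ}

/-- The test function `(s,z) ↦ ψ (X t (Y s z))` is constant along trajectories. Its integral against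
`f s` is therefore conserved; at `s = t` it is the left side and at `s = a` the right side. -/
lemma IsWeakSolution.integral_push
    (hw : IsWeakSolution Ω a b f (fun t (z : Phase D) => (z.2, S t z.1 - α • z.2)))
    (hfl : IsFlow (fun t (z : Phase D) => (z.2, S t z.1 - α • z.2)) L a b X Y) (hab : a < b)
    (hΩ : MeasurableSet Ω) (hbd : Bornology.IsBounded Ω) (hf : Continuous f) {ψ : Phase D → ℝ}
    {C : ℝ≥0} (hψ : LipschitzWith C ψ) (hc : HasCompactSupport ψ) {t : ℝ} (ht : t ∈ Icc a b) :
    ∫ z in Ω, f t z * ψ z = ∫ z in Ω, f a z * ψ (X t z) := by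
  have hψ' : LipschitzWith (C * _) (ψ ∘ X t) := hψ.comp (hfl.lipX t)
  have hc' : HasCompactSupport (ψ ∘ X t) := by
    obtain ⟨R, hR⟩ := hc.isCompact.isBounded.exists_norm_le
    obtain ⟨B, hB0, hB⟩ := hfl.exists_bound R
    refine HasCompactSupport.intro (isCompact_closedBall (0 : Phase D) B) fun z hz => ?_
    by_contra hne
    have := hB t a z (hR _ (subset_tsupport _ hne))
    rw [hfl.init] at this
    exact hz (by simpa using this)
  obtain ⟨C', B, hC', -⟩ := hfl.exists_lipschitz_transport hψ' hc'
  have h1 := hw.integral_lipschitz hab hΩ hbd hf hfl.cont hC' t ht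
  have hYa : ∀ z, Y a z = z := fun z => by
    have := hfl.right_inv a z
    rwa [hfl.init] at this
  simp only [Function.comp, hfl.right_inv, hYa] at h1
  rw [h1, add_eq_left]
  refine intervalIntegral.integral_zero_ae ?_
  have h2 : ∀ᵐ s : ℝ, ∀ᵐ z : Phase D,
      DifferentiableAt ℝ (fun q : ℝ × Phase D => (ψ ∘ X t) (Y q.1 q.2)) (s, z) :=
    Measure.ae_ae_of_ae_prod (hC'.ae_differentiableAt (μ := (volume : Measure (ℝ × Phase D))))
  have h3 : ∀ᵐ s : ℝ, s ≠ t := by simp [ae_iff]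
  filter_upwards [h2, h3] with s hs hst hsm
  rw [uIoc_of_le ht.1] at hsm
  refine integral_eq_zero_of_ae ?_
  filter_upwards [ae_restrict_of_ae hs] with z hz
  have := hfl.fderiv_transport_eq_zero (s := s) (z := z) (ψ := ψ ∘ X t)
    ⟨hsm.1, (lt_of_le_of_ne hsm.2 hst).trans_le ht.2⟩ hz
  simp only [Function.comp] at this
  rw [this]; simp

/-- A jointly measurable version of the density transported by the flow. -/
noncomputable def transported (Ω : Set (Phase D)) (α a : ℝ) (Y : ℝ → Phase D → Phase D)
    (u : Phase D → ℝ) (t : ℝ) (z : Phase D) : ℝ :=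
  Real.exp (α * D * (t - a)) * Ω.indicator u (Y t z)

lemma measurable_transported (hΩ : MeasurableSet Ω) (hY : Continuous (Function.uncurry Y))
    {u : Phase D → ℝ} (hu : Measurable u) :
    Measurable (Function.uncurry (transported Ω α a Y u)) := by
  have h1 : Measurable fun p : ℝ × Phase D => Ω.indicator u (Y p.1 p.2) :=
    (hu.indicator hΩ).comp hY.measurable
  have h2 : Measurable fun p : ℝ × Phase D => Real.exp (α * D * (p.1 - a)) := by fun_prop
  exact h2.mul h1

lemma integrable_indicator_L2 (hΩ : MeasurableSet Ω) (hbd : Bornology.IsBounded Ω)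
    (u : L2 Ω ℝ) : Integrable (Ω.indicator u) :=
  (integrable_indicator_iff hΩ).2 (IsPath.integrable hbd u)

/-- A weak solution is transported by the flow. -/
lemma IsWeakSolution.ae_eq_transported
    (hw : IsWeakSolution Ω a b f (fun t (z : Phase D) => (z.2, S t z.1 - α • z.2)))
    (hfl : IsFlow (fun t (z : Phase D) => (z.2, S t z.1 - α • z.2)) L a b X Y)
    (hS : ∀ t, LipschitzWith LS (S t)) (hab : a < b)
    (hΩ : MeasurableSet Ω) (hbd : Bornology.IsBounded Ω) (hf : Continuous f)
    {t : ℝ} (ht : t ∈ Icc a b) :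
    Ω.indicator (f t) =ᵐ[volume] transported Ω α a Y (f a) t := by
  have hia := integrable_indicator_L2 hΩ hbd (f a)
  refine ae_eq_of_integral_contDiff_smul_eq
    (integrable_indicator_L2 hΩ hbd (f t)).locallyIntegrable
    ((hfl.integrable_comp_Y hS ht hia).const_mul _).locallyIntegrable fun g hg hgc => ?_
  obtain ⟨C, hC⟩ := ContDiff.lipschitzWith_of_hasCompactSupport hgc hg (by simp)
  have h1 := hw.integral_push hfl hab hΩ hbd hf hC hgc ht
  have e1 : ∫ z, g z • Ω.indicator (f t) z = ∫ z in Ω, f t z * g z := by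
    rw [← integral_indicator hΩ]
    congr 1 with z
    by_cases hz : z ∈ Ω <;> simp [hz, mul_comm]
  have e2 : ∫ z in Ω, f a z * g (X t z) = ∫ z, Ω.indicator (f a) (Y t (X t z)) * g (X t z) := by
    rw [← integral_indicator hΩ]
    congr 1 with z
    rw [hfl.left_inv]
    by_cases hz : z ∈ Ω <;> simp [hz]
  rw [e1, h1, e2, hfl.integral_comp_X hS ht
    (u := fun z => Ω.indicator (f a) (Y t z) * g z)
    ((hfl.integrable_comp_Y hS ht hia).aestronglyMeasurable.mul
      hg.continuous.aestronglyMeasurable), ← integral_smul]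
  congr 1 with z
  simp only [transported, smul_eq_mul]
  ring

/-- Integrals against a weak solution in Lagrangian coordinates. -/
lemma IsWeakSolution.integral_smul_eq {H : Type*} [NormedAddCommGroup H] [NormedSpace ℝ H]
    (hw : IsWeakSolution Ω a b f (fun t (z : Phase D) => (z.2, S t z.1 - α • z.2)))
    (hfl : IsFlow (fun t (z : Phase D) => (z.2, S t z.1 - α • z.2)) L a b X Y)
    (hS : ∀ t, LipschitzWith LS (S t)) (hab : a < b)
    (hΩ : MeasurableSet Ω) (hbd : Bornology.IsBounded Ω) (hf : Continuous f)
    {t : ℝ} (ht : t ∈ Icc a b) {c : Phase D → H} (hc : AEStronglyMeasurable c volume) :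
    ∫ z in Ω, f t z • c z = ∫ z in Ω, f a z • c (X t z) := by
  have hia := integrable_indicator_L2 hΩ hbd (f a)
  have e0 := hw.ae_eq_transported hfl hS hab hΩ hbd hf ht
  have e1 : ∫ z in Ω, f t z • c z = ∫ z, Ω.indicator (f t) z • c z := by
    rw [← integral_indicator hΩ]
    congr 1 with z
    by_cases hz : z ∈ Ω <;> simp [hz]
  have e2 : ∫ z in Ω, f a z • c (X t z) = ∫ z, Ω.indicator (f a) (Y t (X t z)) • c (X t z) := by
    rw [← integral_indicator hΩ]
    congr 1 with z
    rw [hfl.left_inv]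
    by_cases hz : z ∈ Ω <;> simp [hz]
  have e3 : ∫ z, Ω.indicator (f t) z • c z = ∫ z, transported Ω α a Y (f a) t z • c z := by
    refine integral_congr_ae ?_
    filter_upwards [e0] with z hz
    rw [hz]
  rw [e1, e2, e3, hfl.integral_comp_X hS ht (u := fun z => Ω.indicator (f a) (Y t z) • c z)
    ((hfl.integrable_comp_Y hS ht hia).aestronglyMeasurable.smul hc), ← integral_smul]
  congr 1 with z
  simp only [transported, smul_smul]

end Representation

/-! ### Stability of the flow in the mean under changes of the agents. -/

section Stability

variable {D M : ℕ} {Ω : Set (Phase D)} {K₁ K₂ : Space D → Space D} {α : ℝ} {L₁ L₂ : ℝ≥0} {a b : ℝ}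
  {fa : L2 Ω ℝ}

/-- States of the system with regularised kernels, on the whole time axis. -/
structure IsRegState (Ω : Set (Phase D)) (K₁ K₂ : Space D → Space D) (α a b : ℝ) (fa : L2 Ω ℝ)
    (f : ℝ → L2 Ω ℝ) (d : ℝ → Agents M D) : Prop where
  path : IsPath Ω f d
  init : f a = fa
  weak : IsWeakSolution Ω a b f (field Ω K₁ K₂ α f d)

/-- Data shared by all states: the domain and the kernels. -/
structure Setting (Ω : Set (Phase D)) (K₁ K₂ : Space D → Space D) (L₁ L₂ : ℝ≥0) (a b : ℝ) :
    Prop where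
  lt : a < b
  meas : MeasurableSet Ω
  bdd : Bornology.IsBounded Ω
  lip₁ : LipschitzWith L₁ K₁
  lip₂ : LipschitzWith L₂ K₂

namespace IsRegState

variable {f f₁ f₂ : ℝ → L2 Ω ℝ} {d d₁ d₂ : ℝ → Agents M D} {X Y X₁ Y₁ X₂ Y₂ : ℝ → Phase D → Phase D}

lemma exists_flow (hs : IsRegState Ω K₁ K₂ α a b fa f d) (h : Setting Ω K₁ K₂ L₁ L₂ a b) :
    ∃ X Y, IsFlow (field Ω K₁ K₂ α f d) (1 + L₁ + L₂ + ‖α‖₊) a b X Y :=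
  MeanFieldControl.exists_flow h.lt.le (fun t => hs.path.lipschitz_field h.bdd h.lip₁ h.lip₂ t)
    (hs.path.continuous_field h.bdd h.lip₁.continuous h.lip₂.continuous)

lemma lip_force (hs : IsRegState Ω K₁ K₂ α a b fa f d) (h : Setting Ω K₁ K₂ L₁ L₂ a b) (t : ℝ) :
    LipschitzWith (L₁ + L₂) (force Ω K₁ K₂ f d t) :=
  LipschitzWith.of_dist_le_mul fun x y => by
    rw [dist_eq_norm, dist_eq_norm]
    exact_mod_cast hs.path.norm_force_sub_le h.bdd h.lip₁ h.lip₂ t x y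

/-- The mean displacement between two flows. -/
noncomputable def displacement (fa : L2 Ω ℝ) (X₁ X₂ : ℝ → Phase D → Phase D) (t : ℝ) : ℝ :=
  ∫ y in Ω, fa y * ‖X₁ t y - X₂ t y‖

lemma continuous_displacement (hbd : Bornology.IsBounded Ω)
    (hX₁ : Continuous (Function.uncurry X₁)) (hX₂ : Continuous (Function.uncurry X₂)) :
    Continuous (displacement fa X₁ X₂) := by
  have hc : Continuous fun p : ℝ × Phase D => ‖X₁ p.1 p.2 - X₂ p.1 p.2‖ := (hX₁.sub hX₂).norm
  exact continuous_pairing_set hbd (f := fun _ : ℝ => fa) continuous_const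
    (c := fun t y => ‖X₁ t y - X₂ t y‖) hc

/-- Both states start from the same density `fa`. In Lagrangian coordinates their interaction forces
are averages of `K₁` against `fa` along the two flows, so they differ by at most the mean
displacement, although the densities themselves are not Lipschitz in the agents. -/
lemma norm_force_sub_le (hs₁ : IsRegState Ω K₁ K₂ α a b fa f₁ d₁)
    (hs₂ : IsRegState Ω K₁ K₂ α a b fa f₂ d₂) (h : Setting Ω K₁ K₂ L₁ L₂ a b) {Λ₁ Λ₂ : ℝ≥0}
    (hfl₁ : IsFlow (field Ω K₁ K₂ α f₁ d₁) Λ₁ a b X₁ Y₁)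
    (hfl₂ : IsFlow (field Ω K₁ K₂ α f₂ d₂) Λ₂ a b X₂ Y₂) {η : ℝ} {t : ℝ} (ht : t ∈ Icc a b)
    (hη0 : 0 ≤ η) (hη : ∀ m, ‖d₁ t m - d₂ t m‖ ≤ η) (x : Space D) :
    ‖force Ω K₁ K₂ f₁ d₁ t x - force Ω K₁ K₂ f₂ d₂ t x‖
      ≤ L₁ * displacement fa X₁ X₂ t + L₂ * η := by
  have hdens : IsDensity Ω fa := by rw [← hs₁.init]; exact hs₁.path.density a
  have hKc : Continuous fun z : Phase D => K₁ (x - z.1) := h.lip₁.continuous.comp (by fun_prop)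
  have r₁ := hs₁.weak.integral_smul_eq hfl₁ (hs₁.lip_force h) h.lt h.meas h.bdd hs₁.path.contf ht
    (c := fun z => K₁ (x - z.1)) hKc.aestronglyMeasurable
  have r₂ := hs₂.weak.integral_smul_eq hfl₂ (hs₂.lip_force h) h.lt h.meas h.bdd hs₂.path.contf ht
    (c := fun z => K₁ (x - z.1)) hKc.aestronglyMeasurable
  rw [hs₁.init] at r₁
  rw [hs₂.init] at r₂
  have e3 : force Ω K₁ K₂ f₁ d₁ t x - force Ω K₁ K₂ f₂ d₂ t x
      = -((∫ z in Ω, f₁ t z • K₁ (x - z.1)) - ∫ z in Ω, f₂ t z • K₁ (x - z.1))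
        + ((1 / (M : ℝ)) • ∑ m, K₂ (x - d₂ t m) - (1 / (M : ℝ)) • ∑ m, K₂ (x - d₁ t m)) := by
    simp only [force]; abel
  rw [e3]
  refine (norm_add_le _ _).trans (add_le_add ?_ ?_)
  · have c1 : Continuous (X₁ t) := (hfl₁.lipX t).continuous
    have c2 : Continuous (X₂ t) := (hfl₂.lipX t).continuous
    have i1 := IsPath.integrable_smul h.bdd fa (c := fun y => K₁ (x - (X₁ t y).1)) (hKc.comp c1)
    have i2 := IsPath.integrable_smul h.bdd fa (c := fun y => K₁ (x - (X₂ t y).1)) (hKc.comp c2)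
    rw [norm_neg, r₁, r₂, ← integral_sub i1 i2, displacement, ← integral_const_mul]
    refine norm_integral_le_of_norm_le ?_ ?_
    · exact (IsPath.integrable_smul h.bdd fa (c1.sub c2).norm).const_mul _
    · filter_upwards [hdens.1] with y hy
      rw [← smul_sub, norm_smul, Real.norm_of_nonneg hy]
      have h1 := h.lip₁.norm_sub_le (x - (X₁ t y).1) (x - (X₂ t y).1)
      rw [sub_sub_sub_cancel_left, norm_sub_rev (X₂ t y).1] at h1
      have h2 : ‖(X₁ t y).1 - (X₂ t y).1‖ ≤ ‖X₁ t y - X₂ t y‖ := norm_fst_le (X₁ t y - X₂ t y)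
      calc fa y * ‖K₁ (x - (X₁ t y).1) - K₁ (x - (X₂ t y).1)‖
          ≤ fa y * (L₁ * ‖X₁ t y - X₂ t y‖) := by gcongr; exact h1.trans (by gcongr)
        _ = _ := by ring
  · refine IsPath.norm_average_sub_le (by positivity) fun m => ?_
    have h1 := h.lip₂.norm_sub_le (x - d₂ t m) (x - d₁ t m)
    rw [sub_sub_sub_cancel_left] at h1
    exact h1.trans (by gcongr; exact hη m)

/-- The growth rate in the stability estimate. -/
noncomputable def stabRate (L₁ L₂ : ℝ≥0) (α : ℝ) : ℝ := (1 + L₁ + L₂ + ‖α‖) + 2 * L₁ + 2 * L₂ + 1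

lemma norm_field_sub (f₁ f₂ : ℝ → L2 Ω ℝ) (d₁ d₂ : ℝ → Agents M D) (t : ℝ) (z : Phase D) :
    ‖field Ω K₁ K₂ α f₁ d₁ t z - field Ω K₁ K₂ α f₂ d₂ t z‖
      = ‖force Ω K₁ K₂ f₁ d₁ t z.1 - force Ω K₁ K₂ f₂ d₂ t z.1‖ := by
  simp [field, Prod.norm_def]

/-- A continuation argument. Let `A` be the maximum of the exponentially weighted mean displacement.
The rate is large enough that each pointwise displacement stays below a barrier of height `(A +
η)/2`. Averaging at the maximum gives `A ≤ (A + η)/2`, that is, `A ≤ η`. -/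
lemma displacement_le (hs₁ : IsRegState Ω K₁ K₂ α a b fa f₁ d₁)
    (hs₂ : IsRegState Ω K₁ K₂ α a b fa f₂ d₂) (h : Setting Ω K₁ K₂ L₁ L₂ a b)
    (hfl₁ : IsFlow (field Ω K₁ K₂ α f₁ d₁) (1 + L₁ + L₂ + ‖α‖₊) a b X₁ Y₁)
    (hfl₂ : IsFlow (field Ω K₁ K₂ α f₂ d₂) (1 + L₁ + L₂ + ‖α‖₊) a b X₂ Y₂) {η : ℝ} (hη0 : 0 < η)
    (hη : ∀ t ∈ Icc a b, ∀ m, ‖d₁ t m - d₂ t m‖ ≤ η) {t : ℝ} (ht : t ∈ Icc a b) :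
    displacement fa X₁ X₂ t ≤ Real.exp (stabRate L₁ L₂ α * (b - a)) * η := by
  have hdens : IsDensity Ω fa := by rw [← hs₁.init]; exact hs₁.path.density a
  set lam := stabRate L₁ L₂ α with hlam
  have hlam0 : 0 ≤ lam := by rw [hlam, stabRate]; positivity
  have hec : Continuous fun t => Real.exp (-(lam * (t - a))) * displacement fa X₁ X₂ t :=
    (by fun_prop : Continuous fun t => Real.exp (-(lam * (t - a)))).mul
      (continuous_displacement h.bdd hfl₁.continuous_X hfl₂.continuous_X)
  obtain ⟨ts, hts, hmax⟩ := isCompact_Icc.exists_isMaxOn (nonempty_Icc.2 h.lt.le)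
    hec.continuousOn
  set A := Real.exp (-(lam * (ts - a))) * displacement fa X₁ X₂ ts with hA
  have hle : ∀ t ∈ Icc a b, displacement fa X₁ X₂ t ≤ A * Real.exp (lam * (t - a)) := by
    intro t ht
    have h1 : Real.exp (-(lam * (t - a))) * displacement fa X₁ X₂ t ≤ A := hmax ht
    rw [Real.exp_neg, inv_mul_le_iff₀ (Real.exp_pos _)] at h1
    linarith
  have hd0 : ∀ t, 0 ≤ displacement fa X₁ X₂ t := fun t =>
    integral_nonneg_of_ae (by
      filter_upwards [hdens.1] with y hy
      exact mul_nonneg hy (norm_nonneg _))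
  have hA0 : 0 ≤ A := mul_nonneg (Real.exp_pos _).le (hd0 _)
  -- The summands `2 L₁` and `2 L₂` of the rate offset this factor one half, and the last `1` makes
  -- the inequality at a touching point strict. Positivity of `β` uses `η > 0`.
  set β := (A + η) / 2 with hβ
  have hβ0 : 0 < β := by positivity
  have hpt : ∀ y, ∀ t ∈ Icc a b, ‖X₁ t y - X₂ t y‖ ≤ β * Real.exp (lam * (t - a)) := by
    intro y
    have hder : ∀ t ∈ Icc a b, HasDerivWithinAt (fun t => X₁ t y - X₂ t y)
        (field Ω K₁ K₂ α f₁ d₁ t (X₁ t y) - field Ω K₁ K₂ α f₂ d₂ t (X₂ t y)) (Icc a b) t :=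
      fun t ht => (hfl₁.deriv y t ht).sub (hfl₂.deriv y t ht)
    refine image_norm_le_of_norm_deriv_right_lt_deriv_boundary'
      (fun t ht => (hder t ht).continuousWithinAt)
      (fun t ht => (hder t ⟨ht.1, ht.2.le⟩).mono_of_mem_nhdsWithin
        (mem_of_superset (Icc_mem_nhdsGE ht.2) (Icc_subset_Icc_left ht.1)))
      (B' := fun t => β * (Real.exp (lam * (t - a)) * (lam * 1))) ?_ (by fun_prop)
      (fun t _ => ((((hasDerivAt_id t).sub_const a).const_mul lam).exp.const_mul β).hasDerivWithinAt)
      ?_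
    · rw [hfl₁.init, hfl₂.init, sub_self, norm_zero]; positivity
    · intro t ht hteq
      have htI : t ∈ Icc a b := ⟨ht.1, ht.2.le⟩
      have hexp : 1 ≤ Real.exp (lam * (t - a)) :=
        Real.one_le_exp (mul_nonneg hlam0 (sub_nonneg.2 ht.1))
      have h1 := (hfl₁.lip t).norm_sub_le (X₁ t y) (X₂ t y)
      have h2 := norm_force_sub_le hs₁ hs₂ h hfl₁ hfl₂ htI hη0.le (hη t htI) (X₂ t y).1
      rw [← norm_field_sub (α := α)] at h2
      have h3 := norm_sub_le_norm_sub_add_norm_sub (field Ω K₁ K₂ α f₁ d₁ t (X₁ t y))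
        (field Ω K₁ K₂ α f₁ d₁ t (X₂ t y)) (field Ω K₁ K₂ α f₂ d₂ t (X₂ t y))
      rw [hteq] at h1
      push_cast at h1
      have h4 := hle t htI
      set e := Real.exp (lam * (t - a)) with he
      have e1 : (L₁ : ℝ) * displacement fa X₁ X₂ t ≤ L₁ * (A * e) := by gcongr
      have e2 : (L₂ : ℝ) * η ≤ L₂ * (η * e) := by
        gcongr; exact le_mul_of_one_le_right hη0.le hexp
      have e3 : lam = (1 + L₁ + L₂ + ‖α‖) + 2 * L₁ + 2 * L₂ + 1 := hlam
      have e4 : β * (e * (lam * 1)) = (1 + L₁ + L₂ + ‖α‖) * (β * e)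
          + (L₁ * (A * e) + L₁ * (η * e) + L₂ * (A * e) + L₂ * (η * e)) + β * e := by
        rw [e3, hβ]; ring
      have e5 : 0 < β * e := by positivity
      have e6 : (0 : ℝ) ≤ L₁ * (η * e) := by positivity
      have e7 : (0 : ℝ) ≤ L₂ * (A * e) := by positivity
      rw [e4]
      linarith
  have hAβ : A ≤ β := by
    rw [hA, Real.exp_neg, inv_mul_le_iff₀ (Real.exp_pos _)]
    have c1 : Continuous (X₁ ts) := (hfl₁.lipX ts).continuous
    have c2 : Continuous (X₂ ts) := (hfl₂.lipX ts).continuous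
    calc displacement fa X₁ X₂ ts
        ≤ ∫ y in Ω, fa y * (β * Real.exp (lam * (ts - a))) := by
          refine integral_mono_ae ?_ ((IsPath.integrable h.bdd fa).mul_const _) ?_
          · exact IsPath.integrable_smul h.bdd fa (c1.sub c2).norm
          · filter_upwards [hdens.1] with y hy
            exact mul_le_mul_of_nonneg_left (hpt y ts hts) hy
      _ = Real.exp (lam * (ts - a)) * β := by rw [integral_mul_const, hdens.2]; ring
  have hAη : A ≤ η := by linarith
  calc displacement fa X₁ X₂ t ≤ A * Real.exp (lam * (t - a)) := hle t ht
    _ ≤ η * Real.exp (lam * (b - a)) := by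
      gcongr
      exact ht.2
    _ = _ := mul_comm _ _

end IsRegState

end Stability

/-! ### Pointwise stability of the flow, Lipschitz averages, and `L¹` continuity of the densities.
-/

section StabilityFlow

variable {D M : ℕ} {Ω : Set (Phase D)} {K₁ K₂ : Space D → Space D} {α : ℝ} {L₁ L₂ : ℝ≥0} {a b : ℝ}
  {fa : L2 Ω ℝ}

/-- The constant in the stability estimate for the field. -/
noncomputable def fieldConst (L₁ L₂ : ℝ≥0) (α a b : ℝ) : ℝ :=
  L₁ * Real.exp (IsRegState.stabRate L₁ L₂ α * (b - a)) + L₂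

/-- The constant in the stability estimate for the flow. -/
noncomputable def flowConst (L₁ L₂ : ℝ≥0) (α a b : ℝ) : ℝ :=
  fieldConst L₁ L₂ α a b * gronwallConst (1 + L₁ + L₂ + ‖α‖₊ : ℝ≥0) (b - a)

lemma fieldConst_nonneg : 0 ≤ fieldConst L₁ L₂ α a b := by
  rw [fieldConst]; positivity

lemma flowConst_nonneg (hab : a ≤ b) : 0 ≤ flowConst L₁ L₂ α a b :=
  mul_nonneg fieldConst_nonneg (zero_le_one.trans
    (one_le_gronwallConst (NNReal.coe_nonneg _) (sub_nonneg.2 hab)))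

namespace IsRegState

variable {f₁ f₂ : ℝ → L2 Ω ℝ} {d₁ d₂ : ℝ → Agents M D} {X₁ Y₁ X₂ Y₂ : ℝ → Phase D → Phase D}

lemma norm_force_diff_le (hs₁ : IsRegState Ω K₁ K₂ α a b fa f₁ d₁)
    (hs₂ : IsRegState Ω K₁ K₂ α a b fa f₂ d₂) (h : Setting Ω K₁ K₂ L₁ L₂ a b) {η : ℝ} (hη0 : 0 < η)
    (hη : ∀ t ∈ Icc a b, ∀ m, ‖d₁ t m - d₂ t m‖ ≤ η) {t : ℝ} (ht : t ∈ Icc a b) (x : Space D) :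
    ‖force Ω K₁ K₂ f₁ d₁ t x - force Ω K₁ K₂ f₂ d₂ t x‖ ≤ fieldConst L₁ L₂ α a b * η := by
  obtain ⟨X₁, Y₁, hfl₁⟩ := hs₁.exists_flow h
  obtain ⟨X₂, Y₂, hfl₂⟩ := hs₂.exists_flow h
  refine (norm_force_sub_le hs₁ hs₂ h hfl₁ hfl₂ ht hη0.le (hη t ht) x).trans ?_
  have := displacement_le hs₁ hs₂ h hfl₁ hfl₂ hη0 hη ht
  rw [fieldConst, add_mul, mul_assoc]
  gcongr

lemma norm_X_sub_le (hs₁ : IsRegState Ω K₁ K₂ α a b fa f₁ d₁)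
    (hs₂ : IsRegState Ω K₁ K₂ α a b fa f₂ d₂) (h : Setting Ω K₁ K₂ L₁ L₂ a b)
    (hfl₁ : IsFlow (field Ω K₁ K₂ α f₁ d₁) (1 + L₁ + L₂ + ‖α‖₊) a b X₁ Y₁)
    (hfl₂ : IsFlow (field Ω K₁ K₂ α f₂ d₂) (1 + L₁ + L₂ + ‖α‖₊) a b X₂ Y₂) {η : ℝ} (hη0 : 0 < η)
    (hη : ∀ t ∈ Icc a b, ∀ m, ‖d₁ t m - d₂ t m‖ ≤ η) {t : ℝ} (ht : t ∈ Icc a b) (y : Phase D) :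
    ‖X₁ t y - X₂ t y‖ ≤ flowConst L₁ L₂ α a b * η := by
  have h1 := norm_sub_le_of_solutions (s := a) (t := t) hfl₁.lip
    (mul_nonneg fieldConst_nonneg hη0.le) (hfl₁.deriv y) (hfl₂.deriv y)
    (fun t ht => by
      rw [norm_field_sub]; exact norm_force_diff_le hs₁ hs₂ h hη0 hη ht _)
    ⟨le_rfl, h.lt.le⟩ ht
  rw [hfl₁.init, hfl₂.init, sub_self, norm_zero, zero_add] at h1
  refine h1.trans (le_of_eq ?_)
  rw [flowConst]; ring

/-- The two trajectories now coincide at time `t` and are compared at time `a`, so the two-sided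
Grönwall estimate is used backward. -/
lemma norm_Y_sub_le (hs₁ : IsRegState Ω K₁ K₂ α a b fa f₁ d₁)
    (hs₂ : IsRegState Ω K₁ K₂ α a b fa f₂ d₂) (h : Setting Ω K₁ K₂ L₁ L₂ a b)
    (hfl₁ : IsFlow (field Ω K₁ K₂ α f₁ d₁) (1 + L₁ + L₂ + ‖α‖₊) a b X₁ Y₁)
    (hfl₂ : IsFlow (field Ω K₁ K₂ α f₂ d₂) (1 + L₁ + L₂ + ‖α‖₊) a b X₂ Y₂) {η : ℝ} (hη0 : 0 < η)
    (hη : ∀ t ∈ Icc a b, ∀ m, ‖d₁ t m - d₂ t m‖ ≤ η) {t : ℝ} (ht : t ∈ Icc a b) (z : Phase D) :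
    ‖Y₁ t z - Y₂ t z‖ ≤ flowConst L₁ L₂ α a b * η := by
  have h1 := norm_sub_le_of_solutions (s := t) (t := a) hfl₁.lip
    (mul_nonneg fieldConst_nonneg hη0.le) (hfl₁.deriv (Y₁ t z)) (hfl₂.deriv (Y₂ t z))
    (fun t ht => by
      rw [norm_field_sub]; exact norm_force_diff_le hs₁ hs₂ h hη0 hη ht _)
    ht ⟨le_rfl, h.lt.le⟩
  rw [hfl₁.init, hfl₂.init, hfl₁.right_inv, hfl₂.right_inv, sub_self, norm_zero, zero_add] at h1
  refine h1.trans (le_of_eq ?_)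
  rw [flowConst]; ring

lemma isDensity_init {f : ℝ → L2 Ω ℝ} {d : ℝ → Agents M D}
    (hs : IsRegState Ω K₁ K₂ α a b fa f d) : IsDensity Ω fa := by
  rw [← hs.init]; exact hs.path.density a

/-- Lipschitz dependence of averages on the state. -/
lemma norm_integral_smul_sub_le {H : Type*} [NormedAddCommGroup H] [NormedSpace ℝ H]
    [SecondCountableTopology H] [MeasurableSpace H] [BorelSpace H]
    (hs₁ : IsRegState Ω K₁ K₂ α a b fa f₁ d₁)
    (hs₂ : IsRegState Ω K₁ K₂ α a b fa f₂ d₂) (h : Setting Ω K₁ K₂ L₁ L₂ a b) {η : ℝ} (hη0 : 0 < η)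
    (hη : ∀ t ∈ Icc a b, ∀ m, ‖d₁ t m - d₂ t m‖ ≤ η) {t : ℝ} (ht : t ∈ Icc a b) {c : Phase D → H}
    {C : ℝ≥0} (hc : LipschitzWith C c) :
    ‖(∫ z in Ω, f₁ t z • c z) - ∫ z in Ω, f₂ t z • c z‖
      ≤ C * (flowConst L₁ L₂ α a b * η) := by
  obtain ⟨X₁, Y₁, hfl₁⟩ := hs₁.exists_flow h
  obtain ⟨X₂, Y₂, hfl₂⟩ := hs₂.exists_flow h
  have hdens := hs₁.isDensity_init
  have r₁ := hs₁.weak.integral_smul_eq hfl₁ (hs₁.lip_force h) h.lt h.meas h.bdd hs₁.path.contf ht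
    (c := c) hc.continuous.measurable.aestronglyMeasurable
  have r₂ := hs₂.weak.integral_smul_eq hfl₂ (hs₂.lip_force h) h.lt h.meas h.bdd hs₂.path.contf ht
    (c := c) hc.continuous.measurable.aestronglyMeasurable
  rw [hs₁.init] at r₁
  rw [hs₂.init] at r₂
  have i1 := IsPath.integrable_smul h.bdd fa (c := fun y => c (X₁ t y))
    (hc.continuous.comp (hfl₁.lipX t).continuous)
  have i2 := IsPath.integrable_smul h.bdd fa (c := fun y => c (X₂ t y))
    (hc.continuous.comp (hfl₂.lipX t).continuous)
  rw [r₁, r₂, ← integral_sub i1 i2]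
  calc _ ≤ ∫ y in Ω, fa y * (C * (flowConst L₁ L₂ α a b * η)) := by
        refine norm_integral_le_of_norm_le ((IsPath.integrable h.bdd fa).mul_const _) ?_
        filter_upwards [hdens.1] with y hy
        rw [← smul_sub, norm_smul, Real.norm_of_nonneg hy]
        refine mul_le_mul_of_nonneg_left ((hc.norm_sub_le _ _).trans ?_) hy
        gcongr
        exact norm_X_sub_le hs₁ hs₂ h hfl₁ hfl₂ hη0 hη ht y
    _ = _ := by rw [integral_mul_const, hdens.2, one_mul]

/-- Continuous dependence of the state on the agents, in `L¹`. -/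
lemma exists_integral_abs_sub_le (h : Setting Ω K₁ K₂ L₁ L₂ a b) (fa : L2 Ω ℝ) (α : ℝ) {ε : ℝ}
    (hε : 0 < ε) : ∃ δ > 0, ∀ (f₁ f₂ : ℝ → L2 Ω ℝ) (d₁ d₂ : ℝ → Agents M D),
      IsRegState Ω K₁ K₂ α a b fa f₁ d₁ → IsRegState Ω K₁ K₂ α a b fa f₂ d₂ →
      (∀ t ∈ Icc a b, ∀ m, ‖d₁ t m - d₂ t m‖ ≤ δ) →
      ∀ t ∈ Icc a b, ∫ z in Ω, |f₁ t z - f₂ t z| ≤ ε := by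
  set u := Ω.indicator (fa : Phase D → ℝ) with hu
  have hui : Integrable u := integrable_indicator_L2 h.meas h.bdd fa
  -- Composition with a flow is not uniformly continuous in `L¹` for rough data. Hence the initial
  -- density is replaced by a continuous, compactly supported `k`. The Jacobian carried by the
  -- transported density cancels in the change of variables, so each replacement costs exactly its
  -- `L¹` error.
  obtain ⟨k, hkc, hk, hkcont, hki⟩ := hui.exists_hasCompactSupport_integral_sub_le
    (ε := ε / 3) (by positivity)
  obtain ⟨R, hR⟩ := hkc.isCompact.isBounded.exists_norm_le
  set V : ℝ := (volume (Metric.closedBall (0 : Phase D) (R + 1))).toReal with hV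
  have hV0 : 0 ≤ V := ENNReal.toReal_nonneg
  obtain ⟨ρ, hρ0, hρ⟩ := Metric.uniformContinuous_iff.1
    (hkc.uniformContinuous_of_continuous hkcont) (ε / 3 / (V + 1)) (by positivity)
  have hC0 : 0 ≤ flowConst L₁ L₂ α a b := flowConst_nonneg h.lt.le
  -- Inverse trajectories are then closer than `ρ`, the modulus of `k`, and at distance at most one.
  -- The latter makes both values of `k` vanish outside the ball of radius `R + 1`.
  set δ : ℝ := min (ρ / 2) 1 / (flowConst L₁ L₂ α a b + 1) with hδ
  have hδ0 : 0 < δ := by positivity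
  have hCδ : flowConst L₁ L₂ α a b * δ ≤ min (ρ / 2) 1 := by
    rw [hδ, ← mul_div_assoc, div_le_iff₀ (by positivity)]
    have : 0 ≤ min (ρ / 2) 1 := by positivity
    nlinarith
  refine ⟨δ, hδ0, fun f₁ f₂ d₁ d₂ hs₁ hs₂ hd t ht => ?_⟩
  obtain ⟨X₁, Y₁, hfl₁⟩ := hs₁.exists_flow h
  obtain ⟨X₂, Y₂, hfl₂⟩ := hs₂.exists_flow h
  have e₁ := hs₁.weak.ae_eq_transported hfl₁ (hs₁.lip_force h) h.lt h.meas h.bdd hs₁.path.contf ht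
  have e₂ := hs₂.weak.ae_eq_transported hfl₂ (hs₂.lip_force h) h.lt h.meas h.bdd hs₂.path.contf ht
  rw [hs₁.init] at e₁
  rw [hs₂.init] at e₂
  set e : ℝ := Real.exp (α * D * (t - a)) with he
  have he0 : 0 < e := Real.exp_pos _
  have hY : ∀ z, ‖Y₁ t z - Y₂ t z‖ ≤ min (ρ / 2) 1 := fun z =>
    (norm_Y_sub_le hs₁ hs₂ h hfl₁ hfl₂ hδ0 hd ht z).trans hCδ
  have hkui : Integrable fun z => ‖u z - k z‖ := (hui.sub hki).norm
  have j1 := hfl₁.integrable_comp_Y (hs₁.lip_force h) ht hkui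
  have j3 := hfl₂.integrable_comp_Y (hs₂.lip_force h) ht hkui
  have hball : Integrable ((Metric.closedBall (0 : Phase D) (R + 1)).indicator
      fun _ => ε / 3 / (V + 1)) :=
    (integrable_indicator_iff Metric.isClosed_closedBall.measurableSet).2
      (integrableOn_const (isCompact_closedBall _ _).measure_lt_top.ne)
  have j2 := hfl₁.integrable_comp_Y (hs₁.lip_force h) ht hball
  have I1 := hfl₁.integral_comp_Y (hs₁.lip_force h) ht hkui
  have I3 := hfl₂.integral_comp_Y (hs₂.lip_force h) ht hkui
  have I2 := hfl₁.integral_comp_Y (hs₁.lip_force h) ht hball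
  rw [integral_indicator Metric.isClosed_closedBall.measurableSet, setIntegral_const, smul_eq_mul,
    smul_eq_mul] at I2
  have hle : ∀ z, |u (Y₁ t z) - u (Y₂ t z)| ≤ ‖u (Y₁ t z) - k (Y₁ t z)‖
      + (Metric.closedBall (0 : Phase D) (R + 1)).indicator (fun _ => ε / 3 / (V + 1)) (Y₁ t z)
      + ‖u (Y₂ t z) - k (Y₂ t z)‖ := by
    intro z
    have h2 : |k (Y₁ t z) - k (Y₂ t z)|
        ≤ (Metric.closedBall (0 : Phase D) (R + 1)).indicator (fun _ => ε / 3 / (V + 1)) (Y₁ t z) := by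
      have hYz := hY z
      by_cases hz : Y₁ t z ∈ Metric.closedBall (0 : Phase D) (R + 1)
      · rw [indicator_of_mem hz, ← Real.dist_eq]
        refine (hρ ?_).le
        rw [dist_eq_norm]
        have := min_le_left (ρ / 2) 1
        linarith
      · have hz' : R + 1 < ‖Y₁ t z‖ := by simpa using hz
        have h3 := norm_sub_norm_le (Y₁ t z) (Y₂ t z)
        have h4 := min_le_right (ρ / 2) 1
        have k1 : k (Y₁ t z) = 0 := by
          by_contra hne
          have := hR _ (subset_tsupport _ hne); linarith
        have k2 : k (Y₂ t z) = 0 := by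
          by_contra hne
          have := hR _ (subset_tsupport _ hne); linarith
        rw [indicator_of_notMem hz, k1, k2]; simp
    have h3 : u (Y₁ t z) - u (Y₂ t z) = (u (Y₁ t z) - k (Y₁ t z)) + (k (Y₁ t z) - k (Y₂ t z))
        - (u (Y₂ t z) - k (Y₂ t z)) := by ring
    rw [h3]
    have h4 := abs_sub (u (Y₁ t z) - k (Y₁ t z) + (k (Y₁ t z) - k (Y₂ t z)))
      (u (Y₂ t z) - k (Y₂ t z))
    have h5 := abs_add_le (u (Y₁ t z) - k (Y₁ t z)) (k (Y₁ t z) - k (Y₂ t z))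
    simp only [Real.norm_eq_abs]
    linarith
  have hi₁ := hfl₁.integrable_comp_Y (hs₁.lip_force h) ht hui
  have hi₂ := hfl₂.integrable_comp_Y (hs₂.lip_force h) ht hui
  calc ∫ z in Ω, |f₁ t z - f₂ t z|
      = ∫ z, |Ω.indicator (f₁ t) z - Ω.indicator (f₂ t) z| := by
        rw [← integral_indicator h.meas]
        congr 1 with z
        by_cases hz : z ∈ Ω <;> simp [hz]
    _ = ∫ z, e * |u (Y₁ t z) - u (Y₂ t z)| := by
        refine integral_congr_ae ?_
        filter_upwards [e₁, e₂] with z h1 h2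
        rw [h1, h2, transported, transported, ← mul_sub, abs_mul, abs_of_pos he0]
    _ ≤ ∫ z, e * (‖u (Y₁ t z) - k (Y₁ t z)‖
      + (Metric.closedBall (0 : Phase D) (R + 1)).indicator (fun _ => ε / 3 / (V + 1)) (Y₁ t z)
      + ‖u (Y₂ t z) - k (Y₂ t z)‖) := by
        refine integral_mono (((hi₁.sub hi₂).abs).const_mul e) (((j1.fun_add j2).fun_add j3).const_mul e)
          fun z => ?_
        exact mul_le_mul_of_nonneg_left (hle z) he0.le
    _ ≤ ε := by
        rw [integral_const_mul, integral_add (j1.fun_add j2) j3, integral_add j1 j2, mul_add, mul_add]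
        simp only [smul_eq_mul] at I1 I3
        rw [I1, I2, I3]
        have hVε : V * (ε / 3 / (V + 1)) ≤ ε / 3 := by
          rw [← mul_div_assoc, div_le_iff₀ (by positivity)]
          nlinarith
        have : (volume : Measure (Phase D)).real (Metric.closedBall (0 : Phase D) (R + 1)) = V := rfl
        rw [this]
        linarith

end IsRegState

end StabilityFlow

/-! ### Partial gradients in position and velocity. -/

section Gradients

variable {D : ℕ}

/-- The `v`-gradient of a function of `(t, (x, v))`. -/
noncomputable def gradV (g : ℝ × Phase D → ℝ) (p : ℝ × Phase D) : Space D :=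
  (InnerProductSpace.toDual ℝ (Space D)).symm ((fderiv ℝ g p).comp
    ((ContinuousLinearMap.inr ℝ ℝ (Phase D)).comp
      (ContinuousLinearMap.inr ℝ (Space D) (Space D))))

/-- The `x`-gradient of a function of `(t, (x, v))`. -/
noncomputable def gradX (g : ℝ × Phase D → ℝ) (p : ℝ × Phase D) : Space D :=
  (InnerProductSpace.toDual ℝ (Space D)).symm ((fderiv ℝ g p).comp
    ((ContinuousLinearMap.inr ℝ ℝ (Phase D)).comp
      (ContinuousLinearMap.inl ℝ (Space D) (Space D))))

lemma inner_gradV (g : ℝ × Phase D → ℝ) (p : ℝ × Phase D) (e : Space D) :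
    ⟪gradV g p, e⟫ = fderiv ℝ g p (0, (0, e)) := by
  rw [gradV, InnerProductSpace.toDual_symm_apply]; rfl

lemma inner_gradX (g : ℝ × Phase D → ℝ) (p : ℝ × Phase D) (e : Space D) :
    ⟪gradX g p, e⟫ = fderiv ℝ g p (0, (e, 0)) := by
  rw [gradX, InnerProductSpace.toDual_symm_apply]; rfl

lemma fderiv_apply_eq (g : ℝ × Phase D → ℝ) (p : ℝ × Phase D) (x v : Space D) :
    fderiv ℝ g p (1, (x, v)) = fderiv ℝ g p (1, 0) + ⟪gradX g p, x⟫ + ⟪gradV g p, v⟫ := by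
  rw [inner_gradX, inner_gradV, ← map_add, ← map_add]
  simp

lemma fderiv_apply_space_eq (g : ℝ × Phase D → ℝ) (p : ℝ × Phase D) (e : Phase D) :
    fderiv ℝ g p (0, e) = ⟪gradX g p, e.1⟫ + ⟪gradV g p, e.2⟫ := by
  rw [inner_gradX, inner_gradV, ← map_add]
  simp

lemma measurable_gradV (g : ℝ × Phase D → ℝ) : Measurable (gradV g) := by
  have h1 : Measurable (fderiv ℝ g) := measurable_fderiv ℝ g
  have h2 : Continuous fun T : ℝ × Phase D →L[ℝ] ℝ =>
      (InnerProductSpace.toDual ℝ (Space D)).symm (T.comp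
        ((ContinuousLinearMap.inr ℝ ℝ (Phase D)).comp
          (ContinuousLinearMap.inr ℝ (Space D) (Space D)))) :=
    (InnerProductSpace.toDual ℝ (Space D)).symm.continuous.comp (by fun_prop)
  exact h2.measurable.comp h1

lemma measurable_gradX (g : ℝ × Phase D → ℝ) : Measurable (gradX g) := by
  have h1 : Measurable (fderiv ℝ g) := measurable_fderiv ℝ g
  have h2 : Continuous fun T : ℝ × Phase D →L[ℝ] ℝ =>
      (InnerProductSpace.toDual ℝ (Space D)).symm (T.comp
        ((ContinuousLinearMap.inr ℝ ℝ (Phase D)).comp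
          (ContinuousLinearMap.inl ℝ (Space D) (Space D)))) :=
    (InnerProductSpace.toDual ℝ (Space D)).symm.continuous.comp (by fun_prop)
  exact h2.measurable.comp h1

/-- No differentiability is required: where it fails, the gradient is zero by convention. This keeps
all later bounds valid at every point. -/
lemma norm_gradV_le_of_lip {g : ℝ × Phase D → ℝ} {t : ℝ} {z : Phase D} {C : ℝ} (hC : 0 ≤ C)
    (h : ∀ᶠ y in 𝓝 z, |g (t, y) - g (t, z)| ≤ C * ‖y - z‖) : ‖gradV g (t, z)‖ ≤ C := by
  by_cases hd : DifferentiableAt ℝ g (t, z)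
  · rw [gradV, LinearIsometryEquiv.norm_map]
    have h1 : HasFDerivAt (fun y => g (t, y))
        ((fderiv ℝ g (t, z)).comp (ContinuousLinearMap.inr ℝ ℝ (Phase D))) z :=
      hd.hasFDerivAt.comp z (hasFDerivAt_prodMk_right t z)
    have h2 := h1.le_of_lip' hC h
    rw [← ContinuousLinearMap.comp_assoc]
    refine (ContinuousLinearMap.opNorm_comp_le _ _).trans ?_
    refine (mul_le_mul h2 (ContinuousLinearMap.norm_inr_le_one ℝ _ _) (norm_nonneg _) hC).trans ?_
    rw [mul_one]
  · rw [gradV, fderiv_zero_of_not_differentiableAt hd]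
    simpa using hC

lemma gradV_sub {g₁ g₂ : ℝ × Phase D → ℝ} {p : ℝ × Phase D} (h₁ : DifferentiableAt ℝ g₁ p)
    (h₂ : DifferentiableAt ℝ g₂ p) : gradV (fun q => g₁ q - g₂ q) p = gradV g₁ p - gradV g₂ p := by
  rw [gradV, gradV, gradV, ← map_sub, fderiv_fun_sub h₁ h₂]
  rfl

lemma gradV_congr {g₁ g₂ : ℝ × Phase D → ℝ} {p : ℝ × Phase D} (h : g₁ =ᶠ[𝓝 p] g₂) :
    gradV g₁ p = gradV g₂ p := by
  rw [gradV, gradV, h.fderiv_eq]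

end Gradients

/-! ### Backward transport with a given source. -/

section Backward

variable {D : ℕ} {F : ℝ → Phase D → Phase D} {L Lk : ℝ≥0} {a b B : ℝ}
  {X Y : ℝ → Phase D → Phase D} {k k' : ℝ → Phase D → ℝ}

/-- A bounded measurable source term, Lipschitz in the phase variable. -/
structure IsSource (k : ℝ → Phase D → ℝ) (B : ℝ) (Lk : ℝ≥0) : Prop where
  meas : Measurable (Function.uncurry k)
  bound : ∀ s z, |k s z| ≤ B
  lip : ∀ s, LipschitzWith Lk (k s)

/-- The solution of the backward transport equation with source `k` that vanishes at time `b`. -/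
noncomputable def backward (a b : ℝ) (X Y : ℝ → Phase D → Phase D) (k : ℝ → Phase D → ℝ)
    (p : ℝ × Phase D) : ℝ :=
  - ∫ s in (max a (min b p.1))..b, k s (X s (Y p.1 p.2))

lemma IsSource.measurable_along (hk : IsSource k B Lk) (hX : Continuous (Function.uncurry X))
    (y : Phase D) : Measurable fun s => k s (X s y) := by
  have h : Continuous fun s : ℝ => (s, X s y) :=
    continuous_id.prodMk (hX.comp (Continuous.prodMk_left y))
  exact hk.meas.comp h.measurable

lemma IsSource.nonneg (hk : IsSource k B Lk) : 0 ≤ B := (abs_nonneg _).trans (hk.bound 0 0)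

lemma intervalIntegrable_of_bounded {h : ℝ → ℝ} (hm : Measurable h) (hb : ∀ s, |h s| ≤ B)
    (c d : ℝ) : IntervalIntegrable h volume c d := by
  rw [intervalIntegrable_iff]
  exact Measure.integrableOn_of_bounded (M := B) measure_Ioc_lt_top.ne hm.aestronglyMeasurable
    (Eventually.of_forall hb)

lemma IsSource.intervalIntegrable (hk : IsSource k B Lk) (hX : Continuous (Function.uncurry X))
    (y : Phase D) (c d : ℝ) : IntervalIntegrable (fun s => k s (X s y)) volume c d :=
  intervalIntegrable_of_bounded (hk.measurable_along hX y) (fun s => hk.bound s _) c d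

lemma backward_end {p : ℝ × Phase D} (hab : a ≤ b) (hp : b ≤ p.1) : backward a b X Y k p = 0 := by
  rw [backward, min_eq_left hp, max_eq_right hab, intervalIntegral.integral_same, neg_zero]

lemma backward_sub (hfl : IsFlow F L a b X Y) (hk : IsSource k B Lk) {B' : ℝ} {Lk' : ℝ≥0}
    (hk' : IsSource k' B' Lk') (p : ℝ × Phase D) :
    backward a b X Y k p - backward a b X Y k' p
      = backward a b X Y (fun s z => k s z - k' s z) p := by
  rw [backward, backward, backward, intervalIntegral.integral_sub
    (hk.intervalIntegrable hfl.continuous_X _ _ _) (hk'.intervalIntegrable hfl.continuous_X _ _ _)]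
  ring

lemma IsSource.sub (hk : IsSource k B Lk) {B' : ℝ} {Lk' : ℝ≥0}
    (hk' : IsSource k' B' Lk') : IsSource (fun s z => k s z - k' s z) (B + B') (Lk + Lk') :=
  ⟨hk.meas.sub hk'.meas, fun s z => (abs_sub _ _).trans (add_le_add (hk.bound s z) (hk'.bound s z)),
    fun s => (hk.lip s).sub (hk'.lip s)⟩

lemma clamp_mem (hab : a ≤ b) (t : ℝ) : max a (min b t) ∈ Icc a b :=
  ⟨le_max_left _ _, max_le hab (min_le_left _ _)⟩

lemma abs_clamp_sub_le (a b s t : ℝ) : |max a (min b s) - max a (min b t)| ≤ |s - t| := by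
  refine (abs_max_sub_max_le_max _ _ _ _).trans (max_le (by simp) ?_)
  exact (abs_min_sub_min_le_max _ _ _ _).trans (max_le (by simp) le_rfl)

/-- Estimate at a fixed time. -/
lemma abs_backward_sub_le (hfl : IsFlow F L a b X Y) (hk : IsSource k B Lk) {ℓ : ℝ → ℝ}
    (hℓ : IntervalIntegrable ℓ volume a b) (hℓ0 : ∀ s, 0 ≤ ℓ s)
    (h : ∀ᵐ s, s ∈ Ioc a b → ∀ y z, |k s y - k s z| ≤ ℓ s * ‖y - z‖) {t : ℝ} (ht : t ∈ Icc a b)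
    (y z : Phase D) :
    |backward a b X Y k (t, y) - backward a b X Y k (t, z)|
      ≤ gronwallConst L (b - a) ^ 2 * (∫ s in t..b, ℓ s) * ‖y - z‖ := by
  have hc : max a (min b t) = t := by rw [min_eq_right ht.2, max_eq_right ht.1]
  have hg := hfl.const_nonneg
  rw [backward, backward, neg_sub_neg, ← intervalIntegral.integral_sub
    (hk.intervalIntegrable hfl.continuous_X _ _ _) (hk.intervalIntegrable hfl.continuous_X _ _ _),
    ← Real.norm_eq_abs]
  simp only [hc]
  have hℓ' : IntervalIntegrable ℓ volume t b := hℓ.mono_set (by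
    rw [uIcc_of_le ht.2, uIcc_of_le hfl.le]; exact Icc_subset_Icc_left ht.1)
  calc _ ≤ ∫ s in t..b, gronwallConst L (b - a) ^ 2 * ‖y - z‖ * ℓ s := by
        refine intervalIntegral.norm_integral_le_of_norm_le ht.2 ?_ (hℓ'.const_mul _)
        filter_upwards [h] with s hs hsm
        refine (hs ⟨ht.1.trans_lt hsm.1, hsm.2⟩ _ _).trans ?_
        rw [mul_comm]
        refine mul_le_mul_of_nonneg_right ?_ (hℓ0 s)
        refine (hfl.dist_X s _ _).trans ?_
        rw [pow_two, mul_assoc]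
        gcongr
        rw [norm_sub_rev y z]
        exact hfl.dist_Y t z y
    _ = _ := by rw [intervalIntegral.integral_const_mul]; ring

/-- Two effects are separated: the change of the lower limit, controlled by the bound on the source,
and the change of characteristic, controlled by its Lipschitz constant. The estimate is local
because the field may be unbounded, so that `Y` is Lipschitz in time only on balls. -/
lemma exists_lipschitz_backward (hfl : IsFlow F L a b X Y) (hk : IsSource k B Lk) (R : ℝ) :
    ∃ C, 0 ≤ C ∧ ∀ s t y z, ‖y‖ ≤ R →
      |backward a b X Y k (s, y) - backward a b X Y k (t, z)| ≤ C * (|s - t| + ‖y - z‖) := by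
  obtain ⟨C, hC0, hC⟩ := hfl.exists_lipschitz_Y R
  have hg := hfl.const_nonneg
  have hba := sub_nonneg.2 hfl.le
  have hB := hk.nonneg
  refine ⟨B + Lk * (gronwallConst L (b - a) * C) * (b - a), by positivity, fun s t y z hy => ?_⟩
  have hi := fun y c d => hk.intervalIntegrable hfl.continuous_X y c d
  simp only [backward]
  have htc := clamp_mem hfl.le t
  have hcs := abs_clamp_sub_le a b s t
  set σ := max a (min b s)
  set τ := max a (min b t)
  have e1 : (-∫ r in σ..b, k r (X r (Y s y))) - (-∫ r in τ..b, k r (X r (Y t z)))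
      = (∫ r in τ..b, (k r (X r (Y t z)) - k r (X r (Y s y)))) - ∫ r in σ..τ, k r (X r (Y s y)) := by
    rw [intervalIntegral.integral_sub (hi _ _ _) (hi _ _ _),
      ← intervalIntegral.integral_add_adjacent_intervals (hi (Y s y) σ τ) (hi (Y s y) τ b)]
    ring
  have e2 : |∫ r in σ..τ, k r (X r (Y s y))| ≤ B * |s - t| := by
    rw [← Real.norm_eq_abs]
    refine (intervalIntegral.norm_integral_le_of_norm_le_const (C := B)
      (fun r _ => hk.bound r (X r (Y s y)))).trans ?_
    rw [abs_sub_comm τ σ]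
    gcongr
  have e3 : |∫ r in τ..b, (k r (X r (Y t z)) - k r (X r (Y s y)))|
      ≤ Lk * (gronwallConst L (b - a) * (C * (|s - t| + ‖y - z‖))) * (b - a) := by
    rw [← Real.norm_eq_abs]
    refine (intervalIntegral.norm_integral_le_of_norm_le_const
      (C := Lk * (gronwallConst L (b - a) * (C * (|s - t| + ‖y - z‖)))) (fun r _ => ?_)).trans ?_
    · refine ((hk.lip r).norm_sub_le _ _).trans ?_
      gcongr
      refine (hfl.dist_X r _ _).trans ?_
      rw [norm_sub_rev]
      gcongr
      exact hC s t y z hy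
    · rw [abs_of_nonneg (sub_nonneg.2 htc.2)]
      gcongr
      exact htc.1
  rw [e1]
  refine (abs_sub _ _).trans ?_
  have h0 : 0 ≤ B * ‖y - z‖ := by positivity
  nlinarith

lemma lipschitzOn_of_lip {g : ℝ × Phase D → ℝ} {R C : ℝ} (hC : 0 ≤ C)
    (h : ∀ s t y z, ‖y‖ ≤ R → |g (s, y) - g (t, z)| ≤ C * (|s - t| + ‖y - z‖)) :
    LipschitzOnWith (2 * C.toNNReal) g (univ ×ˢ Metric.ball 0 R) := by
  refine LipschitzOnWith.of_dist_le_mul ?_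
  rintro ⟨s, y⟩ hy ⟨t, z⟩ -
  have hy' : ‖y‖ ≤ R := (mem_ball_zero_iff.1 hy.2).le
  rw [Real.dist_eq]
  refine (h s t y z hy').trans ?_
  push_cast
  rw [Real.coe_toNNReal _ hC, Prod.dist_eq, dist_eq_norm y z, Real.dist_eq]
  have h1 := le_max_left |s - t| ‖y - z‖
  have h2 := le_max_right |s - t| ‖y - z‖
  nlinarith

/-- Rademacher on an exhaustion by balls, since the Lipschitz bound is only local in `z`. -/
lemma ae_differentiableAt_backward (hfl : IsFlow F L a b X Y) (hk : IsSource k B Lk) :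
    ∀ᵐ p : ℝ × Phase D, DifferentiableAt ℝ (backward a b X Y k) p := by
  have h : ∀ n : ℕ, ∀ᵐ p : ℝ × Phase D, p ∈ (univ : Set ℝ) ×ˢ Metric.ball (0 : Phase D) n →
      DifferentiableAt ℝ (backward a b X Y k) p := by
    intro n
    obtain ⟨C, hC0, hC⟩ := exists_lipschitz_backward hfl hk n
    filter_upwards [(lipschitzOn_of_lip hC0 hC).ae_differentiableWithinAt_of_mem
      (μ := (volume : Measure (ℝ × Phase D)))] with p hp hpm
    exact (hp hpm).differentiableAt ((isOpen_univ.prod Metric.isOpen_ball).mem_nhds hpm)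
  filter_upwards [ae_all_iff.2 h] with p hp
  obtain ⟨n, hn⟩ := exists_nat_gt ‖p.2‖
  exact hp n ⟨mem_univ _, by simpa using hn⟩

end Backward

/-! ### The backward equation almost everywhere. -/

section BackwardEquation

variable {D : ℕ} {S : ℝ → Space D → Space D} {α : ℝ} {L LS Lk : ℝ≥0} {a b B : ℝ}
  {X Y : ℝ → Phase D → Phase D} {k : ℝ → Phase D → ℝ}

/-- The backward transport equation holds almost everywhere. -/
lemma ae_fderiv_backward_eq
    (hfl : IsFlow (fun t (z : Phase D) => (z.2, S t z.1 - α • z.2)) L a b X Y)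
    (hS : ∀ t, LipschitzWith LS (S t)) (hk : IsSource k B Lk) :
    ∀ᵐ t : ℝ, t ∈ Icc a b → ∀ᵐ z : Phase D, fderiv ℝ (backward a b X Y k) (t, z)
      (1, (z.2, S t z.1 - α • z.2)) = k t z := by
  set g := backward a b X Y k with hg
  set F : ℝ → Phase D → Phase D := fun t z => (z.2, S t z.1 - α • z.2) with hF
  -- Stated as an implication, the property is measurable, as Fubini needs, and Rademacher can be
  -- invoked separately at the end.
  set Q : Set (ℝ × Phase D) := {p | DifferentiableAt ℝ g p →
    fderiv ℝ g p (1, F p.1 p.2) = k p.1 p.2} with hQ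
  have hQm : MeasurableSet Q := by
    refine MeasurableSet.imp (measurableSet_of_differentiableAt ℝ g) ?_
    refine measurableSet_eq_fun ?_ hk.meas
    have h1 : Measurable (fderiv ℝ g) := measurable_fderiv ℝ g
    have h2 : Measurable fun p : ℝ × Phase D => ((1 : ℝ), F p.1 p.2) :=
      measurable_const.prodMk hfl.cont.measurable
    have h3 : Continuous fun q : (ℝ × Phase D →L[ℝ] ℝ) × (ℝ × Phase D) => q.1 q.2 := by fun_prop
    exact h3.measurable.comp (h1.prodMk h2)
  -- The source is only measurable in time. On each single trajectory the equation follows from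
  -- Lebesgue differentiation; Fubini over the starting points and the flow then carry it to almost
  -- every `(t,z)`.
  have h1 : ∀ y : Phase D, ∀ᵐ t : ℝ, t ∈ Ioo a b → (t, X t y) ∈ Q := by
    intro y
    have hi := hk.intervalIntegrable hfl.continuous_X y a b
    filter_upwards [hi.ae_hasDerivAt_integral] with t ht htm hd
    have htI : t ∈ Icc a b := Ioo_subset_Icc_self htm
    rw [uIcc_of_le hfl.le] at ht
    have d1 := ht htI b ⟨hfl.le, le_rfl⟩
    have d2 := hfl.hasDerivAt_along (h := g) (z := X t y) htm hd
    simp only [hfl.left_inv] at d2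
    refine d2.unique (d1.congr_of_eventuallyEq ?_)
    filter_upwards [Ioo_mem_nhds htm.1 htm.2] with r hr
    simp only [hg, backward, hfl.left_inv]
    rw [min_eq_right hr.2.le, max_eq_right hr.1.le, intervalIntegral.integral_symm, neg_neg]
  have h2 : ∀ᵐ p : Phase D × ℝ, p.2 ∈ Ioo a b → (p.2, X p.2 p.1) ∈ Q := by
    have hc : Continuous fun p : Phase D × ℝ => (p.2, X p.2 p.1) := by
      have := hfl.continuous_X.comp (continuous_swap (X := Phase D) (Y := ℝ))
      exact continuous_snd.prodMk this
    have hm : MeasurableSet {p : Phase D × ℝ | p.2 ∈ Ioo a b → (p.2, X p.2 p.1) ∈ Q} :=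
      (measurable_snd measurableSet_Ioo).imp (hc.measurable hQm)
    exact (Measure.ae_prod_iff_ae_ae (μ := (volume : Measure (Phase D)))
      (ν := (volume : Measure ℝ)) hm).2 (Eventually.of_forall h1)
  have h3 : ∀ᵐ t : ℝ, ∀ᵐ y : Phase D, t ∈ Ioo a b → (t, X t y) ∈ Q := by
    have : ∀ᵐ p : ℝ × Phase D, p.1 ∈ Ioo a b → (p.1, X p.1 p.2) ∈ Q := by
      have hqm := (Measure.measurePreserving_swap (μ := (volume : Measure ℝ))
        (ν := (volume : Measure (Phase D)))).quasiMeasurePreserving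
      exact hqm.ae h2
    exact Measure.ae_ae_of_ae_prod this
  have h4 : ∀ᵐ t : ℝ, ∀ᵐ z : Phase D, DifferentiableAt ℝ g (t, z) :=
    Measure.ae_ae_of_ae_prod (ae_differentiableAt_backward hfl hk)
  have h5 : ∀ᵐ t : ℝ, t ≠ a := by simp [ae_iff]
  have h6 : ∀ᵐ t : ℝ, t ≠ b := by simp [ae_iff]
  filter_upwards [h3, h4, h5, h6] with t ht3 ht4 hta htb ht
  have hto : t ∈ Ioo a b := ⟨lt_of_le_of_ne ht.1 hta.symm, lt_of_le_of_ne ht.2 htb⟩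
  have h7 : ∀ᵐ z : Phase D, (t, z) ∈ Q :=
    hfl.ae_of_ae_comp_X hS ht (p := fun z => (t, z) ∈ Q)
      (ht3.mono fun y hy => hy hto)
  filter_upwards [h7, ht4] with z hz hd
  exact hz hd

end BackwardEquation

/-! ### Bounded representatives of essentially bounded functions. -/

section LInfty

variable {Z E : Type*} [MeasurableSpace Z] [NormedAddCommGroup E] {μ : Measure Z}

lemma ae_norm_le_norm_Linfty (H : Lp E ∞ μ) : ∀ᵐ p ∂μ, ‖H p‖ ≤ ‖H‖ := by
  filter_upwards [ae_le_eLpNormEssSup (f := H) (μ := μ)] with p hp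
  rw [Lp.norm_def, eLpNorm_exponent_top, ← toReal_enorm]
  refine ENNReal.toReal_mono ?_ hp
  rw [← eLpNorm_exponent_top]
  exact Lp.eLpNorm_ne_top H

/-- An essentially bounded function has an everywhere bounded representative. -/
lemma exists_bounded_representative [MeasurableSpace E] [BorelSpace E] (H : Lp E ∞ μ) :
    ∃ G : Z → E, Measurable G ∧ (∀ p, ‖G p‖ ≤ ‖H‖) ∧ G =ᵐ[μ] H := by
  classical
  have hm : Measurable H := (Lp.stronglyMeasurable H).measurable
  refine ⟨fun p => if ‖H p‖ ≤ ‖H‖ then H p else 0,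
    Measurable.ite (measurableSet_le hm.norm measurable_const) hm measurable_const, fun p => ?_, ?_⟩
  · by_cases h : ‖H p‖ ≤ ‖H‖
    · simp only [if_pos h]; exact h
    · simp only [if_neg h, norm_zero]; exact norm_nonneg _
  · filter_upwards [ae_norm_le_norm_Linfty H] with p hp
    simp only [if_pos hp]

end LInfty

/-! ### The nonlocal source of the adjoint equation. -/

section AdjointSource

variable {D : ℕ} {Ω : Set (Phase D)} {K : Space D → Space D} {ρ : ℝ → Phase D → ℝ}
  {J : ℝ → Space D → ℝ} {L₁ LJ : ℝ≥0} {B₁ BJ : ℝ}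

/-- The source term of the adjoint equation. -/
noncomputable def adjointSource (Ω : Set (Phase D)) (K : Space D → Space D) (ρ : ℝ → Phase D → ℝ)
    (J : ℝ → Space D → ℝ) (G : ℝ × Phase D → Space D) (s : ℝ) (z : Phase D) : ℝ :=
  - (∫ y in Ω, ρ s y * ⟪K (z.1 - y.1), G (s, y)⟫) + J s z.1

/-- Data of the linear adjoint equation. -/
structure AdjointData (Ω : Set (Phase D)) (K : Space D → Space D) (ρ : ℝ → Phase D → ℝ)
    (J : ℝ → Space D → ℝ) (L₁ LJ : ℝ≥0) (B₁ BJ : ℝ) : Prop where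
  bdd : Bornology.IsBounded Ω
  measΩ : MeasurableSet Ω
  lipK : LipschitzWith L₁ K
  boundK : ∀ x, ‖K x‖ ≤ B₁
  measρ : Measurable (Function.uncurry ρ)
  intρ : ∀ t, Integrable (ρ t) (volume.restrict Ω)
  massρ : ∀ t, ∫ y in Ω, |ρ t y| = 1
  measJ : Measurable (Function.uncurry J)
  boundJ : ∀ t x, |J t x| ≤ BJ
  lipJ : ∀ t, LipschitzWith LJ (J t)

namespace AdjointData

variable {G G' : ℝ × Phase D → Space D} {N : ℝ}

lemma measurable_integrand (h : AdjointData Ω K ρ J L₁ LJ B₁ BJ) (hG : Measurable G) : Measurable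
    fun q : (ℝ × Phase D) × Phase D => ρ q.1.1 q.2 * ⟪K (q.1.2.1 - q.2.1), G (q.1.1, q.2)⟫ := by
  have h1 : Measurable fun q : (ℝ × Phase D) × Phase D => ρ q.1.1 q.2 :=
    h.measρ.comp (f := fun q : (ℝ × Phase D) × Phase D => (q.1.1, q.2)) (by fun_prop)
  have h2 : Measurable fun q : (ℝ × Phase D) × Phase D => K (q.1.2.1 - q.2.1) :=
    h.lipK.continuous.measurable.comp (by fun_prop)
  have h3 : Measurable fun q : (ℝ × Phase D) × Phase D => G (q.1.1, q.2) :=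
    hG.comp (by fun_prop)
  exact h1.mul (h2.inner h3)

lemma integrable_integrand (h : AdjointData Ω K ρ J L₁ LJ B₁ BJ) (hG : Measurable G) (hN : ∀ p, ‖G p‖ ≤ N) (s : ℝ) (z : Phase D) :
    Integrable (fun y => ρ s y * ⟪K (z.1 - y.1), G (s, y)⟫) (volume.restrict Ω) := by
  have hm : Measurable fun y => ρ s y * ⟪K (z.1 - y.1), G (s, y)⟫ :=
    (h.measurable_integrand hG).comp (f := fun y => ((s, z), y)) (by fun_prop)
  refine Integrable.mono' ((h.intρ s).norm.mul_const (B₁ * N)) hm.aestronglyMeasurable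
    (Eventually.of_forall fun y => ?_)
  rw [norm_mul]
  refine mul_le_mul_of_nonneg_left ((norm_inner_le_norm _ _).trans ?_) (norm_nonneg _)
  exact mul_le_mul (h.boundK _) (hN _) (norm_nonneg _) ((norm_nonneg _).trans (h.boundK 0))

lemma abs_integral_le (h : AdjointData Ω K ρ J L₁ LJ B₁ BJ) {c : Phase D → ℝ} {C : ℝ} {s : ℝ}
    (hc : ∀ᵐ y ∂(volume.restrict Ω), |c y| ≤ C) : |∫ y in Ω, ρ s y * c y| ≤ C := by
  rw [← Real.norm_eq_abs]
  calc _ ≤ ∫ y in Ω, |ρ s y| * C := by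
        refine norm_integral_le_of_norm_le ((h.intρ s).norm.mul_const C) ?_
        filter_upwards [hc] with y hy
        rw [norm_mul, Real.norm_eq_abs, Real.norm_eq_abs]
        gcongr
    _ = C := by rw [integral_mul_const, h.massρ, one_mul]

/-- The variable `z` enters only through `K` and `J`. The source is therefore Lipschitz in `z`
whatever the regularity of `G`, and only a bound on `G` is used; this makes the fixed point problem
well posed in `L^∞`. -/
lemma isSource (h : AdjointData Ω K ρ J L₁ LJ B₁ BJ) (hG : Measurable G) (hN : ∀ p, ‖G p‖ ≤ N) :
    IsSource (adjointSource Ω K ρ J G) (B₁ * N + BJ) (L₁ * N.toNNReal + LJ) := by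
  have hN0 : 0 ≤ N := (norm_nonneg _).trans (hN 0)
  have hB0 : 0 ≤ B₁ := (norm_nonneg _).trans (h.boundK 0)
  refine ⟨?_, fun s z => ?_, fun s => ?_⟩
  · have h1 := (h.measurable_integrand hG).stronglyMeasurable.integral_prod_right'
      (ν := volume.restrict Ω)
    have h2 : Measurable fun p : ℝ × Phase D => J p.1 p.2.1 :=
      h.measJ.comp (f := fun p : ℝ × Phase D => (p.1, p.2.1)) (by fun_prop)
    exact h1.measurable.neg.add h2
  · refine (abs_add_le _ _).trans (add_le_add ?_ (h.boundJ _ _))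
    rw [abs_neg]
    refine h.abs_integral_le (Eventually.of_forall fun y => (abs_real_inner_le_norm _ _).trans ?_)
    exact mul_le_mul (h.boundK _) (hN _) (norm_nonneg _) hB0
  · refine LipschitzWith.of_dist_le_mul fun y z => ?_
    rw [Real.dist_eq, dist_eq_norm]
    push_cast
    rw [Real.coe_toNNReal _ hN0, adjointSource, adjointSource]
    have hx : ‖y.1 - z.1‖ ≤ ‖y - z‖ := norm_fst_le (y - z)
    have e : -(∫ w in Ω, ρ s w * ⟪K (y.1 - w.1), G (s, w)⟫) + J s y.1
        - (-(∫ w in Ω, ρ s w * ⟪K (z.1 - w.1), G (s, w)⟫) + J s z.1)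
        = -(∫ w in Ω, ρ s w * ⟪K (y.1 - w.1) - K (z.1 - w.1), G (s, w)⟫)
          + (J s y.1 - J s z.1) := by
      simp only [inner_sub_left, mul_sub]
      rw [integral_sub (h.integrable_integrand hG hN s y) (h.integrable_integrand hG hN s z)]
      ring
    rw [e]
    refine (abs_add_le _ _).trans ?_
    rw [abs_neg, add_mul]
    refine add_le_add ?_ ?_
    · refine h.abs_integral_le (Eventually.of_forall fun w =>
        (abs_real_inner_le_norm _ _).trans ?_)
      have h1 := h.lipK.norm_sub_le (y.1 - w.1) (z.1 - w.1)
      rw [sub_sub_sub_cancel_right] at h1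
      calc ‖K (y.1 - w.1) - K (z.1 - w.1)‖ * ‖G (s, w)‖ ≤ (L₁ * ‖y - z‖) * N := by
            gcongr
            · exact h1.trans (by gcongr)
            · exact hN _
        _ = _ := by ring
    · have h1 := (h.lipJ s).norm_sub_le y.1 z.1
      rw [Real.norm_eq_abs] at h1
      exact h1.trans (by gcongr)

/-- The cost term cancels in the difference, and a second difference in `z` falls on the kernel.
Thus the Lipschitz constant of the difference of sources is proportional to the distance between the
two fields at time `s`; this is the source of the contraction. -/
lemma abs_adjointSource_sub_le (h : AdjointData Ω K ρ J L₁ LJ B₁ BJ) {N' : ℝ} (hG : Measurable G) (hN : ∀ p, ‖G p‖ ≤ N)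
    (hG' : Measurable G') (hN' : ∀ p, ‖G' p‖ ≤ N') {s ν : ℝ}
    (hν : ∀ᵐ w ∂(volume.restrict Ω), ‖G (s, w) - G' (s, w)‖ ≤ ν) (y z : Phase D) :
    |(adjointSource Ω K ρ J G s y - adjointSource Ω K ρ J G' s y)
      - (adjointSource Ω K ρ J G s z - adjointSource Ω K ρ J G' s z)| ≤ L₁ * ν * ‖y - z‖ := by
  have hx : ‖y.1 - z.1‖ ≤ ‖y - z‖ := norm_fst_le (y - z)
  have e : (adjointSource Ω K ρ J G s y - adjointSource Ω K ρ J G' s y)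
      - (adjointSource Ω K ρ J G s z - adjointSource Ω K ρ J G' s z)
      = -(∫ w in Ω, ρ s w * ⟪K (y.1 - w.1) - K (z.1 - w.1), G (s, w) - G' (s, w)⟫) := by
    simp only [inner_sub_left, inner_sub_right, mul_sub, adjointSource]
    have i1 := h.integrable_integrand hG hN s y
    have i2 := h.integrable_integrand hG hN s z
    have i3 := h.integrable_integrand hG' hN' s y
    have i4 := h.integrable_integrand hG' hN' s z
    have e1 := integral_sub (i1.sub i2) (i3.sub i4)
    simp only [Pi.sub_apply] at e1
    rw [e1, integral_sub i1 i2, integral_sub i3 i4]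
    ring
  rw [e, abs_neg]
  refine h.abs_integral_le ?_
  filter_upwards [hν] with w hw
  refine (abs_real_inner_le_norm _ _).trans ?_
  have h1 := h.lipK.norm_sub_le (y.1 - w.1) (z.1 - w.1)
  rw [sub_sub_sub_cancel_right] at h1
  calc ‖K (y.1 - w.1) - K (z.1 - w.1)‖ * ‖G (s, w) - G' (s, w)‖ ≤ (L₁ * ‖y - z‖) * ν := by
        gcongr
        exact h1.trans (by gcongr)
    _ = _ := by ring

end AdjointData

end AdjointSource

/-! ### The fixed point for the velocity gradient. -/

section FixedPoint

variable {D : ℕ} {Ω : Set (Phase D)} {K : Space D → Space D} {ρ : ℝ → Phase D → ℝ}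
  {J : ℝ → Space D → ℝ} {L L₁ LJ Lk Lk' : ℝ≥0} {B B' B₁ BJ a b : ℝ} {F : ℝ → Phase D → Phase D}
  {X Y : ℝ → Phase D → Phase D} {k k' : ℝ → Phase D → ℝ}

lemma ae_ae_of_ae_restrict_prod {p : ℝ × Phase D → Prop} {A : Set ℝ}
    (h : ∀ᵐ q ∂((volume : Measure (ℝ × Phase D)).restrict (A ×ˢ Ω)), p q) :
    ∀ᵐ s ∂(volume.restrict A), ∀ᵐ y ∂((volume : Measure (Phase D)).restrict Ω), p (s, y) := by
  have e : (volume : Measure (ℝ × Phase D)).restrict (A ×ˢ Ω)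
      = (volume.restrict A).prod (volume.restrict Ω) := by
    rw [Measure.prod_restrict]; rfl
  rw [e] at h
  exact Measure.ae_ae_of_ae_prod h

lemma exists_bound_gradV_backward (hfl : IsFlow F L a b X Y) (hk : IsSource k B Lk)
    (hΩ : Bornology.IsBounded Ω) :
    ∃ C, 0 ≤ C ∧ ∀ t, ∀ z ∈ Ω, ‖gradV (backward a b X Y k) (t, z)‖ ≤ C := by
  obtain ⟨R, hR⟩ := hΩ.exists_norm_le
  obtain ⟨C, hC0, hC⟩ := exists_lipschitz_backward hfl hk (R + 1)
  refine ⟨C, hC0, fun t z hz => norm_gradV_le_of_lip hC0 ?_⟩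
  refine Eventually.of_forall fun y => ?_
  have := hC t t z y ((hR z hz).trans (by linarith))
  rwa [sub_self, abs_zero, zero_add, abs_sub_comm, norm_sub_rev] at this

/-- By linearity, the difference is the backward solution for the difference of sources. Its
gradient splits where both solutions are differentiable, that is, almost everywhere. -/
lemma norm_gradV_backward_sub_le (hfl : IsFlow F L a b X Y) (hk : IsSource k B Lk)
    (hk' : IsSource k' B' Lk') {ℓ : ℝ → ℝ} (hℓ : IntervalIntegrable ℓ volume a b)
    (hℓ0 : ∀ s, 0 ≤ ℓ s)
    (h : ∀ᵐ s, s ∈ Ioc a b → ∀ y z, |(k s y - k' s y) - (k s z - k' s z)| ≤ ℓ s * ‖y - z‖) :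
    ∀ᵐ p : ℝ × Phase D, p.1 ∈ Icc a b →
      ‖gradV (backward a b X Y k) p - gradV (backward a b X Y k') p‖
        ≤ gronwallConst L (b - a) ^ 2 * ∫ s in p.1..b, ℓ s := by
  filter_upwards [ae_differentiableAt_backward hfl hk, ae_differentiableAt_backward hfl hk']
    with p hp hp' hpm
  rw [← gradV_sub hp hp']
  have e : (fun q => backward a b X Y k q - backward a b X Y k' q)
      = backward a b X Y (fun s z => k s z - k' s z) := funext fun q => backward_sub hfl hk hk' q
  rw [e]
  have hi : 0 ≤ ∫ s in p.1..b, ℓ s := intervalIntegral.integral_nonneg hpm.2 fun s _ => hℓ0 s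
  refine norm_gradV_le_of_lip (t := p.1) (z := p.2) (by positivity) (Eventually.of_forall fun y => ?_)
  exact abs_backward_sub_le hfl (hk.sub hk') hℓ hℓ0 h hpm y p.2

lemma integral_exp_le {lam t b : ℝ} (hlam : 0 < lam) :
    ∫ s in t..b, Real.exp (lam * (b - s)) ≤ Real.exp (lam * (b - t)) / lam := by
  have hd : ∀ s ∈ uIcc t b, HasDerivAt (fun s => - (Real.exp (lam * (b - s)) / lam))
      (Real.exp (lam * (b - s))) s := by
    intro s _
    have h1 := ((((hasDerivAt_id s).const_sub b).const_mul lam).exp.div_const lam).neg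
    refine h1.congr_deriv ?_
    simp only [id]
    field_simp
  rw [intervalIntegral.integral_eq_sub_of_hasDerivAt hd
    ((by fun_prop : Continuous fun s => Real.exp (lam * (b - s))).intervalIntegrable _ _)]
  have : 0 < Real.exp (lam * (b - b)) / lam := by positivity
  linarith

/-- The fixed point problem for the `v`-gradient of the adjoint variable. -/
lemma AdjointData.exists_fixedPoint (h : AdjointData Ω K ρ J L₁ LJ B₁ BJ)
    (hfl : IsFlow F L a b X Y) :
    ∃ (G : ℝ × Phase D → Space D) (N : ℝ), Measurable G ∧ (∀ p, ‖G p‖ ≤ N) ∧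
      ∀ᵐ p ∂((volume : Measure (ℝ × Phase D)).restrict (Icc a b ×ˢ Ω)),
        G p = gradV (backward a b X Y (adjointSource Ω K ρ J G)) p := by
  set μ := (volume : Measure (ℝ × Phase D)).restrict (Icc a b ×ˢ Ω) with hμ
  have hμmem : ∀ᵐ p ∂μ, p ∈ Icc a b ×ˢ Ω := ae_restrict_mem (measurableSet_Icc.prod h.measΩ)
  have hfin : IsFiniteMeasure μ := ⟨by
    rw [hμ, Measure.restrict_apply_univ]
    exact ((Metric.isBounded_Icc a b).prod h.bdd).measure_lt_top⟩
  set γ := gronwallConst L (b - a) with hγ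
  -- Integrating the weight from `t` to `b` gains a factor `1 / lam`, so this choice gives
  -- contraction constant one half, with no smallness condition on `b - a`.
  set lam : ℝ := 2 * (γ ^ 2 * L₁) + 1 with hlam
  have hlam0 : 0 < lam := by positivity
  -- The source integrates `G` over single time slices and must be bounded at every point, so
  -- measurable, everywhere bounded representatives are fixed in advance.
  choose rep hrepm hrepb hrep using
    fun H : Lp (Space D) ∞ μ => exists_bounded_representative H
  -- The unknown `H` is the weighted gradient and `G H` undoes the weight; clamping the time keeps
  -- the factor bounded outside `[a,b]`.
  let G : Lp (Space D) ∞ μ → ℝ × Phase D → Space D := fun H p =>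
    Real.exp (lam * (b - max a (min b p.1))) • rep H p
  have hGm : ∀ H, Measurable (G H) := fun H => by
    have : Measurable fun p : ℝ × Phase D => Real.exp (lam * (b - max a (min b p.1))) := by fun_prop
    exact this.smul (hrepm H)
  have hGb : ∀ H p, ‖G H p‖ ≤ Real.exp (lam * (b - a)) * ‖H‖ := fun H p => by
    simp only [G]
    rw [norm_smul, Real.norm_of_nonneg (Real.exp_pos _).le]
    have := le_max_left a (min b p.1)
    gcongr
    exact hrepb H p
  have hk : ∀ H, IsSource (adjointSource Ω K ρ J (G H)) _ _ := fun H => h.isSource (hGm H) (hGb H)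
  let U : Lp (Space D) ∞ μ → ℝ × Phase D → Space D := fun H =>
    gradV (backward a b X Y (adjointSource Ω K ρ J (G H)))
  have hw : Measurable fun p : ℝ × Phase D => Real.exp (-(lam * (b - p.1))) := by fun_prop
  have hmem : ∀ H, MemLp (fun p : ℝ × Phase D => Real.exp (-(lam * (b - p.1))) • U H p) ∞ μ := by
    intro H
    obtain ⟨C, hC0, hC⟩ := exists_bound_gradV_backward hfl (hk H) h.bdd
    refine memLp_top_of_bound (hw.smul (measurable_gradV _)).aestronglyMeasurable C ?_
    filter_upwards [hμmem] with p hp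
    rw [norm_smul, Real.norm_of_nonneg (Real.exp_pos _).le]
    have h1 : Real.exp (-(lam * (b - p.1))) ≤ 1 := by
      rw [Real.exp_le_one_iff, neg_nonpos]
      exact mul_nonneg hlam0.le (sub_nonneg.2 hp.1.2)
    exact (mul_le_mul h1 (hC p.1 p.2 hp.2) (norm_nonneg _) zero_le_one).trans (one_mul C).le
  let T : Lp (Space D) ∞ μ → Lp (Space D) ∞ μ := fun H => (hmem H).toLp _
  have hT : ContractingWith (1 / 2 : ℝ≥0) T := by
    refine ⟨by norm_num, LipschitzWith.of_dist_le_mul fun H H' => ?_⟩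
    rw [dist_eq_norm, dist_eq_norm, ← MemLp.toLp_sub]
    have h1 : ∀ᵐ p ∂μ, ‖rep H p - rep H' p‖ ≤ ‖H - H'‖ := by
      filter_upwards [hrep H, hrep H', ae_norm_le_norm_Linfty (H - H'), Lp.coeFn_sub H H']
        with p e1 e2 e3 e4
      rw [e1, e2]
      rwa [e4, Pi.sub_apply] at e3
    have h2 : ∀ᵐ s ∂(volume.restrict (Icc a b)), ∀ᵐ y ∂(volume.restrict Ω),
        ‖rep H (s, y) - rep H' (s, y)‖ ≤ ‖H - H'‖ := ae_ae_of_ae_restrict_prod h1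
    rw [ae_restrict_iff' measurableSet_Icc] at h2
    set ℓ : ℝ → ℝ := fun s => L₁ * ‖H - H'‖ * Real.exp (lam * (b - s)) with hℓ
    have hℓc : Continuous ℓ := by fun_prop
    have h3 := norm_gradV_backward_sub_le hfl (hk H) (hk H') (ℓ := ℓ)
      (hℓc.intervalIntegrable _ _) (fun s => by positivity) (by
        filter_upwards [h2] with s hs hsm y z
        have hsI := Ioc_subset_Icc_self hsm
        have := h.abs_adjointSource_sub_le (hGm H) (hGb H) (hGm H') (hGb H') (s := s)
          (ν := Real.exp (lam * (b - s)) * ‖H - H'‖) (by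
            filter_upwards [hs hsI] with w hw
            simp only [G]
            rw [← smul_sub, norm_smul, Real.norm_of_nonneg (Real.exp_pos _).le,
              min_eq_right hsI.2, max_eq_right hsI.1]
            gcongr) y z
        refine this.trans (le_of_eq ?_)
        rw [hℓ]; ring)
    have h4 : ∀ᵐ p ∂μ, ‖((hmem H).sub (hmem H')).toLp _ p‖ ≤ 1 / 2 * ‖H - H'‖ := by
      filter_upwards [((hmem H).sub (hmem H')).coeFn_toLp, ae_restrict_of_ae h3, hμmem]
        with p e1 e2 hp
      rw [e1, Pi.sub_apply, ← smul_sub, norm_smul, Real.norm_of_nonneg (Real.exp_pos _).le]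
      have e3 := e2 hp.1
      have e4 := integral_exp_le (t := p.1) (b := b) hlam0
      have e5 : ∫ s in p.1..b, ℓ s = L₁ * ‖H - H'‖ * ∫ s in p.1..b, Real.exp (lam * (b - s)) := by
        rw [hℓ, intervalIntegral.integral_const_mul]
      rw [e5] at e3
      set e := Real.exp (lam * (b - p.1)) with he
      have he0 : 0 < e := Real.exp_pos _
      have e6 : ‖U H p - U H' p‖ ≤ γ ^ 2 * (L₁ * ‖H - H'‖ * (e / lam)) := by
        refine e3.trans ?_
        gcongr
      rw [Real.exp_neg, inv_mul_le_iff₀ he0]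
      refine e6.trans ?_
      have e7 : γ ^ 2 * L₁ / lam ≤ 1 / 2 := by
        rw [div_le_iff₀ hlam0, hlam]; linarith
      calc γ ^ 2 * (L₁ * ‖H - H'‖ * (e / lam)) = (γ ^ 2 * L₁ / lam) * (e * ‖H - H'‖) := by ring
        _ ≤ 1 / 2 * (e * ‖H - H'‖) := by gcongr
        _ = _ := by ring
    have h5 := Lp.norm_le_of_ae_bound (by positivity) h4
    simpa using h5
  have hne : Nonempty (Lp (Space D) ∞ μ) := ⟨0⟩
  set H := hT.fixedPoint with hH
  have hfix : T H = H := hT.fixedPoint_isFixedPt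
  refine ⟨G H, _, hGm H, hGb H, ?_⟩
  have e0 : H =ᵐ[μ] fun p : ℝ × Phase D => Real.exp (-(lam * (b - p.1))) • U H p := by
    conv_lhs => rw [← hfix]
    exact (hmem H).coeFn_toLp
  filter_upwards [e0, hrep H, hμmem] with p e1 e2 hp
  simp only [G]
  rw [e2, e1, smul_smul, min_eq_right hp.1.2, max_eq_right hp.1.1, ← Real.exp_add, add_neg_cancel,
    Real.exp_zero, one_smul]

end FixedPoint

/-! ### Existence of a Lipschitz adjoint function. -/

section Existence

variable {D : ℕ} {Ω : Set (Phase D)} {K : Space D → Space D} {ρ : ℝ → Phase D → ℝ}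
  {J : ℝ → Space D → ℝ} {L L₁ LJ LS : ℝ≥0} {B₁ BJ a b α : ℝ} {S : ℝ → Space D → Space D}
  {X Y : ℝ → Phase D → Phase D}

/-- Existence of a Lipschitz solution of the adjoint equation. -/
lemma AdjointData.exists_solution (h : AdjointData Ω K ρ J L₁ LJ B₁ BJ)
    (hfl : IsFlow (fun t (z : Phase D) => (z.2, S t z.1 - α • z.2)) L a b X Y)
    (hS : ∀ t, LipschitzWith LS (S t)) :
    ∃ (g : ℝ × Phase D → ℝ) (C : ℝ≥0), LipschitzWith C g ∧ (∀ z ∈ Ω, g (b, z) = 0) ∧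
      ∀ᵐ t : ℝ, t ∈ Icc a b → ∀ᵐ z ∂(volume.restrict Ω),
        fderiv ℝ g (t, z) (1, (z.2, S t z.1 - α • z.2))
          = -(∫ y in Ω, ρ t y * ⟪K (z.1 - y.1), gradV g (t, y)⟫) + J t z.1 := by
  obtain ⟨G, N, hGm, hGN, hG⟩ := h.exists_fixedPoint hfl
  set k := adjointSource Ω K ρ J G with hk
  have hks : IsSource k _ _ := h.isSource hGm hGN
  obtain ⟨R, hR⟩ := h.bdd.exists_norm_le
  obtain ⟨C, hC0, hC⟩ := exists_lipschitz_backward hfl hks (R + 1)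
  -- The margin `R + 1` makes the extension agree with the backward solution in a neighbourhood of
  -- each point over `Ω`, so that the derivatives agree as well.
  obtain ⟨g, hg, hgeq⟩ := (lipschitzOn_of_lip hC0 hC).extend_real
  have hmem : ∀ t, ∀ z ∈ Ω, (t, z) ∈ (univ : Set ℝ) ×ˢ Metric.ball (0 : Phase D) (R + 1) :=
    fun t z hz => ⟨mem_univ _, by
      rw [mem_ball_zero_iff]
      have := hR z hz
      linarith⟩
  have hev : ∀ t, ∀ z ∈ Ω, backward a b X Y k =ᶠ[𝓝 (t, z)] g := fun t z hz => by
    filter_upwards [(isOpen_univ.prod Metric.isOpen_ball).mem_nhds (hmem t z hz)] with p hp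
    exact hgeq hp
  have h1 : ∀ᵐ t ∂(volume.restrict (Icc a b)), ∀ᵐ y ∂(volume.restrict Ω),
      G (t, y) = gradV (backward a b X Y k) (t, y) := ae_ae_of_ae_restrict_prod hG
  rw [ae_restrict_iff' measurableSet_Icc] at h1
  refine ⟨g, _, hg, fun z hz => ?_, ?_⟩
  · rw [← hgeq (hmem b z hz)]; exact backward_end hfl.le le_rfl
  · filter_upwards [ae_fderiv_backward_eq hfl hS hks, h1] with t h2 h3 ht
    filter_upwards [ae_restrict_of_ae (h2 ht), ae_restrict_mem h.measΩ] with z hz hzm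
    rw [← (hev t z hzm).fderiv_eq, hz, hk, adjointSource]
    congr 2
    refine integral_congr_ae ?_
    filter_upwards [h3 ht, ae_restrict_mem h.measΩ] with y hy hym
    rw [hy, gradV_congr (hev t y hym)]

end Existence

/-! ### Time slices as measurable curves in `L²(Ω)`. -/

section Slices

variable {D : ℕ} {Ω : Set (Phase D)} {H : Type*} [NormedAddCommGroup H] [InnerProductSpace ℝ H]
  [SecondCountableTopology H] [MeasurableSpace H] [BorelSpace H] {Φ : ℝ × Phase D → H} {N : ℝ}

/-- A map into a separable normed space is measurable if the distances to all points are. -/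
lemma measurable_of_measurable_norm_sub {T V : Type*} [MeasurableSpace T] [NormedAddCommGroup V]
    [SecondCountableTopology V] [MeasurableSpace V] [BorelSpace V] {u : T → V}
    (h : ∀ c, Measurable fun t => ‖u t - c‖) : Measurable u := by
  refine measurable_of_isOpen fun U hU => ?_
  choose! r hr0 hr using fun (x : V) (hx : x ∈ U) => Metric.isOpen_iff.1 hU x hx
  obtain ⟨T', hT'U, hT'c, hT'⟩ := TopologicalSpace.isOpen_biUnion_countable U
    (fun x => Metric.ball x (r x)) fun _ _ => Metric.isOpen_ball
  have e : U = ⋃ x ∈ T', Metric.ball x (r x) := by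
    rw [hT']
    refine Subset.antisymm (fun x hx => mem_biUnion hx (Metric.mem_ball_self (hr0 x hx)))
      (iUnion₂_subset hr)
  rw [e, preimage_iUnion₂]
  refine MeasurableSet.biUnion hT'c fun c _ => ?_
  have : u ⁻¹' Metric.ball c (r c) = {t | ‖u t - c‖ < r c} := by
    ext t; simp [dist_eq_norm]
  rw [this]
  exact measurableSet_lt (h c) measurable_const

/-- The slice of `Φ` at time `t` as an element of `L²(Ω)`. -/
noncomputable def slice (Ω : Set (Phase D)) (Φ : ℝ × Phase D → H) (t : ℝ) : L2 Ω H := by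
  classical
  exact if h : MemLp (fun z => Φ (t, z)) 2 (volume.restrict Ω) then h.toLp _ else 0

lemma coeFn_slice {t : ℝ} (h : MemLp (fun z => Φ (t, z)) 2 (volume.restrict Ω)) :
    slice Ω Φ t =ᵐ[volume.restrict Ω] fun z => Φ (t, z) := by
  rw [slice, dif_pos h]; exact h.coeFn_toLp

lemma memLp_slice (hbd : Bornology.IsBounded Ω) (hΩ : MeasurableSet Ω) (hm : Measurable Φ)
    {t : ℝ} (hN : ∀ z ∈ Ω, ‖Φ (t, z)‖ ≤ N) :
    MemLp (fun z => Φ (t, z)) 2 (volume.restrict Ω) := by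
  have := isFiniteMeasure_restrict hbd
  refine MemLp.of_bound (hm.comp measurable_prodMk_left).aestronglyMeasurable N ?_
  filter_upwards [ae_restrict_mem hΩ] with z hz using hN z hz

/-- `L²(Ω)` is separable, so it is enough that the distance to each fixed element is measurable in
time; its square is an integral over slices, to which Fubini applies. -/
lemma measurable_slice [MeasurableSpace (L2 Ω H)] [BorelSpace (L2 Ω H)] (hm : Measurable Φ)
    (hΦ : ∀ t, MemLp (fun z => Φ (t, z)) 2 (volume.restrict Ω)) : Measurable (slice Ω Φ) := by
  have : Fact ((2 : ℝ≥0∞) ≠ ⊤) := ⟨by norm_num⟩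
  have : IsSeparable ((volume : Measure (Phase D)).restrict Ω) := isSeparable_of_sigmaFinite _
  refine measurable_of_measurable_norm_sub fun c => ?_
  have hc : StronglyMeasurable (c : Phase D → H) := Lp.stronglyMeasurable c
  have h1 : Measurable fun t => ∫ z in Ω, ‖Φ (t, z) - c z‖ ^ 2 := by
    have h2 : StronglyMeasurable fun p : ℝ × Phase D => ‖Φ p - c p.2‖ ^ 2 := by
      have h3 : Measurable fun p : ℝ × Phase D => c p.2 := hc.measurable.comp measurable_snd
      exact ((hm.sub h3).norm.pow_const 2).stronglyMeasurable
    exact (h2.integral_prod_right' (ν := volume.restrict Ω)).measurable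
  have h4 : (fun t => ‖slice Ω Φ t - c‖) = fun t => Real.sqrt (∫ z in Ω, ‖Φ (t, z) - c z‖ ^ 2) := by
    funext t
    have h5 : ‖slice Ω Φ t - c‖ ^ 2 = ∫ z in Ω, ‖Φ (t, z) - c z‖ ^ 2 := by
      rw [← real_inner_self_eq_norm_sq, L2.inner_def]
      refine integral_congr_ae ?_
      filter_upwards [Lp.coeFn_sub (slice Ω Φ t) c, coeFn_slice (hΦ t)] with z h1 h2
      rw [h1, Pi.sub_apply, h2, real_inner_self_eq_norm_sq]
    rw [← h5, Real.sqrt_sq (norm_nonneg _)]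
  rw [h4]
  exact h1.sqrt

lemma norm_slice_le (hbd : Bornology.IsBounded Ω) (hΩ : MeasurableSet Ω) (hm : Measurable Φ) {t : ℝ}
    (hN0 : 0 ≤ N) (hN : ∀ z ∈ Ω, ‖Φ (t, z)‖ ≤ N) :
    ‖slice Ω Φ t‖ ≤ measureUnivNNReal (volume.restrict Ω) ^ (2 : ℝ≥0∞).toReal⁻¹ * N := by
  have := isFiniteMeasure_restrict hbd
  refine Lp.norm_le_of_ae_bound hN0 ?_
  filter_upwards [coeFn_slice (memLp_slice hbd hΩ hm hN), ae_restrict_mem hΩ] with z h1 h2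
  rw [h1]; exact hN z h2

lemma memLp_slices (hbd : Bornology.IsBounded Ω) (hΩ : MeasurableSet Ω) (hm : Measurable Φ)
    (hN0 : 0 ≤ N) (hN : ∀ t, ∀ z ∈ Ω, ‖Φ (t, z)‖ ≤ N) (a b : ℝ) :
    MemLp (slice Ω Φ) 2 (volume.restrict (Icc a b)) := by
  have : Fact ((2 : ℝ≥0∞) ≠ ⊤) := ⟨by norm_num⟩
  have : IsSeparable ((volume : Measure (Phase D)).restrict Ω) := isSeparable_of_sigmaFinite _
  have := isFiniteMeasure_restrict hbd
  borelize ↥(L2 Ω H)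
  refine MemLp.of_bound (measurable_slice hm fun t =>
    memLp_slice hbd hΩ hm (hN t)).aestronglyMeasurable _
    (Eventually.of_forall fun t => norm_slice_le hbd hΩ hm hN0 (hN t))

lemma inner_slice {t : ℝ} (h : MemLp (fun z => Φ (t, z)) 2 (volume.restrict Ω)) (v : L2 Ω H) :
    ⟪v, slice Ω Φ t⟫ = ∫ z in Ω, ⟪v z, Φ (t, z)⟫ := by
  rw [L2.inner_def]
  refine integral_congr_ae ?_
  filter_upwards [coeFn_slice h] with z hz
  rw [hz]

end Slices

/-! ### Classical derivatives of Lipschitz functions as weak derivatives. -/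

section Derivatives

variable {D : ℕ} {Ω : Set (Phase D)} {g : ℝ × Phase D → ℝ} {C : ℝ≥0} {a b : ℝ}

lemma norm_fderiv_time_le (hg : LipschitzWith C g) (p : ℝ × Phase D) :
    ‖fderiv ℝ g p (1, 0)‖ ≤ C := by
  refine (ContinuousLinearMap.le_opNorm _ _).trans ?_
  have h1 : ‖((1 : ℝ), (0 : Phase D))‖ = 1 := by simp [Prod.norm_def]
  rw [h1, mul_one]
  exact norm_fderiv_le_of_lipschitz ℝ hg

lemma norm_gradV_le (hg : LipschitzWith C g) (p : ℝ × Phase D) : ‖gradV g p‖ ≤ C :=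
  norm_gradV_le_of_lip (t := p.1) (z := p.2) C.coe_nonneg (Eventually.of_forall fun y => by
    have := hg.dist_le_mul (p.1, y) (p.1, p.2)
    rwa [Real.dist_eq, Prod.dist_eq, dist_self, max_eq_right dist_nonneg, dist_eq_norm] at this)

lemma norm_gradX_le (hg : LipschitzWith C g) (p : ℝ × Phase D) : ‖gradX g p‖ ≤ C := by
  have h1 : ‖gradX g p‖ ^ 2 ≤ C * ‖gradX g p‖ := by
    rw [← real_inner_self_eq_norm_sq, inner_gradX]
    refine (Real.le_norm_self _).trans ((ContinuousLinearMap.le_opNorm _ _).trans ?_)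
    have h2 : ‖((0 : ℝ), ((gradX g p, 0) : Phase D))‖ = ‖gradX g p‖ := by simp [Prod.norm_def]
    rw [h2]
    gcongr
    exact norm_fderiv_le_of_lipschitz ℝ hg
  rcases (norm_nonneg (gradX g p)).eq_or_lt with h0 | h0
  · rw [← h0]; exact C.coe_nonneg
  · nlinarith

lemma measurable_fderiv_time (g : ℝ × Phase D → ℝ) : Measurable fun p => fderiv ℝ g p (1, 0) :=
  measurable_fderiv_apply_const ℝ g (1, 0)

lemma exists_bound_of_lipschitz (hbd : Bornology.IsBounded Ω) (hg : LipschitzWith C g) (t : ℝ) :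
    ∃ N, ∀ z ∈ Ω, ‖g (t, z)‖ ≤ N := by
  obtain ⟨N, hN⟩ := hbd.isCompact_closure.exists_bound_of_continuousOn
    (f := fun z => g (t, z)) (hg.continuous.comp (Continuous.prodMk_right t)).continuousOn
  exact ⟨N, fun z hz => hN z (subset_closure hz)⟩

/-- A Lipschitz function is an `H¹` function of time with values in `L²`. -/
lemma isH1With_slice (hbd : Bornology.IsBounded Ω) (hΩ : MeasurableSet Ω) (hg : LipschitzWith C g) :
    IsH1With a b (slice Ω g) (slice Ω fun p => fderiv ℝ g p (1, 0)) := by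
  have hfin := isFiniteMeasure_restrict hbd
  have hN := fun t => (fun z (_ : z ∈ Ω) => norm_fderiv_time_le hg (t, z))
  have hmg : ∀ t, MemLp (fun z => g (t, z)) 2 (volume.restrict Ω) := fun t => by
    obtain ⟨N, hN⟩ := exists_bound_of_lipschitz hbd hg t
    exact memLp_slice hbd hΩ hg.continuous.measurable hN
  have hmd := fun t => memLp_slice hbd hΩ (measurable_fderiv_time g) (hN t)
  have hmem := memLp_slices hbd hΩ (measurable_fderiv_time g) C.coe_nonneg hN
  refine ⟨hmem a b, fun t ht => ?_⟩
  have hint : IntervalIntegrable (slice Ω fun p => fderiv ℝ g p (1, 0)) volume a t := by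
    rw [intervalIntegrable_iff_integrableOn_Icc_of_le ht.1]
    exact (hmem a t).integrable one_le_two
  have hae : ∀ᵐ z ∂(volume.restrict Ω), ∀ᵐ s : ℝ, DifferentiableAt ℝ g (s, z) := by
    refine ae_restrict_of_ae ?_
    have h1 : ∀ᵐ p : Phase D × ℝ, DifferentiableAt ℝ g (p.2, p.1) := by
      have hqm := (Measure.measurePreserving_swap (μ := (volume : Measure (Phase D)))
        (ν := (volume : Measure ℝ))).quasiMeasurePreserving
      exact hqm.ae (hg.ae_differentiableAt (μ := (volume : Measure (ℝ × Phase D))))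
    exact Measure.ae_ae_of_ae_prod h1
  -- The identity in `L²(Ω)` is tested against each `v`. After exchanging the integrals it reduces
  -- to the fundamental theorem of calculus for the Lipschitz function `s ↦ g (s, z)`, for almost
  -- every `z`.
  refine ext_inner_left ℝ fun v => ?_
  have hv : Integrable v (volume.restrict Ω) := IsPath.integrable hbd v
  rw [inner_add_right]
  have e1 := (innerSL ℝ v).intervalIntegral_comp_comm hint
  simp only [innerSL_apply_apply] at e1
  have e3 : ∀ s, ⟪v, slice Ω (fun p => fderiv ℝ g p (1, 0)) s⟫
      = ∫ z in Ω, fderiv ℝ g (s, z) (1, 0) * v z := fun s => inner_slice (hmd s) v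
  simp only [e3] at e1
  rw [← e1, inner_slice (hmg t), inner_slice (hmg a)]
  simp only [RCLike.inner_apply, conj_trivial]
  rw [intervalIntegral_integral_swap]
  · have i1 : ∀ t, Integrable (fun z => g (t, z) * v z) (volume.restrict Ω) := fun t => by
      obtain ⟨N, hN⟩ := exists_bound_of_lipschitz hbd hg t
      refine hv.bdd_mul (c := N)
        (hg.continuous.comp (Continuous.prodMk_right t)).aestronglyMeasurable ?_
      filter_upwards [ae_restrict_mem hΩ] with z hz using hN z hz
    rw [← sub_eq_iff_eq_add', ← integral_sub (i1 t) (i1 a)]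
    refine integral_congr_ae ?_
    filter_upwards [hae] with z hz
    have hl : LipschitzWith C fun s => g (s, z) := by
      have := hg.comp (LipschitzWith.prodMk_right z)
      simpa [Function.comp_def] using this
    have e2 := (hl.lipschitzOnWith (s := uIcc a t)).absolutelyContinuousOnInterval.integral_deriv_eq_sub
    rw [← sub_mul, ← e2, ← intervalIntegral.integral_mul_const]
    refine intervalIntegral.integral_congr_ae ?_
    filter_upwards [hz] with s hs _
    congr 1
    have h1 : HasDerivAt (fun s => (s, z)) ((1 : ℝ), (0 : Phase D)) s :=
      (hasDerivAt_id s).prodMk (hasDerivAt_const s z)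
    exact (hs.hasFDerivAt.comp_hasDerivAt s h1).deriv
  · have hm : Measurable fun p : ℝ × Phase D => v p.2 :=
      (Lp.stronglyMeasurable v).measurable.comp measurable_snd
    rw [uIoc_of_le ht.1]
    refine Integrable.mono' (g := fun p : ℝ × Phase D => C * ‖v p.2‖) ?_
      ((measurable_fderiv_time g).mul hm).aestronglyMeasurable (Eventually.of_forall fun p => ?_)
    · exact (hv.norm.const_mul _).comp_snd _
    · simp only [Function.uncurry, norm_mul]
      gcongr
      exact norm_fderiv_time_le hg p

/-- The classical gradient of a Lipschitz function is a weak gradient. -/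
lemma isWeakGradient_slice (hbd : Bornology.IsBounded Ω) (hΩ : MeasurableSet Ω)
    (hg : LipschitzWith C g) :
    ∀ᵐ t : ℝ, IsWeakGradient Ω (slice Ω g t) (slice Ω (gradX g) t) (slice Ω (gradV g) t) := by
  have hfin := isFiniteMeasure_restrict hbd
  have h1 : ∀ᵐ t : ℝ, ∀ᵐ z : Phase D, DifferentiableAt ℝ g (t, z) :=
    Measure.ae_ae_of_ae_prod (hg.ae_differentiableAt (μ := (volume : Measure (ℝ × Phase D))))
  filter_upwards [h1] with t ht ψ hψ hψc hψs e
  have hgt : LipschitzWith C fun z => g (t, z) := by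
    have := hg.comp (LipschitzWith.prodMk_left (β := Phase D) t)
    simpa [Function.comp_def] using this
  obtain ⟨C', hC'⟩ := ContDiff.lipschitzWith_of_hasCompactSupport hψc hψ (by simp)
  have h2 := hgt.integral_lineDeriv_mul_eq (μ := (volume : Measure (Phase D))) hC' hψc e
  obtain ⟨N, hN⟩ := exists_bound_of_lipschitz hbd hg t
  have a1 := coeFn_slice (memLp_slice hbd hΩ hg.continuous.measurable hN)
  have a2 := coeFn_slice (memLp_slice hbd hΩ (measurable_gradX g)
    (t := t) (fun z _ => norm_gradX_le hg (t, z)))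
  have a3 := coeFn_slice (memLp_slice hbd hΩ (measurable_gradV g)
    (t := t) (fun z _ => norm_gradV_le hg (t, z)))
  have e1 : ∫ z in Ω, slice Ω g t z * fderiv ℝ ψ z e = - ∫ z, lineDeriv ℝ ψ z (-e) * g (t, z) := by
    have e3 : ∀ z, lineDeriv ℝ ψ z (-e) * g (t, z) = - (g (t, z) * fderiv ℝ ψ z e) := fun z => by
      rw [((hψ.differentiable (by simp)) z).lineDeriv_eq_fderiv, map_neg]
      ring
    have e4 : ∫ z in Ω, g (t, z) * fderiv ℝ ψ z e = ∫ z, g (t, z) * fderiv ℝ ψ z e :=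
      setIntegral_eq_integral_of_forall_compl_eq_zero fun z hz => by
        have : fderiv ℝ ψ z = 0 := image_eq_zero_of_notMem_tsupport fun h =>
          hz (hψs (tsupport_fderiv_subset ℝ h))
        rw [this]
        simp
    simp only [e3]
    rw [integral_neg, neg_neg, ← e4]
    refine integral_congr_ae ?_
    filter_upwards [a1] with z hz
    rw [hz]
  have e2 : ∫ z in Ω, (⟪slice Ω (gradX g) t z, e.1⟫ + ⟪slice Ω (gradV g) t z, e.2⟫) * ψ z
      = ∫ z, lineDeriv ℝ (fun z => g (t, z)) z e * ψ z := by
    have e4 : ∫ z in Ω, lineDeriv ℝ (fun z => g (t, z)) z e * ψ z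
        = ∫ z, lineDeriv ℝ (fun z => g (t, z)) z e * ψ z :=
      setIntegral_eq_integral_of_forall_compl_eq_zero fun z hz => by
        rw [image_eq_zero_of_notMem_tsupport fun h => hz (hψs h), mul_zero]
    rw [← e4]
    refine integral_congr_ae ?_
    filter_upwards [a2, a3, ae_restrict_of_ae ht] with z hx hv hd
    rw [hx, hv, ← fderiv_apply_space_eq]
    have h3 : HasFDerivAt (fun y => g (t, y))
        ((fderiv ℝ g (t, z)).comp (ContinuousLinearMap.inr ℝ ℝ (Phase D))) z :=
      hd.hasFDerivAt.comp z (hasFDerivAt_prodMk_right t z)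
    rw [h3.differentiableAt.lineDeriv_eq_fderiv, h3.fderiv]
    rfl
  rw [e1, e2, h2]

end Derivatives

/-! ### Continuity of `H¹` curves. -/

section H1

variable {H : Type*} [NormedAddCommGroup H] [NormedSpace ℝ H] {a b : ℝ} {u u' : ℝ → H}

lemma IsH1With.integrableOn (h : IsH1With a b u u') : IntegrableOn u' (Icc a b) :=
  h.1.integrable one_le_two

lemma IsH1With.intervalIntegrable (h : IsH1With a b u u') {t : ℝ} (ht : t ∈ Icc a b) :
    IntervalIntegrable u' volume a t := by
  rw [intervalIntegrable_iff_integrableOn_Icc_of_le ht.1]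
  exact h.integrableOn.mono_set (Icc_subset_Icc_right ht.2)

/-- A primitive of an integrable function is continuous on `[a,b]`. Clamping the time gives a curve
that is continuous on the whole line, as paths are required to be. -/
lemma IsH1With.continuous_clamp (h : IsH1With a b u u') (hab : a ≤ b) :
    Continuous fun t => u (max a (min b t)) := by
  have e : (fun t => u (max a (min b t))) = fun t => u a + ∫ s in a..max a (min b t), u' s :=
    funext fun t => h.2 _ (clamp_mem hab t)
  rw [e]
  have h1 : ContinuousOn (fun t => ∫ s in a..t, u' s) (Icc a b) := by
    have := intervalIntegral.continuousOn_primitive_interval (f := u') (μ := volume) (a := a)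
      (b := b) (by rw [uIcc_of_le hab]; exact h.integrableOn)
    rwa [uIcc_of_le hab] at this
  have h2 : Continuous fun t => max a (min b t) := by fun_prop
  exact continuous_const.add (h1.comp_continuous h2 fun t => clamp_mem hab t)

end H1

/-! ### From states of the model to states with regularised kernels. -/

section Regularisation

variable {D M : ℕ} {P : Model D} {Ω : Set (Phase D)} {a b : ℝ} {fa : L2 Ω ℝ} {da : Agents M D}
  {f : ℝ → L2 Ω ℝ} {d w : ℝ → Agents M D}

/-- A bound on the positions of the agents under admissible controls. -/
noncomputable def agentsBound (P : Model D) (a b : ℝ) (da : Agents M D) : ℝ :=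
  ‖da‖ + |P.umax| * (b - a)

lemma norm_agents_integral_apply_le {w : ℝ → Agents M D} {C t : ℝ} (ht : t ∈ Icc a b)
    (hw : ∀ᵐ s ∂(volume.restrict (Icc a b)), ∀ m, ‖w s m‖ ≤ C)
    (hi : IntervalIntegrable w volume a t) (hC : 0 ≤ C) (m : Fin M) :
    ‖(∫ s in a..t, w s) m‖ ≤ C * (b - a) := by
  have h1 := (PiLp.proj 2 (𝕜 := ℝ) (fun _ : Fin M => Space D) m).intervalIntegral_comp_comm hi
  simp only [PiLp.proj_apply] at h1
  rw [← h1]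
  have h2 : ∀ᵐ s, s ∈ Ioc a t → ‖w s m‖ ≤ C := by
    filter_upwards [(ae_restrict_iff' measurableSet_Icc).1 hw] with s hs hsm
    exact hs ⟨hsm.1.le, hsm.2.trans ht.2⟩ m
  have h3 := intervalIntegral.norm_integral_le_of_norm_le_const_ae
    (f := fun s => w s m) (a := a) (b := t) (C := C) (by rwa [uIoc_of_le ht.1])
  refine h3.trans ?_
  rw [abs_of_nonneg (sub_nonneg.2 ht.1)]
  gcongr
  exact ht.2

lemma norm_agents_le (hs : P.IsState Ω a b fa da f d w) (hw : P.Admissible a b w) {t : ℝ}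
    (ht : t ∈ Icc a b) (m : Fin M) : ‖d t m‖ ≤ agentsBound P a b da := by
  rw [hs.agents.2 t ht, hs.agents_init, agentsBound, PiLp.add_apply]
  refine (norm_add_le _ _).trans (add_le_add (PiLp.norm_apply_le da m) ?_)
  refine norm_agents_integral_apply_le ht (hw.2.mono fun s hs m => (hs m).trans (le_abs_self _))
    (hs.agents.intervalIntegrable ht) (abs_nonneg _) m

/-- The kernels `K₁`, `K₂` agree with the interaction kernels of the model as far as it matters. -/
structure AgreesWith (P : Model D) (Ω : Set (Phase D)) (K₁ K₂ : Space D → Space D) (R A : ℝ) :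
    Prop where
  bound : ∀ z ∈ Ω, ‖z‖ ≤ R
  eq₁ : ∀ x, ‖x‖ ≤ 2 * R → K₁ x = gradient P.Φ₁ x
  eq₂ : ∀ x, ‖x‖ < R + A + 1 → K₂ x = gradient P.Φ₂ x

variable {K₁ K₂ : Space D → Space D} {R A : ℝ}

namespace AgreesWith

lemma norm_fst_sub_le (h : AgreesWith P Ω K₁ K₂ R A) {y z : Phase D} (hy : y ∈ Ω) (hz : z ∈ Ω) :
    ‖z.1 - y.1‖ ≤ 2 * R := by
  have h1 := (norm_fst_le z).trans (h.bound z hz)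
  have h2 := (norm_fst_le y).trans (h.bound y hy)
  have := norm_sub_le z.1 y.1
  linarith

lemma norm_fst_sub_agent_lt (h : AgreesWith P Ω K₁ K₂ R A) {z : Phase D} (hz : z ∈ Ω) {x : Space D}
    (hx : ‖x‖ ≤ A) : ‖z.1 - x‖ < R + A + 1 := by
  have h1 := (norm_fst_le z).trans (h.bound z hz)
  have := norm_sub_le z.1 x
  linarith

lemma K₁_eq (h : AgreesWith P Ω K₁ K₂ R A) {y z : Phase D} (hy : y ∈ Ω) (hz : z ∈ Ω) :
    P.K₁ z.1 y.1 = K₁ (z.1 - y.1) := (h.eq₁ _ (h.norm_fst_sub_le hy hz)).symm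

lemma K₂_eq (h : AgreesWith P Ω K₁ K₂ R A) {z : Phase D} (hz : z ∈ Ω) {x : Space D}
    (hx : ‖x‖ ≤ A) : P.K₂ z.1 x = K₂ (z.1 - x) := (h.eq₂ _ (h.norm_fst_sub_agent_lt hz hx)).symm

lemma S_eq (h : AgreesWith P Ω K₁ K₂ R A) (hΩ : MeasurableSet Ω) {f : ℝ → L2 Ω ℝ}
    {d : ℝ → Agents M D} {t : ℝ} (hd : ∀ m, ‖d t m‖ ≤ A) {z : Phase D} (hz : z ∈ Ω) :
    P.S Ω (f t) (d t) z = force Ω K₁ K₂ f d t z.1 - P.α • z.2 := by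
  have e1 : ∫ y in Ω, f t y • P.K₁ z.1 y.1 = ∫ y in Ω, f t y • K₁ (z.1 - y.1) :=
    setIntegral_congr_fun hΩ fun y hy => by rw [h.K₁_eq hy hz]
  have e2 : ∑ m, P.K₂ z.1 (d t m) = ∑ m, K₂ (z.1 - d t m) :=
    Finset.sum_congr rfl fun m _ => h.K₂_eq hz (hd m)
  rw [Model.S, force, e1, e2]

end AgreesWith

lemma clamp_of_mem {t : ℝ} (ht : t ∈ Icc a b) : max a (min b t) = t := by
  rw [min_eq_right ht.2, max_eq_right ht.1]

/-- The weak formulation integrates over `Ω` and `[a,b]` only. There the positions and the agents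
stay in the region where the kernels were left unchanged. -/
lemma isRegState_of_isState (h : AgreesWith P Ω K₁ K₂ R (agentsBound P a b da)) (hab : a < b)
    (hΩ : MeasurableSet Ω) (hs : P.IsState Ω a b fa da f d w) (hw : P.Admissible a b w) :
    IsRegState Ω K₁ K₂ P.α a b fa (fun t => f (max a (min b t)))
      (fun t => d (max a (min b t))) := by
  obtain ⟨f', hf'⟩ := hs.memH1
  have ca : max a (min b a) = a := clamp_of_mem ⟨le_rfl, hab.le⟩
  refine ⟨⟨hf'.continuous_clamp hab.le, hs.agents.continuous_clamp hab.le,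
    fun t => hs.density _ (clamp_mem hab.le t)⟩, ?_, ?_⟩
  · simp only [ca]; exact hs.init
  · intro η hη hc hsupp
    have h1 := hs.vlasov η hη hc hsupp
    simp only [ca]
    rw [← h1]
    congr 1
    · refine setIntegral_congr_fun measurableSet_Icc fun t ht => ?_
      refine setIntegral_congr_fun hΩ fun z hz => ?_
      simp only [field, clamp_of_mem ht]
      have h2 := h.S_eq hΩ (f := fun t => f (max a (min b t)))
        (d := fun t => d (max a (min b t))) (t := t)
        (fun m => norm_agents_le hs hw (clamp_mem hab.le t) m) hz
      simp only [clamp_of_mem ht] at h2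
      rw [h2, mul_comm]
    · refine setIntegral_congr_fun hΩ fun z _ => ?_
      exact mul_comm _ _

/-- Regularised kernels exist. -/
lemma exists_agreesWith (P : Model D) (hbd : Bornology.IsBounded Ω) (A : ℝ) :
    ∃ (K₁ K₂ : Space D → Space D) (L₁ L₂ : ℝ≥0) (B₁ R : ℝ), AgreesWith P Ω K₁ K₂ R A ∧
      LipschitzWith L₁ K₁ ∧ LipschitzWith L₂ K₂ ∧ (∀ x, ‖K₁ x‖ ≤ B₁) := by
  obtain ⟨R, hR⟩ := hbd.exists_norm_le
  obtain ⟨K₁, L₁, B₁, hL₁, hB₁, he₁⟩ := exists_lipschitz_bounded_eqOn P.hΦ₁ (2 * R)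
  obtain ⟨K₂, L₂, B₂, hL₂, hB₂, he₂⟩ := exists_lipschitz_bounded_eqOn P.hΦ₂ (R + A + 1)
  exact ⟨K₁, K₂, L₁, L₂, B₁, R, ⟨hR, he₁, fun x hx => he₂ x hx.le⟩, hL₁, hL₂, hB₁⟩

end Regularisation

/-! ### Jointly measurable versions of paths of densities. -/

section MeasurableVersion

variable {D M : ℕ} {Ω : Set (Phase D)} {K₁ K₂ : Space D → Space D} {α a b : ℝ} {L₁ L₂ : ℝ≥0}
  {fa : L2 Ω ℝ} {f : ℝ → L2 Ω ℝ} {d : ℝ → Agents M D}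

/-- `ρ` is a jointly measurable version of the path of densities `f`. -/
structure IsVersion (Ω : Set (Phase D)) (a b : ℝ) (f : ℝ → L2 Ω ℝ) (ρ : ℝ → Phase D → ℝ) :
    Prop where
  meas : Measurable (Function.uncurry ρ)
  int : ∀ t, Integrable (ρ t) (volume.restrict Ω)
  mass : ∀ t, ∫ y in Ω, |ρ t y| = 1
  ae_eq : ∀ t ∈ Icc a b, ρ t =ᵐ[volume.restrict Ω] f t

/-- A curve in `L²(Ω)` carries no measurability in `(t,z)` for its pointwise representatives. The
transported initial density does, because the inverse flow is jointly continuous. -/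
lemma IsRegState.exists_version (hs : IsRegState Ω K₁ K₂ α a b fa f d)
    (h : Setting Ω K₁ K₂ L₁ L₂ a b) : ∃ ρ, IsVersion Ω a b f ρ := by
  obtain ⟨X, Y, hfl⟩ := hs.exists_flow h
  have hae : ∀ t, transported Ω α a Y fa (max a (min b t)) =ᵐ[volume.restrict Ω]
      f (max a (min b t)) := fun t => by
    have := hs.weak.ae_eq_transported hfl (hs.lip_force h) h.lt h.meas h.bdd hs.path.contf
      (clamp_mem h.lt.le t)
    rw [hs.init] at this
    filter_upwards [ae_restrict_of_ae this, ae_restrict_mem h.meas] with z hz hm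
    rw [← hz, indicator_of_mem hm]
  refine ⟨fun t => transported Ω α a Y fa (max a (min b t)), ?_, fun t => ?_, fun t => ?_,
    fun t ht => ?_⟩
  · have h1 := measurable_transported (α := α) (a := a) h.meas hfl.continuous_Y
      (Lp.stronglyMeasurable fa).measurable
    exact h1.comp (f := fun p : ℝ × Phase D => (max a (min b p.1), p.2)) (by fun_prop)
  · exact (IsPath.integrable h.bdd (f (max a (min b t)))).congr (hae t).symm
  · have h1 := IsPath.integral_norm_eq_one (hs.path.density (max a (min b t)))
    rw [← h1]
    refine integral_congr_ae ?_
    filter_upwards [hae t] with z hz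
    rw [hz, Real.norm_eq_abs]
  · have e := clamp_of_mem ht
    have := hae t
    simp only [e] at this ⊢
    exact this

lemma measurable_integral_mul {ρ : ℝ → Phase D → ℝ} (hρ : Measurable (Function.uncurry ρ))
    {c : ℝ × Phase D → ℝ} (hc : Measurable c) :
    Measurable fun s => ∫ z in Ω, ρ s z * c (s, z) :=
  ((Measurable.mul hρ hc).stronglyMeasurable.integral_prod_right' (ν := volume.restrict Ω)).measurable

lemma abs_integral_mul_le_of_ae {ρ c : Phase D → ℝ} {C : ℝ} (hρ : Integrable ρ (volume.restrict Ω))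
    (hc : ∀ᵐ z ∂(volume.restrict Ω), |c z| ≤ C) :
    |∫ z in Ω, ρ z * c z| ≤ C * ∫ z in Ω, |ρ z| := by
  rw [← Real.norm_eq_abs, ← integral_const_mul]
  refine norm_integral_le_of_norm_le (hρ.norm.const_mul C) ?_
  filter_upwards [hc] with z hz
  rw [norm_mul, mul_comm, Real.norm_eq_abs (c z)]
  exact mul_le_mul_of_nonneg_right hz (norm_nonneg _)

lemma integrable_mul_of_bound {ρ c : Phase D → ℝ} {C : ℝ} (hρ : Integrable ρ (volume.restrict Ω))
    (hm : Measurable c) (hc : ∀ᵐ z ∂(volume.restrict Ω), |c z| ≤ C) :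
    Integrable (fun z => ρ z * c z) (volume.restrict Ω) :=
  hρ.mul_bdd hm.aestronglyMeasurable hc

end MeasurableVersion

/-! ### The duality identity at a fixed time. -/

section FixedTime

variable {D : ℕ} {Ω : Set (Phase D)} {K : Space D → Space D} {ρ : ℝ → Phase D → ℝ}
  {J : ℝ → Space D → ℝ} {L₁ LJ : ℝ≥0} {B₁ BJ C : ℝ} {V : ℝ × Phase D → Space D} {p : Phase D → ℝ}

lemma AdjointData.integrable_kernel (h : AdjointData Ω K ρ J L₁ LJ B₁ BJ)
    (hp : Integrable p (volume.restrict Ω)) (x : Space D) :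
    Integrable (fun z => p z • K (x - z.1)) (volume.restrict Ω) := by
  refine hp.smul_bdd B₁ ?_ (Eventually.of_forall fun z => h.boundK _)
  exact (h.lipK.continuous.measurable.comp (by fun_prop)).aestronglyMeasurable

/-- Exchanging the roles of the two variables in the nonlocal term. -/
lemma AdjointData.integral_swap (h : AdjointData Ω K ρ J L₁ LJ B₁ BJ)
    (hodd : ∀ y ∈ Ω, ∀ z ∈ Ω, K (z.1 - y.1) = - K (y.1 - z.1)) (hV : Measurable V)
    (hVC : ∀ q, ‖V q‖ ≤ C) (hp : Integrable p (volume.restrict Ω)) (s : ℝ) :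
    ∫ z in Ω, p z * ∫ y in Ω, ρ s y * ⟪K (z.1 - y.1), V (s, y)⟫
      = - ∫ y in Ω, ρ s y * ⟪V (s, y), ∫ z in Ω, p z • K (y.1 - z.1)⟫ := by
  have hi : Integrable (fun q : Phase D × Phase D =>
      p q.1 * (ρ s q.2 * ⟪K (q.1.1 - q.2.1), V (s, q.2)⟫))
      ((volume.restrict Ω).prod (volume.restrict Ω)) := by
    have h1 : Integrable (fun q : Phase D × Phase D => (p q.1 * ρ s q.2)
        * ⟪K (q.1.1 - q.2.1), V (s, q.2)⟫) ((volume.restrict Ω).prod (volume.restrict Ω)) := by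
      refine (hp.mul_prod (h.intρ s)).mul_bdd (c := B₁ * C) ?_ (Eventually.of_forall fun q => ?_)
      · have h2 : Measurable fun q : Phase D × Phase D => K (q.1.1 - q.2.1) :=
          h.lipK.continuous.measurable.comp (by fun_prop)
        have h3 : Measurable fun q : Phase D × Phase D => V (s, q.2) := hV.comp (by fun_prop)
        exact (h2.inner h3).aestronglyMeasurable
      · exact (norm_inner_le_norm _ _).trans (mul_le_mul (h.boundK _) (hVC _) (norm_nonneg _)
          ((norm_nonneg _).trans (h.boundK 0)))
    refine h1.congr (Eventually.of_forall fun q => ?_)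
    simp only [mul_assoc]
  simp only [← integral_const_mul]
  rw [integral_integral_swap hi, ← integral_neg]
  refine integral_congr_ae ?_
  filter_upwards [ae_restrict_mem h.measΩ] with y hy
  have h4 : ∫ z in Ω, p z * (ρ s y * ⟪K (z.1 - y.1), V (s, y)⟫)
      = ∫ z in Ω, ⟪-(ρ s y) • V (s, y), p z • K (y.1 - z.1)⟫ := by
    refine integral_congr_ae ?_
    filter_upwards [ae_restrict_mem h.measΩ] with z hz
    rw [hodd y hy z hz, inner_neg_left, real_inner_smul_left, real_inner_smul_right,
      real_inner_comm]
    ring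
  rw [h4, integral_inner (h.integrable_kernel hp y.1), real_inner_smul_left]
  ring

/-- The identity behind the adjoint calculus, at a fixed time. -/
lemma AdjointData.fixed_time_identity (h : AdjointData Ω K ρ J L₁ LJ B₁ BJ)
    (hodd : ∀ y ∈ Ω, ∀ z ∈ Ω, K (z.1 - y.1) = - K (y.1 - z.1)) (hV : Measurable V)
    (hVC : ∀ q, ‖V q‖ ≤ C) (hp : Integrable p (volume.restrict Ω)) (s : ℝ) {Δ T : Phase D → Space D}
    {NΔ NT : ℝ} (hΔm : Measurable Δ) (hΔ : ∀ z, ‖Δ z‖ ≤ NΔ) (hTm : Measurable T)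
    (hT : ∀ z, ‖T z‖ ≤ NT)
    (hΔT : ∀ z, Δ z = - ((∫ y in Ω, p y • K (z.1 - y.1)) - ∫ y in Ω, ρ s y • K (z.1 - y.1)) - T z) :
    (∫ z in Ω, p z * (adjointSource Ω K ρ J V s z + ⟪V (s, z), Δ z⟫))
        - ∫ z in Ω, ρ s z * adjointSource Ω K ρ J V s z
      = ((∫ z in Ω, (p z - ρ s z) * J s z.1) - ∫ z in Ω, ρ s z * ⟪V (s, z), T z⟫)
        + ∫ z in Ω, (p z - ρ s z) * ⟪V (s, z), Δ z⟫ := by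
  have hq := h.intρ s
  have hpq : Integrable (fun z => p z - ρ s z) (volume.restrict Ω) := hp.sub hq
  have hVs : Measurable fun z => V (s, z) := hV.comp measurable_prodMk_left
  have hC0 : 0 ≤ C := (norm_nonneg _).trans (hVC (0, 0))
  have hk := h.isSource hV hVC
  have hkm : Measurable (adjointSource Ω K ρ J V s) := hk.meas.comp measurable_prodMk_left
  have hkb : ∀ᵐ z ∂(volume.restrict Ω), |adjointSource Ω K ρ J V s z| ≤ B₁ * C + BJ :=
    Eventually.of_forall fun z => hk.bound s z
  have hVb : ∀ {U : Phase D → Space D} {N : ℝ}, (∀ z, ‖U z‖ ≤ N) →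
      ∀ᵐ z ∂(volume.restrict Ω), |⟪V (s, z), U z⟫| ≤ C * N := fun hU =>
    Eventually.of_forall fun z => (abs_real_inner_le_norm _ _).trans
      (mul_le_mul (hVC _) (hU z) (norm_nonneg _) hC0)
  have hΔi : Measurable fun z => ⟪V (s, z), Δ z⟫ := hVs.inner hΔm
  have hTi : Measurable fun z => ⟪V (s, z), T z⟫ := hVs.inner hTm
  have hJm : Measurable fun z : Phase D => J s z.1 :=
    h.measJ.comp (f := fun z : Phase D => (s, z.1)) (by fun_prop)
  have hJb : ∀ᵐ z ∂(volume.restrict Ω), |J s z.1| ≤ BJ := Eventually.of_forall fun z => h.boundJ _ _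
  set I : Phase D → ℝ := fun z => ∫ y in Ω, ρ s y * ⟪K (z.1 - y.1), V (s, y)⟫ with hI
  have hIJ : ∀ z, adjointSource Ω K ρ J V s z = - I z + J s z.1 := fun z => rfl
  have hIeq : ∀ z, I z = J s z.1 - adjointSource Ω K ρ J V s z := fun z => by rw [hIJ]; ring
  have hpqI : Integrable (fun z => (p z - ρ s z) * I z) (volume.restrict Ω) := by
    simp only [hIeq, mul_sub]
    exact (integrable_mul_of_bound hpq hJm hJb).sub (integrable_mul_of_bound hpq hkm hkb)
  have hpqJ := integrable_mul_of_bound hpq hJm hJb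
  have hpqΔ := integrable_mul_of_bound hpq hΔi (hVb hΔ)
  have hqΔ := integrable_mul_of_bound hq hΔi (hVb hΔ)
  have hqT := integrable_mul_of_bound hq hTi (hVb hT)
  have hpk := integrable_mul_of_bound hp hkm hkb
  have hqk := integrable_mul_of_bound hq hkm hkb
  have hpΔ := integrable_mul_of_bound hp hΔi (hVb hΔ)
  -- After the swap the nonlocal term contains the variation of the crowd's force, which is `-Δ -
  -- T`. The part `Δ` cancels against the transport term weighted with `ρ`. There remain the agents'
  -- part `T` and a term containing both variations.
  have s1 := h.integral_swap hodd hV hVC hpq s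
  have e1 : ∫ y in Ω, ρ s y * ⟪V (s, y), ∫ z in Ω, (p z - ρ s z) • K (y.1 - z.1)⟫
      = - (∫ y in Ω, ρ s y * ⟪V (s, y), Δ y⟫) - ∫ y in Ω, ρ s y * ⟪V (s, y), T y⟫ := by
    have e0 := integral_sub hqΔ.neg hqT
    simp only [Pi.neg_apply, integral_neg] at e0
    rw [← e0]
    congr 1 with y
    have e2 : ∫ z in Ω, (p z - ρ s z) • K (y.1 - z.1) = - Δ y - T y := by
      simp only [sub_smul]
      rw [integral_sub (h.integrable_kernel hp y.1) (h.integrable_kernel hq y.1), hΔT y]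
      abel
    rw [e2, inner_sub_right, inner_neg_right]
    ring
  have e3 : ∫ z in Ω, p z * (adjointSource Ω K ρ J V s z + ⟪V (s, z), Δ z⟫)
      = (∫ z in Ω, p z * adjointSource Ω K ρ J V s z) + ∫ z in Ω, p z * ⟪V (s, z), Δ z⟫ := by
    rw [← integral_add hpk hpΔ]
    congr 1 with z
    ring
  have e4 : (∫ z in Ω, p z * adjointSource Ω K ρ J V s z)
      - ∫ z in Ω, ρ s z * adjointSource Ω K ρ J V s z
      = (∫ z in Ω, (p z - ρ s z) * J s z.1) - ∫ z in Ω, (p z - ρ s z) * I z := by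
    rw [← integral_sub hpk hqk, ← integral_sub hpqJ hpqI]
    congr 1 with z
    rw [hIJ]
    ring
  have e5 : ∫ z in Ω, p z * ⟪V (s, z), Δ z⟫
      = (∫ z in Ω, (p z - ρ s z) * ⟪V (s, z), Δ z⟫) + ∫ z in Ω, ρ s z * ⟪V (s, z), Δ z⟫ := by
    rw [← integral_add hpqΔ hqΔ]
    congr 1 with z
    ring
  rw [e1] at s1
  rw [e3, e5]
  linarith

end FixedTime

lemma intervalIntegrable_of_bounded_on {h : ℝ → ℝ} {a b B : ℝ} (hab : a ≤ b) (hm : Measurable h)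
    (hb : ∀ s ∈ Icc a b, |h s| ≤ B) : IntervalIntegrable h volume a b := by
  rw [intervalIntegrable_iff_integrableOn_Icc_of_le hab]
  refine Measure.integrableOn_of_bounded (M := B) measure_Icc_lt_top.ne hm.aestronglyMeasurable ?_
  filter_upwards [ae_restrict_mem measurableSet_Icc] with s hs using hb s hs

/-! ### Duality between the adjoint function and variations of the state. -/

section Duality

variable {D M : ℕ} {Ω : Set (Phase D)} {K₁ K₂ : Space D → Space D} {α a b : ℝ} {L₁ L₂ LJ C : ℝ≥0}
  {fa : L2 Ω ℝ} {f f₁ : ℝ → L2 Ω ℝ} {d d₁ : ℝ → Agents M D} {ρ ρ₁ : ℝ → Phase D → ℝ}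
  {J : ℝ → Space D → ℝ} {B₁ BJ η θ : ℝ} {g : ℝ × Phase D → ℝ}

/-- The average force exerted by the agents, up to its sign. -/
noncomputable def agentForce (K : Space D → Space D) (p : Agents M D) (x : Space D) : Space D :=
  (1 / (M : ℝ)) • ∑ m, K (x - p m)

lemma norm_agentForce_sub_le (hK : LipschitzWith L₂ K₂) {p q : Agents M D} (hη0 : 0 ≤ η)
    (h : ∀ m, ‖p m - q m‖ ≤ η) (x : Space D) :
    ‖agentForce K₂ p x - agentForce K₂ q x‖ ≤ L₂ * η := by
  refine IsPath.norm_average_sub_le (by positivity) fun m => ?_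
  refine (hK.norm_sub_le _ _).trans ?_
  have : x - p m - (x - q m) = -(p m - q m) := by abel
  rw [this, norm_neg]
  gcongr
  exact h m

lemma continuous_agentForce (hK : LipschitzWith L₂ K₂) (hd : Continuous d) :
    Continuous fun q : ℝ × Phase D => agentForce K₂ (d q.1) q.2.1 := by
  have h1 : ∀ m, Continuous fun q : ℝ × Phase D => K₂ (q.2.1 - d q.1 m) := fun m =>
    hK.continuous.comp (by fun_prop)
  have h2 : Continuous fun q : ℝ × Phase D => ∑ m, K₂ (q.2.1 - d q.1 m) :=
    continuous_finsetSum _ fun m _ => h1 m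
  exact h2.const_smul (1 / (M : ℝ))

lemma IsVersion.integral_abs_sub_le (hρ : IsVersion Ω a b f ρ) (hρ₁ : IsVersion Ω a b f₁ ρ₁)
    {s : ℝ} (hs : s ∈ Icc a b) (hθ : ∫ z in Ω, |f₁ s z - f s z| ≤ θ) :
    ∫ z in Ω, |ρ₁ s z - ρ s z| ≤ θ := by
  refine (le_of_eq ?_).trans hθ
  refine integral_congr_ae ?_
  filter_upwards [hρ.ae_eq s hs, hρ₁.ae_eq s hs] with z h1 h2
  rw [h1, h2]

/-- The adjoint function represents the variation of the linear part of the cost. -/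
lemma abs_duality_le (hs : IsRegState Ω K₁ K₂ α a b fa f d)
    (hs₁ : IsRegState Ω K₁ K₂ α a b fa f₁ d₁) (h : Setting Ω K₁ K₂ L₁ L₂ a b)
    (hρ : IsVersion Ω a b f ρ) (hρ₁ : IsVersion Ω a b f₁ ρ₁)
    (hA : AdjointData Ω K₁ ρ J L₁ LJ B₁ BJ)
    (hodd : ∀ y ∈ Ω, ∀ z ∈ Ω, K₁ (z.1 - y.1) = - K₁ (y.1 - z.1)) (hg : LipschitzWith C g)
    (hgb : ∀ z ∈ Ω, g (b, z) = 0)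
    (hgeq : ∀ᵐ t : ℝ, t ∈ Icc a b → ∀ᵐ z ∂(volume.restrict Ω),
        fderiv ℝ g (t, z) (1, (z.2, force Ω K₁ K₂ f d t z.1 - α • z.2))
          = adjointSource Ω K₁ ρ J (gradV g) t z)
    (hη0 : 0 < η) (hη : ∀ t ∈ Icc a b, ∀ m, ‖d₁ t m - d t m‖ ≤ η)
    (hθ : ∀ t ∈ Icc a b, ∫ z in Ω, |f₁ t z - f t z| ≤ θ) :
    |(∫ s in a..b, ∫ z in Ω, (ρ₁ s z - ρ s z) * J s z.1)
        - ∫ s in a..b, ∫ z in Ω,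
          ρ s z * ⟪gradV g (s, z), agentForce K₂ (d₁ s) z.1 - agentForce K₂ (d s) z.1⟫|
      ≤ C * (fieldConst L₁ L₂ α a b * η) * θ * (b - a) := by
  have hab := h.lt.le
  have hVm := measurable_gradV g
  have hVC := fun q => norm_gradV_le hg q
  have hN0 : 0 ≤ fieldConst L₁ L₂ α a b * η := mul_nonneg fieldConst_nonneg hη0.le
  have hk := hA.isSource hVm hVC
  set N := fieldConst L₁ L₂ α a b * η with hN
  set Bk := B₁ * (C : ℝ) + BJ with hBk
  set k := adjointSource Ω K₁ ρ J (gradV g) with hkdef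
  set Δ : ℝ × Phase D → Space D := fun q =>
    force Ω K₁ K₂ f₁ d₁ q.1 q.2.1 - force Ω K₁ K₂ f d q.1 q.2.1 with hΔdef
  set T : ℝ × Phase D → Space D := fun q =>
    agentForce K₂ (d₁ q.1) q.2.1 - agentForce K₂ (d q.1) q.2.1 with hTdef
  have hΔb : ∀ s ∈ Icc a b, ∀ z, ‖Δ (s, z)‖ ≤ N := fun s hsm z =>
    hs₁.norm_force_diff_le hs h hη0 hη hsm z.1
  have hTb : ∀ s ∈ Icc a b, ∀ z, ‖T (s, z)‖ ≤ L₂ * η := fun s hsm z =>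
    norm_agentForce_sub_le h.lip₂ hη0.le (hη s hsm) z.1
  have hΔc : Continuous Δ := by
    have h1 := hs.path.continuous_force h.bdd h.lip₁.continuous h.lip₂.continuous
    have h2 := hs₁.path.continuous_force h.bdd h.lip₁.continuous h.lip₂.continuous
    have hp : Continuous fun q : ℝ × Phase D => (q.1, q.2.1) := by fun_prop
    exact (h2.comp hp).sub (h1.comp hp)
  have hTc : Continuous T :=
    (continuous_agentForce h.lip₂ hs₁.path.contd).sub (continuous_agentForce h.lip₂ hs.path.contd)
  have hVΔ : Measurable fun q => ⟪gradV g q, Δ q⟫ := hVm.inner hΔc.measurable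
  have hVT : Measurable fun q => ⟪gradV g q, T q⟫ := hVm.inner hTc.measurable
  have hVΔb : ∀ s ∈ Icc a b, ∀ z, |⟪gradV g (s, z), Δ (s, z)⟫| ≤ C * N := fun s hsm z =>
    (abs_real_inner_le_norm _ _).trans (mul_le_mul (hVC _) (hΔb s hsm z) (norm_nonneg _)
      C.coe_nonneg)
  have hVTb : ∀ s ∈ Icc a b, ∀ z, |⟪gradV g (s, z), T (s, z)⟫| ≤ C * (L₂ * η) := fun s hsm z =>
    (abs_real_inner_le_norm _ _).trans (mul_le_mul (hVC _) (hTb s hsm z) (norm_nonneg _)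
      C.coe_nonneg)
  have hρd : Measurable (Function.uncurry fun s z => ρ₁ s z - ρ s z) := hρ₁.meas.sub hρ.meas
  have hJm : Measurable fun q : ℝ × Phase D => J q.1 q.2.1 :=
    hA.measJ.comp (f := fun q : ℝ × Phase D => (q.1, q.2.1)) (by fun_prop)
  set A : ℝ → ℝ := fun s => ∫ z in Ω, ρ s z * k s z with hAdef
  set A₁ : ℝ → ℝ := fun s => ∫ z in Ω, ρ₁ s z * (k s z + ⟪gradV g (s, z), Δ (s, z)⟫) with hA₁def
  set Q : ℝ → ℝ := fun s => ∫ z in Ω, (ρ₁ s z - ρ s z) * J s z.1 with hQdef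
  set U : ℝ → ℝ := fun s => ∫ z in Ω, ρ s z * ⟪gradV g (s, z), T (s, z)⟫ with hUdef
  set W : ℝ → ℝ := fun s => ∫ z in Ω, (ρ₁ s z - ρ s z) * ⟪gradV g (s, z), Δ (s, z)⟫ with hWdef
  have hiA : IntervalIntegrable A volume a b :=
    intervalIntegrable_of_bounded_on (B := Bk) hab
      (measurable_integral_mul hρ.meas (c := fun q => k q.1 q.2) hk.meas) fun s _ => by
        have := abs_integral_mul_le_of_ae (hρ.int s) (c := k s) (C := Bk)
          (Eventually.of_forall fun z => hk.bound s z)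
        rwa [hρ.mass, mul_one] at this
  have hiA₁ : IntervalIntegrable A₁ volume a b :=
    intervalIntegrable_of_bounded_on (B := Bk + C * N) hab
      (measurable_integral_mul hρ₁.meas
        (c := fun q => k q.1 q.2 + ⟪gradV g q, Δ q⟫) (Measurable.add hk.meas hVΔ)) fun s hsm => by
        have := abs_integral_mul_le_of_ae (hρ₁.int s)
          (c := fun z => k s z + ⟪gradV g (s, z), Δ (s, z)⟫) (C := Bk + C * N)
          (Eventually.of_forall fun z =>
            (abs_add_le _ _).trans (add_le_add (hk.bound s z) (hVΔb s hsm z)))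
        rwa [hρ₁.mass, mul_one] at this
  have hpq : ∀ s, Integrable (fun z => ρ₁ s z - ρ s z) (volume.restrict Ω) := fun s =>
    (hρ₁.int s).sub (hρ.int s)
  have hpqθ : ∀ s ∈ Icc a b, ∫ z in Ω, |ρ₁ s z - ρ s z| ≤ θ := fun s hsm =>
    hρ.integral_abs_sub_le hρ₁ hsm (hθ s hsm)
  have hBJ0 : 0 ≤ BJ := (abs_nonneg _).trans (hA.boundJ 0 0)
  have hiQ : IntervalIntegrable Q volume a b :=
    intervalIntegrable_of_bounded_on (B := BJ * θ) hab (measurable_integral_mul hρd hJm)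
      fun s hsm => (abs_integral_mul_le_of_ae (hpq s)
        (Eventually.of_forall fun z => hA.boundJ s z.1)).trans
        (mul_le_mul_of_nonneg_left (hpqθ s hsm) hBJ0)
  have hiU : IntervalIntegrable U volume a b :=
    intervalIntegrable_of_bounded_on (B := C * (L₂ * η)) hab (measurable_integral_mul hρ.meas hVT)
      fun s hsm => by
        have := abs_integral_mul_le_of_ae (hρ.int s)
          (Eventually.of_forall fun z => hVTb s hsm z)
        rwa [hρ.mass, mul_one] at this
  -- The remainder is a product of two variations: the field changes by at most `N`, proportional to
  -- `η`, and the density changes by `θ` in `L¹`. Once `θ` tends to zero it is negligible against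
  -- `η`.
  have hWb : ∀ s ∈ Icc a b, |W s| ≤ C * N * θ := fun s hsm =>
    (abs_integral_mul_le_of_ae (hpq s) (Eventually.of_forall fun z => hVΔb s hsm z)).trans
      (mul_le_mul_of_nonneg_left (hpqθ s hsm) (by positivity))
  have hiW : IntervalIntegrable W volume a b :=
    intervalIntegrable_of_bounded_on hab (measurable_integral_mul hρd hVΔ) hWb
  have hid : ∀ s ∈ Icc a b, A₁ s - A s = (Q s - U s) + W s := fun s hsm => by
    refine hA.fixed_time_identity hodd hVm hVC (hρ₁.int s) s
      (Δ := fun z => Δ (s, z)) (T := fun z => T (s, z))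
      (hΔc.measurable.comp measurable_prodMk_left) (hΔb s hsm)
      (hTc.measurable.comp measurable_prodMk_left) (hTb s hsm) fun z => ?_
    have c1 : ∫ y in Ω, ρ₁ s y • K₁ (z.1 - y.1) = ∫ y in Ω, f₁ s y • K₁ (z.1 - y.1) := by
      refine integral_congr_ae ?_
      filter_upwards [hρ₁.ae_eq s hsm] with y hy
      rw [hy]
    have c2 : ∫ y in Ω, ρ s y • K₁ (z.1 - y.1) = ∫ y in Ω, f s y • K₁ (z.1 - y.1) := by
      refine integral_congr_ae ?_
      filter_upwards [hρ.ae_eq s hsm] with y hy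
      rw [hy]
    simp only [hΔdef, hTdef, force, agentForce, c1, c2]
    abel
  have hend : ∀ p : L2 Ω ℝ, ∫ z in Ω, p z * g (b, z) = 0 := fun p => by
    refine (setIntegral_congr_fun h.meas fun z hz => ?_).trans (integral_zero _ _)
    rw [hgb z hz, mul_zero]
  -- The same `g` is tested in both equations. It vanishes at time `b`, and the two states share
  -- their initial density, so all boundary terms drop out of the difference.
  have e0 := hs.weak.integral_lipschitz h.lt h.meas h.bdd hs.path.contf
    (hs.path.continuous_field h.bdd h.lip₁.continuous h.lip₂.continuous) hg b ⟨hab, le_rfl⟩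
  have e1 := hs₁.weak.integral_lipschitz h.lt h.meas h.bdd hs₁.path.contf
    (hs₁.path.continuous_field h.bdd h.lip₁.continuous h.lip₂.continuous) hg b ⟨hab, le_rfl⟩
  rw [hend, hs.init] at e0
  rw [hend, hs₁.init] at e1
  have f0 : ∫ s in a..b, ∫ z in Ω, f s z * fderiv ℝ g (s, z) (1, field Ω K₁ K₂ α f d s z)
      = ∫ s in a..b, A s := by
    refine intervalIntegral.integral_congr_ae ?_
    filter_upwards [hgeq] with s hsg hsm
    rw [uIoc_of_le hab] at hsm
    have hsm' : s ∈ Icc a b := ⟨hsm.1.le, hsm.2⟩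
    refine integral_congr_ae ?_
    filter_upwards [hρ.ae_eq s hsm', hsg hsm'] with z h1 h2
    rw [h1, field, h2]
  have f1 : ∫ s in a..b, ∫ z in Ω, f₁ s z * fderiv ℝ g (s, z) (1, field Ω K₁ K₂ α f₁ d₁ s z)
      = ∫ s in a..b, A₁ s := by
    refine intervalIntegral.integral_congr_ae ?_
    filter_upwards [hgeq] with s hsg hsm
    rw [uIoc_of_le hab] at hsm
    have hsm' : s ∈ Icc a b := ⟨hsm.1.le, hsm.2⟩
    refine integral_congr_ae ?_
    filter_upwards [hρ₁.ae_eq s hsm', hsg hsm'] with z h1 h2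
    -- The two fields differ only in the velocity component, by the difference of the forces, so the
    -- adjoint equation along the optimal field can be reused for the perturbed one.
    have h3 : fderiv ℝ g (s, z) (1, (z.2, force Ω K₁ K₂ f₁ d₁ s z.1 - α • z.2))
        = k s z + ⟪gradV g (s, z), Δ (s, z)⟫ := by
      rw [← h2, fderiv_apply_eq g _ z.2 (force Ω K₁ K₂ f₁ d₁ s z.1 - α • z.2),
        fderiv_apply_eq g _ z.2 (force Ω K₁ K₂ f d s z.1 - α • z.2), add_assoc _ _ ⟪_, Δ (s, z)⟫,
        ← inner_add_right]
      congr 2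
      simp only [hΔdef]
      abel
    rw [h1, field, h3]
  have hsub : ∫ s in a..b, (A₁ s - A s) = ∫ s in a..b, ((Q s - U s) + W s) :=
    intervalIntegral.integral_congr fun s hsm => hid s (by rwa [uIcc_of_le hab] at hsm)
  rw [intervalIntegral.integral_sub hiA₁ hiA, intervalIntegral.integral_add (hiQ.sub hiU) hiW,
    intervalIntegral.integral_sub hiQ hiU, ← f0, ← f1] at hsub
  have hfin : (∫ s in a..b, Q s) - ∫ s in a..b, U s = - ∫ s in a..b, W s := by linarith
  rw [hfin, abs_neg, ← Real.norm_eq_abs]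
  refine (intervalIntegral.norm_integral_le_of_norm_le_const (C := C * N * θ) fun s hsm => ?_).trans
    (le_of_eq ?_)
  · rw [uIoc_of_le hab] at hsm
    exact hWb s ⟨hsm.1.le, hsm.2⟩
  · rw [abs_of_nonneg (sub_nonneg.2 hab)]

end Duality

/-! ### Integration by parts in time. -/

section IntegrationByParts

variable {H : Type*} [NormedAddCommGroup H] [InnerProductSpace ℝ H] [CompleteSpace H] {a b : ℝ}
  {e D : ℝ → H}

/-- Integration by parts for primitives of integrable functions. -/
lemma integral_inner_primitive (hab : a ≤ b) (he : IntegrableOn e (Ioc a b))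
    (hD : IntegrableOn D (Ioc a b)) :
    ∫ t in a..b, ⟪∫ r in a..t, e r, D t⟫ = ∫ r in a..b, ⟪e r, ∫ t in r..b, D t⟫ := by
  set μ := (volume : Measure ℝ).restrict (Ioc a b) with hμ
  have he' : Integrable e μ := he
  have hD' : Integrable D μ := hD
  set S : Set (ℝ × ℝ) := {q | q.2 < q.1} with hS
  have hSm : MeasurableSet S := measurableSet_lt measurable_snd measurable_fst
  -- Both sides are iterated integrals of the same function over the triangle `r < t`.
  set G : ℝ → ℝ → ℝ := fun t r => S.indicator (fun q => ⟪e q.2, D q.1⟫) (t, r) with hG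
  have hGi : Integrable (Function.uncurry G) (μ.prod μ) := by
    have h1 : Integrable (fun q : ℝ × ℝ => ⟪e q.2, D q.1⟫) (μ.prod μ) := by
      refine Integrable.mono' (hD'.norm.mul_prod he'.norm)
        (he'.aestronglyMeasurable.comp_snd.inner hD'.aestronglyMeasurable.comp_fst)
        (Eventually.of_forall fun q => ?_)
      rw [mul_comm]
      exact norm_inner_le_norm _ _
    exact h1.indicator hSm
  have e1 : ∀ t ∈ Ioc a b, ⟪∫ r in a..t, e r, D t⟫ = ∫ r, G t r ∂μ := fun t ht => by
    have h1 : ∫ r in a..t, e r = ∫ r, (Iio t).indicator e r ∂μ := by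
      rw [intervalIntegral.integral_of_le ht.1.le, integral_Ioc_eq_integral_Ioo,
        integral_indicator measurableSet_Iio, hμ, Measure.restrict_restrict measurableSet_Iio]
      congr 2
      ext r
      simp only [mem_Ioo, mem_inter_iff, mem_Iio, mem_Ioc]
      have := ht.2
      exact ⟨fun h => ⟨h.2, h.1, (h.2.trans_le this).le⟩, fun h => ⟨h.2.1, h.1⟩⟩
    rw [h1, real_inner_comm, ← integral_inner (he'.indicator measurableSet_Iio)]
    congr 1 with r
    by_cases hr : r < t
    · rw [indicator_of_mem (by exact hr), hG]
      simp only
      rw [indicator_of_mem (by exact hr), real_inner_comm]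
    · rw [indicator_of_notMem (by exact hr), hG]
      simp only
      rw [indicator_of_notMem (by exact hr), inner_zero_right]
  have e2 : ∀ r ∈ Ioc a b, ⟪e r, ∫ t in r..b, D t⟫ = ∫ t, G t r ∂μ := fun r hr => by
    have h1 : ∫ t in r..b, D t = ∫ t, (Ioi r).indicator D t ∂μ := by
      rw [intervalIntegral.integral_of_le hr.2, integral_indicator measurableSet_Ioi, hμ,
        Measure.restrict_restrict measurableSet_Ioi]
      congr 2
      ext t
      simp only [mem_inter_iff, mem_Ioi, mem_Ioc]
      exact ⟨fun h => ⟨h.1, hr.1.trans h.1, h.2⟩, fun h => ⟨h.1, h.2.2⟩⟩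
    rw [h1, ← integral_inner (hD'.indicator measurableSet_Ioi)]
    congr 1 with t
    by_cases hr : r < t
    · rw [indicator_of_mem (by exact hr), hG]
      simp only
      rw [indicator_of_mem (by exact hr)]
    · rw [indicator_of_notMem (by exact hr), hG]
      simp only
      rw [indicator_of_notMem (by exact hr), inner_zero_right]
  rw [intervalIntegral.integral_of_le hab, intervalIntegral.integral_of_le hab,
    setIntegral_congr_fun measurableSet_Ioc e1, setIntegral_congr_fun measurableSet_Ioc e2]
  exact integral_integral_swap hGi

end IntegrationByParts

/-! ### Symmetry of the Hessian and the slope of the agents' force. -/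

section Slope

variable {D M : ℕ} {K : Space D → Space D} {L : ℝ≥0}

/-- Symmetry of the second derivative requires differentiability of the first derivative only at the
point itself; `Φ` need not be twice continuously differentiable. -/
lemma inner_fderiv_gradient_comm {Φ : Space D → ℝ} (hΦ : ContDiff ℝ 1 Φ) {y : Space D}
    (hd : DifferentiableAt ℝ (gradient Φ) y) (v w : Space D) :
    ⟪fderiv ℝ (gradient Φ) y v, w⟫ = ⟪v, fderiv ℝ (gradient Φ) y w⟫ := by
  set T := (InnerProductSpace.toDual ℝ (Space D)).toContinuousLinearEquiv.toContinuousLinearMap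
    with hT
  have h1 : HasFDerivAt (fun x => T (gradient Φ x)) (T.comp (fderiv ℝ (gradient Φ) y)) y :=
    T.hasFDerivAt.comp y hd.hasFDerivAt
  have h2 : ∀ᶠ x in 𝓝 y, HasFDerivAt Φ (T (gradient Φ x)) x := Eventually.of_forall fun x =>
    ((hΦ.differentiable one_ne_zero).differentiableAt (x := x)).hasGradientAt.hasFDerivAt
  have h3 := second_derivative_symmetric_of_eventually h2 h1 v w
  have h4 : ∀ p q : Space D, (T.comp (fderiv ℝ (gradient Φ) y)) p q
      = ⟪fderiv ℝ (gradient Φ) y p, q⟫ := fun p q => rfl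
  rw [h4, h4] at h3
  rw [h3, real_inner_comm]

/-- Rademacher in position space, pulled back along `z ↦ z.1 - p m`, under which preimages of null
sets are null. -/
lemma ae_differentiableAt_sub (hK : LipschitzWith L K) (p : Agents M D) :
    ∀ᵐ z : Phase D, ∀ m, DifferentiableAt ℝ K (z.1 - p m) := by
  rw [ae_all_iff]
  intro m
  have h1 : ∀ᵐ x : Space D, DifferentiableAt ℝ K x := hK.ae_differentiableAt
  have h2 : Measure.QuasiMeasurePreserving (fun z : Phase D => z.1 - p m) volume volume :=
    (measurePreserving_sub_right volume (p m)).quasiMeasurePreserving.comp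
      Measure.quasiMeasurePreserving_fst
  exact h2.ae h1

lemma tendsto_agentForce_slope {p q : Agents M D} {x : Space D}
    (hd : ∀ m, DifferentiableAt ℝ K (x - p m)) :
    Tendsto (fun ε : ℝ => ε⁻¹ • (agentForce K (p + ε • q) x - agentForce K p x)) (𝓝[≠] 0)
      (𝓝 (-((1 / (M : ℝ)) • ∑ m, fderiv ℝ K (x - p m) (q m)))) := by
  have h1 : ∀ m, HasDerivAt (fun ε : ℝ => K (x - (p + ε • q) m)) (-fderiv ℝ K (x - p m) (q m)) 0 :=
    fun m => by
      have e1 : HasDerivAt (fun ε : ℝ => x - (p + ε • q) m) (-(q m)) 0 := by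
        have : HasDerivAt (fun ε : ℝ => x - (p m + ε • q m)) (-((1 : ℝ) • q m)) 0 :=
          (((hasDerivAt_id (0 : ℝ)).smul_const (q m)).const_add (p m)).const_sub x
        simpa using this
      have e2 : HasFDerivAt K (fderiv ℝ K (x - p m)) (x - (p + (0 : ℝ) • q) m) := by
        have : x - (p + (0 : ℝ) • q) m = x - p m := by simp
        rw [this]
        exact (hd m).hasFDerivAt
      have := e2.comp_hasDerivAt (0 : ℝ) e1
      rwa [map_neg] at this
  have h2 : HasDerivAt (fun ε : ℝ => agentForce K (p + ε • q) x)
      ((1 / (M : ℝ)) • ∑ m, -fderiv ℝ K (x - p m) (q m)) 0 := by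
    have := (HasDerivAt.fun_sum (u := Finset.univ) fun m _ => h1 m).const_smul (1 / (M : ℝ))
    exact this
  have h3 := h2.tendsto_slope_zero
  simpa using h3

end Slope

/-! ### The limit of the coupling with the agents. -/

section Limit

variable {D M : ℕ} {Ω : Set (Phase D)} {K : Space D → Space D} {a b : ℝ} {L : ℝ≥0}
  {d δ : ℝ → Agents M D} {ρ : ℝ → Phase D → ℝ} {C B : ℝ} {V : ℝ × Phase D → Space D}

/-- The derivative of the coupling with the agents, with a general kernel. -/
noncomputable def agentTerm (Ω : Set (Phase D)) (K : Space D → Space D) (ρ : ℝ → Phase D → ℝ)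
    (d : ℝ → Agents M D) (V : ℝ × Phase D → Space D) (s : ℝ) : Agents M D :=
  WithLp.toLp 2 fun m => (1 / (M : ℝ)) • ∫ z in Ω, ρ s z • fderiv ℝ K (z.1 - d s m) (V (s, z))

lemma measurable_fderiv_agent (hd : Continuous d) (hV : Measurable V) (m : Fin M) :
    Measurable fun q : ℝ × Phase D => fderiv ℝ K (q.2.1 - d q.1 m) (V q) := by
  have h1 : Measurable fun q : ℝ × Phase D => fderiv ℝ K (q.2.1 - d q.1 m) :=
    (measurable_fderiv ℝ K).comp (f := fun q : ℝ × Phase D => q.2.1 - d q.1 m)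
      (Continuous.measurable (by fun_prop))
  have h2 : Continuous fun p : (Space D →L[ℝ] Space D) × Space D => p.1 p.2 :=
    isBoundedBilinearMap_apply.continuous
  exact h2.measurable.comp (h1.prodMk hV)

lemma norm_fderiv_agent_le (hK : LipschitzWith L K) (hVC : ∀ q, ‖V q‖ ≤ C) (x : Space D)
    (q : ℝ × Phase D) : ‖fderiv ℝ K x (V q)‖ ≤ L * C :=
  (ContinuousLinearMap.le_opNorm _ _).trans
    (mul_le_mul (norm_fderiv_le_of_lipschitz ℝ hK) (hVC q) (norm_nonneg _) L.coe_nonneg)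

lemma integrable_agent (hK : LipschitzWith L K) (hd : Continuous d) (hV : Measurable V)
    (hVC : ∀ q, ‖V q‖ ≤ C) {s : ℝ} (hi : Integrable (ρ s) (volume.restrict Ω)) (m : Fin M) :
    Integrable (fun z => ρ s z • fderiv ℝ K (z.1 - d s m) (V (s, z))) (volume.restrict Ω) :=
  hi.smul_bdd (L * C)
    ((measurable_fderiv_agent hd hV m).comp measurable_prodMk_left).aestronglyMeasurable
    (Eventually.of_forall fun _ => norm_fderiv_agent_le hK hVC _ _)

lemma measurable_agentTerm (hρ : Measurable (Function.uncurry ρ)) (hd : Continuous d)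
    (hV : Measurable V) : Measurable (agentTerm Ω K ρ d V) := by
  have h1 : ∀ m, Measurable fun s => (1 / (M : ℝ)) •
      ∫ z in Ω, ρ s z • fderiv ℝ K (z.1 - d s m) (V (s, z)) := fun m => by
    have h2 : Measurable fun q : ℝ × Phase D =>
        ρ q.1 q.2 • fderiv ℝ K (q.2.1 - d q.1 m) (V q) :=
      Measurable.smul hρ (measurable_fderiv_agent hd hV m)
    have h3 := (h2.stronglyMeasurable.integral_prod_right' (ν := volume.restrict Ω)).measurable
    exact h3.const_smul (1 / (M : ℝ))
  exact (PiLp.continuous_toLp 2 fun _ : Fin M => Space D).measurable.comp (measurable_pi_lambda _ h1)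

lemma exists_bound_agentTerm (hK : LipschitzWith L K) (hVC : ∀ q, ‖V q‖ ≤ C)
    (hi : ∀ s, Integrable (ρ s) (volume.restrict Ω)) (hmass : ∀ s, ∫ y in Ω, |ρ s y| = 1) :
    ∃ N, ∀ s, ‖agentTerm Ω K ρ d V s‖ ≤ N := by
  -- Bounds are available agent by agent, hence in the supremum norm; compactness of the closed ball
  -- turns them into a bound in the Euclidean norm.
  obtain ⟨N, hN⟩ : ∃ N, ∀ v : Fin M → Space D, ‖v‖ ≤ |1 / (M : ℝ)| * (L * C) →
      ‖(WithLp.toLp 2 v : Agents M D)‖ ≤ N := by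
    obtain ⟨N, hN⟩ := (isCompact_closedBall (0 : Fin M → Space D)
      (|1 / (M : ℝ)| * (L * C))).exists_bound_of_continuousOn
      (f := fun v => (WithLp.toLp 2 v : Agents M D))
      (PiLp.continuous_toLp 2 fun _ : Fin M => Space D).continuousOn
    exact ⟨N, fun v hv => hN v (by rwa [mem_closedBall_zero_iff])⟩
  have hC0 : 0 ≤ C := (norm_nonneg _).trans (hVC (0, 0))
  refine ⟨N, fun s => hN _ ?_⟩
  rw [pi_norm_le_iff_of_nonneg (by positivity)]
  intro m
  rw [norm_smul, Real.norm_eq_abs]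
  gcongr
  have h1 := norm_integral_le_of_norm_le ((hi s).norm.mul_const (L * C))
    (f := fun z => ρ s z • fderiv ℝ K (z.1 - d s m) (V (s, z))) (Eventually.of_forall fun z => by
      rw [norm_smul]
      exact mul_le_mul_of_nonneg_left (norm_fderiv_agent_le hK hVC _ _) (norm_nonneg _))
  refine h1.trans (le_of_eq ?_)
  rw [integral_mul_const]
  simp only [Real.norm_eq_abs, hmass, one_mul]

/-- Symmetry moves the Hessian from the agents' displacement `q m` onto the velocity gradient, so
that `q` leaves the integral. -/
lemma inner_agentTerm (hK : LipschitzWith L K) (hd : Continuous d) (hV : Measurable V)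
    (hVC : ∀ q, ‖V q‖ ≤ C) {s : ℝ} (hi : Integrable (ρ s) (volume.restrict Ω)) {q : Agents M D}
    (hsymm : ∀ᵐ z ∂(volume.restrict Ω), ∀ m v w,
      ⟪fderiv ℝ K (z.1 - d s m) v, w⟫ = ⟪v, fderiv ℝ K (z.1 - d s m) w⟫) :
    ∫ z in Ω, ρ s z * ⟪V (s, z), (1 / (M : ℝ)) • ∑ m, fderiv ℝ K (z.1 - d s m) (q m)⟫
      = ⟪q, agentTerm Ω K ρ d V s⟫ := by
  have h1 : ∫ z in Ω, ρ s z * ⟪V (s, z), (1 / (M : ℝ)) • ∑ m, fderiv ℝ K (z.1 - d s m) (q m)⟫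
      = ∫ z in Ω, ∑ m, (1 / (M : ℝ)) * ⟪q m, ρ s z • fderiv ℝ K (z.1 - d s m) (V (s, z))⟫ := by
    refine integral_congr_ae ?_
    filter_upwards [hsymm] with z hz
    rw [real_inner_smul_right, inner_sum, Finset.mul_sum, Finset.mul_sum]
    refine Finset.sum_congr rfl fun m _ => ?_
    rw [← hz, real_inner_smul_right, real_inner_comm (q m)]
    ring
  rw [h1, integral_finsetSum _ fun m _ =>
    ((integrable_agent hK hd hV hVC hi m).const_inner (q m)).const_mul _, PiLp.inner_apply]
  refine Finset.sum_congr rfl fun m _ => ?_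
  rw [integral_const_mul, integral_inner (integrable_agent hK hd hV hVC hi m)]
  simp only [agentTerm, real_inner_smul_right]

/-- The derivative of the coupling term in the direction `δ`. -/
lemma tendsto_coupling (hab : a ≤ b) (hK : LipschitzWith L K) (hd : Continuous d)
    (hδ : Continuous δ) (hBn : 0 ≤ B) (hB : ∀ s ∈ Icc a b, ∀ m, ‖δ s m‖ ≤ B)
    (hV : Measurable V) (hVC : ∀ q, ‖V q‖ ≤ C) (hρ : Measurable (Function.uncurry ρ))
    (hi : ∀ s, Integrable (ρ s) (volume.restrict Ω)) (hmass : ∀ s, ∫ y in Ω, |ρ s y| = 1)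
    (hsymm : ∀ s ∈ Icc a b, ∀ᵐ z ∂(volume.restrict Ω), ∀ m v w,
      ⟪fderiv ℝ K (z.1 - d s m) v, w⟫ = ⟪v, fderiv ℝ K (z.1 - d s m) w⟫)
    {ε : ℕ → ℝ} (hε : Tendsto ε atTop (𝓝[>] 0)) (hεpos : ∀ n, 0 < ε n) :
    Tendsto (fun n => (ε n)⁻¹ * ∫ s in a..b, ∫ z in Ω,
        ρ s z * ⟪V (s, z), agentForce K (d s + ε n • δ s) z.1 - agentForce K (d s) z.1⟫) atTop
      (𝓝 (-∫ s in a..b, ⟪δ s, agentTerm Ω K ρ d V s⟫)) := by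
  have hε' : Tendsto ε atTop (𝓝[≠] 0) := hε.mono_right (nhdsWithin_mono _ fun x hx => ne_of_gt hx)
  have hC0 : 0 ≤ C := (norm_nonneg _).trans (hVC (0, 0))
  set Q : ℕ → ℝ × Phase D → Space D := fun n q =>
    (ε n)⁻¹ • (agentForce K (d q.1 + ε n • δ q.1) q.2.1 - agentForce K (d q.1) q.2.1) with hQ
  have hQc : ∀ n, Continuous (Q n) := fun n => by
    have h1 : Continuous fun s => d s + ε n • δ s := by fun_prop
    exact ((continuous_agentForce hK h1).sub (continuous_agentForce hK hd)).const_smul (ε n)⁻¹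
  have hQb : ∀ n, ∀ s ∈ Icc a b, ∀ z, ‖Q n (s, z)‖ ≤ L * B := fun n s hs z => by
    rw [hQ]
    simp only
    rw [norm_smul, norm_inv, Real.norm_of_nonneg (hεpos n).le, inv_mul_le_iff₀ (hεpos n)]
    have hB0 : ∀ m, ‖(d s + ε n • δ s) m - d s m‖ ≤ ε n * B := fun m => by
      have : (d s + ε n • δ s) m - d s m = ε n • δ s m := by simp
      rw [this, norm_smul, Real.norm_of_nonneg (hεpos n).le]
      exact mul_le_mul_of_nonneg_left (hB s hs m) (hεpos n).le
    have := norm_agentForce_sub_le hK (mul_nonneg (hεpos n).le hBn) hB0 z.1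
    linarith
  set U : ℕ → ℝ → ℝ := fun n s => ∫ z in Ω, ρ s z * ⟪V (s, z), Q n (s, z)⟫ with hU
  have hVQ : ∀ n, Measurable fun q => ⟪V q, Q n q⟫ := fun n => hV.inner (hQc n).measurable
  have hVQb : ∀ n, ∀ s ∈ Icc a b, ∀ z, |⟪V (s, z), Q n (s, z)⟫| ≤ C * (L * B) := fun n s hs z =>
    (abs_real_inner_le_norm _ _).trans (mul_le_mul (hVC _) (hQb n s hs z) (norm_nonneg _) hC0)
  have hUm : ∀ n, Measurable (U n) := fun n => measurable_integral_mul hρ (hVQ n)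
  have hUb : ∀ n, ∀ s ∈ Icc a b, |U n s| ≤ C * (L * B) := fun n s hs => by
    have := abs_integral_mul_le_of_ae (hi s) (Eventually.of_forall fun z => hVQb n s hs z)
    rwa [hmass, mul_one] at this
  -- For fixed time, the slopes converge for almost every `z` and are bounded by the Lipschitz
  -- constant of `K`, so dominated convergence applies, first in `z` and then in `s`.
  have hlim : ∀ s ∈ Icc a b, Tendsto (fun n => U n s) atTop
      (𝓝 (-⟪δ s, agentTerm Ω K ρ d V s⟫)) := fun s hs => by
    rw [← inner_agentTerm hK hd hV hVC (hi s) (hsymm s hs), ← integral_neg]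
    refine tendsto_integral_of_dominated_convergence (fun z => |ρ s z| * (C * (L * B)))
      (fun n => ?_) ((hi s).abs.mul_const _) (fun n => ?_) ?_
    · exact ((hi s).aestronglyMeasurable.mul
        ((hVQ n).comp measurable_prodMk_left).aestronglyMeasurable)
    · refine Eventually.of_forall fun z => ?_
      rw [norm_mul]
      exact mul_le_mul_of_nonneg_left (hVQb n s hs z) (norm_nonneg _)
    · filter_upwards [ae_restrict_of_ae (ae_differentiableAt_sub hK (d s))] with z hz
      have h1 := (tendsto_agentForce_slope (q := δ s) hz).comp hε'
      have h2 := ((tendsto_const_nhds (x := V (s, z))).inner h1).const_mul (ρ s z)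
      rw [inner_neg_right, mul_neg] at h2
      exact h2
  have hmain : Tendsto (fun n => ∫ s in a..b, U n s) atTop
      (𝓝 (∫ s in a..b, -⟪δ s, agentTerm Ω K ρ d V s⟫)) := by
    refine intervalIntegral.tendsto_integral_filter_of_dominated_convergence
      (fun _ => C * (L * B)) (Eventually.of_forall fun n => (hUm n).aestronglyMeasurable)
      (Eventually.of_forall fun n => Eventually.of_forall fun s hs => ?_)
      intervalIntegrable_const (Eventually.of_forall fun s hs => ?_)
    · rw [uIoc_of_le hab] at hs
      exact hUb n s ⟨hs.1.le, hs.2⟩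
    · rw [uIoc_of_le hab] at hs
      exact hlim s ⟨hs.1.le, hs.2⟩
  rw [intervalIntegral.integral_neg] at hmain
  refine hmain.congr fun n => ?_
  rw [← intervalIntegral.integral_const_mul]
  refine intervalIntegral.integral_congr fun s _ => ?_
  simp only [hU]
  rw [← integral_const_mul]
  congr 1 with z
  simp only [hQ, real_inner_smul_right]
  ring

end Limit

/-! ### Mean and variance of densities. -/

section Moments

variable {D : ℕ} {Ω : Set (Phase D)} {R : ℝ}

/-- The integral of a function that is not integrable is zero by convention, so total mass one
forces integrability. -/
lemma IsDensity.integrable {f : Phase D → ℝ} (hf : IsDensity Ω f) :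
    Integrable f (volume.restrict Ω) := by
  by_contra h
  have := hf.2
  rw [integral_undef h] at this
  exact zero_ne_one this

lemma IsDensity.norm_integral_smul_le {H : Type*} [NormedAddCommGroup H] [NormedSpace ℝ H]
    {f : Phase D → ℝ} (hf : IsDensity Ω f) (hΩ : MeasurableSet Ω) {c : Phase D → H} {C : ℝ}
    (hc : ∀ z ∈ Ω, ‖c z‖ ≤ C) : ‖∫ z in Ω, f z • c z‖ ≤ C := by
  refine (norm_integral_le_of_norm_le (hf.integrable.norm.mul_const C) ?_).trans (le_of_eq ?_)
  · filter_upwards [ae_restrict_mem hΩ] with z hz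
    rw [norm_smul]
    exact mul_le_mul_of_nonneg_left (hc z hz) (norm_nonneg _)
  · rw [integral_mul_const, IsPath.integral_norm_eq_one hf, one_mul]

lemma norm_mean_le {f : Phase D → ℝ} (hf : IsDensity Ω f) (hΩ : MeasurableSet Ω)
    (hR : ∀ z ∈ Ω, ‖z‖ ≤ R) : ‖mean Ω f‖ ≤ R :=
  hf.norm_integral_smul_le hΩ fun z hz => (norm_fst_le z).trans (hR z hz)

lemma abs_variance_le {f : Phase D → ℝ} (hf : IsDensity Ω f) (hΩ : MeasurableSet Ω)
    (hR : ∀ z ∈ Ω, ‖z‖ ≤ R) : |variance Ω f| ≤ (2 * R) ^ 2 := by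
  have h1 := hf.norm_integral_smul_le hΩ (c := fun z => ‖z.1 - mean Ω f‖ ^ 2) (C := (2 * R) ^ 2)
    fun z hz => by
      rw [norm_pow, norm_norm]
      have := norm_sub_le z.1 (mean Ω f)
      have h2 := norm_mean_le hf hΩ hR
      have h3 := (norm_fst_le z).trans (hR z hz)
      gcongr
      linarith
  have h2 : variance Ω f = ∫ z in Ω, f z • ‖z.1 - mean Ω f‖ ^ 2 := by
    simp only [variance, smul_eq_mul, mul_comm]
  rwa [h2, ← Real.norm_eq_abs]

variable {f : ℝ → L2 Ω ℝ}

lemma continuous_mean (hbd : Bornology.IsBounded Ω) (hf : Continuous f) :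
    Continuous fun t => mean Ω (f t) :=
  continuous_pairing_set hbd hf (c := fun _ z => z.1) (by fun_prop)

lemma continuous_variance (hbd : Bornology.IsBounded Ω) (hf : Continuous f) :
    Continuous fun t => variance Ω (f t) := by
  have key : ∀ m : ℝ → Space D, Continuous m →
      Continuous fun t => ∫ z in Ω, f t z • ‖z.1 - m t‖ ^ 2 := fun m hm =>
    continuous_pairing_set hbd hf (c := fun t z => ‖z.1 - m t‖ ^ 2) (by fun_prop)
  refine (key _ (continuous_mean hbd hf)).congr fun t => ?_
  simp only [variance, smul_eq_mul, mul_comm]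

end Moments

/-! ### The derivative of the cost as a bounded Lipschitz function. -/

section CutCost

variable {D : ℕ} {P : Model D} {Ω : Set (Phase D)} {R : ℝ}

/-- The derivative of the cost, as a globally Lipschitz and bounded function of the position. -/
noncomputable def cutCost (P : Model D) (Ω : Set (Phase D)) (R : ℝ) (f : Phase D → ℝ)
    (x : Space D) : ℝ :=
  P.dJ Ω f (clampVec R x, 0)

lemma cutCost_eq (hR : ∀ z ∈ Ω, ‖z‖ ≤ R) (f : Phase D → ℝ) {z : Phase D} (hz : z ∈ Ω) :
    cutCost P Ω R f z.1 = P.dJ Ω f z := by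
  rw [cutCost, clampVec_of_norm_le ((norm_fst_le z).trans (hR z hz))]
  rfl

lemma abs_cost_coeff_le {f : Phase D → ℝ} (hf : IsDensity Ω f) (hΩ : MeasurableSet Ω)
    (hR : ∀ z ∈ Ω, ‖z‖ ≤ R) : |P.σ₁ / (2 * P.T) * (variance Ω f - P.Vdes)|
      ≤ P.σ₁ / (2 * P.T) * ((2 * R) ^ 2 + |P.Vdes|) := by
  have h1 := P.hσ₁
  have h2 := P.hT
  rw [abs_mul, abs_of_nonneg (by positivity)]
  gcongr
  exact (abs_sub _ _).trans (add_le_add (abs_variance_le hf hΩ hR) le_rfl)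

/-- Mean and variance of any density on `Ω` are bounded by the size of `Ω`. The constants are thus
uniform over densities and serve all times at once. -/
lemma exists_lipschitz_cutCost (hΩ : MeasurableSet Ω) (hR : ∀ z ∈ Ω, ‖z‖ ≤ R) :
    ∃ (BJ : ℝ) (LJ : ℝ≥0), ∀ f : Phase D → ℝ, IsDensity Ω f →
      (∀ x, |cutCost P Ω R f x| ≤ BJ) ∧ LipschitzWith LJ (cutCost P Ω R f) := by
  obtain ⟨B, hB0, hB⟩ := exists_bound_clampVec D R
  have hσ₁ := P.hσ₁
  have hσ₂ := P.hσ₂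
  have hT := P.hT
  set c := P.σ₁ / (2 * P.T) * ((2 * R) ^ 2 + |P.Vdes|) with hc
  have hc0 : 0 ≤ c := by positivity
  set e := P.σ₂ / P.T * (|R| + ‖P.Edes‖) with he
  have he0 : 0 ≤ e := by positivity
  refine ⟨c * (B + |R|) ^ 2 + e * B, (c * (2 * (B + |R|)) + e).toNNReal, fun f hf => ?_⟩
  have hm : ‖mean Ω f‖ ≤ |R| := (norm_mean_le hf hΩ hR).trans (le_abs_self R)
  have hcf := abs_cost_coeff_le (P := P) hf hΩ hR
  have hyb : ∀ x, ‖clampVec R x - mean Ω f‖ ≤ B + |R| := fun x =>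
    (norm_sub_le _ _).trans (add_le_add (hB x) hm)
  have hef : ∀ v : Space D, |P.σ₂ / P.T * ⟪mean Ω f - P.Edes, v⟫| ≤ e * ‖v‖ := fun v => by
    rw [abs_mul, abs_of_nonneg (by positivity), he, mul_assoc]
    gcongr
    exact (abs_real_inner_le_norm _ _).trans (mul_le_mul_of_nonneg_right
      ((norm_sub_le _ _).trans (add_le_add hm le_rfl)) (norm_nonneg _))
  refine ⟨fun x => ?_, LipschitzWith.of_dist_le_mul fun x y => ?_⟩
  · rw [cutCost, Model.dJ]
    refine (abs_add_le _ _).trans (add_le_add ?_ ?_)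
    · rw [abs_mul, abs_of_nonneg (sq_nonneg ‖_‖)]
      have := hyb x
      gcongr
    · exact (hef _).trans (mul_le_mul_of_nonneg_left (hB x) he0)
  · rw [Real.coe_toNNReal _ (by positivity), Real.dist_eq, dist_eq_norm, cutCost, cutCost,
      Model.dJ, Model.dJ]
    simp only
    set k := P.σ₁ / (2 * P.T) * (variance Ω f - P.Vdes) with hk
    set p := clampVec R x with hp
    set q := clampVec R y with hq
    have hpq : ‖p - q‖ ≤ ‖x - y‖ := by
      have := (lipschitzWith_clampVec (D := D) R).norm_sub_le x y
      simpa using this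
    have h1 : |‖p - mean Ω f‖ ^ 2 - ‖q - mean Ω f‖ ^ 2| ≤ 2 * (B + |R|) * ‖x - y‖ := by
      rw [sq_sub_sq, abs_mul, abs_of_nonneg (by positivity)]
      have h2 := abs_norm_sub_norm_le (p - mean Ω f) (q - mean Ω f)
      rw [sub_sub_sub_cancel_right] at h2
      have h3 := hyb x
      have h4 := hyb y
      refine mul_le_mul (by linarith) (h2.trans hpq) (abs_nonneg _) (by positivity)
    have h5 := hef (p - q)
    rw [inner_sub_right] at h5
    have e1 : k * ‖p - mean Ω f‖ ^ 2 + P.σ₂ / P.T * ⟪mean Ω f - P.Edes, p⟫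
        - (k * ‖q - mean Ω f‖ ^ 2 + P.σ₂ / P.T * ⟪mean Ω f - P.Edes, q⟫)
        = k * (‖p - mean Ω f‖ ^ 2 - ‖q - mean Ω f‖ ^ 2)
          + P.σ₂ / P.T * (⟪mean Ω f - P.Edes, p⟫ - ⟪mean Ω f - P.Edes, q⟫) := by ring
    rw [e1]
    refine (abs_add_le _ _).trans ?_
    rw [abs_mul, add_mul, mul_assoc]
    exact add_le_add (mul_le_mul hcf h1 (abs_nonneg _) hc0)
      (h5.trans (mul_le_mul_of_nonneg_left hpq he0))

lemma measurable_cutCost (hbd : Bornology.IsBounded Ω) {f : ℝ → L2 Ω ℝ} (hf : Continuous f) :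
    Measurable (Function.uncurry fun t x => cutCost P Ω R (f t) x) := by
  have key : ∀ (m : ℝ → Space D) (v : ℝ → ℝ) (c : Space D → Space D), Continuous m →
      Continuous v → Continuous c → Continuous fun q : ℝ × Space D =>
        P.σ₁ / (2 * P.T) * (v q.1 - P.Vdes) * ‖c q.2 - m q.1‖ ^ 2
          + P.σ₂ / P.T * ⟪m q.1 - P.Edes, c q.2⟫ := fun m v c hm hv hc => by fun_prop
  exact (key _ _ _ (continuous_mean hbd hf) (continuous_variance hbd hf)
    (lipschitzWith_clampVec R).continuous).measurable

end CutCost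

/-! ### The constructed pair solves the adjoint system. -/

section Adjoint

variable {D M : ℕ} {P : Model D} {Ω : Set (Phase D)} {a b : ℝ} {fa : L2 Ω ℝ} {da : Agents M D}
  {f : ℝ → L2 Ω ℝ} {d w : ℝ → Agents M D} {K₁ K₂ : Space D → Space D} {L₁ L₂ C : ℝ≥0}
  {B₁ R A : ℝ} {ρ : ℝ → Phase D → ℝ} {g : ℝ × Phase D → ℝ}

/-- The kernels agree on an open ball with a margin of one, hence near each point that occurs.
Equality of the values alone would not identify the Hessians. -/
lemma AgreesWith.fderiv_K₂ (h : AgreesWith P Ω K₁ K₂ R A) {z : Phase D} (hz : z ∈ Ω) {x : Space D}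
    (hx : ‖x‖ ≤ A) : K₂ =ᶠ[𝓝 (z.1 - x)] gradient P.Φ₂ := by
  have h1 : z.1 - x ∈ Metric.ball (0 : Space D) (R + A + 1) := by
    rw [mem_ball_zero_iff]; exact h.norm_fst_sub_agent_lt hz hx
  filter_upwards [Metric.isOpen_ball.mem_nhds h1] with y hy
  exact h.eq₂ y (by rwa [mem_ball_zero_iff] at hy)

lemma AgreesWith.ae_symmetric (h : AgreesWith P Ω K₁ K₂ R A) (hΩ : MeasurableSet Ω)
    (hK : LipschitzWith L₂ K₂) {p : Agents M D} (hp : ∀ m, ‖p m‖ ≤ A) :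
    ∀ᵐ z ∂(volume.restrict Ω), ∀ m v w,
      ⟪fderiv ℝ K₂ (z.1 - p m) v, w⟫ = ⟪v, fderiv ℝ K₂ (z.1 - p m) w⟫ := by
  filter_upwards [ae_restrict_of_ae (ae_differentiableAt_sub hK p), ae_restrict_mem hΩ]
    with z hz hzm m v w
  have h1 := h.fderiv_K₂ hzm (hp m)
  rw [h1.fderiv_eq]
  exact inner_fderiv_gradient_comm P.hΦ₂.contDiff (h1.differentiableAt_iff.1 (hz m)) v w

lemma AgreesWith.odd (h : AgreesWith P Ω K₁ K₂ R A) : ∀ y ∈ Ω, ∀ z ∈ Ω,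
    K₁ (z.1 - y.1) = - K₁ (y.1 - z.1) := fun y hy z hz => by
  rw [← h.K₁_eq hy hz, ← h.K₁_eq hz hy, Model.K₁, Model.K₁, ← gradient_neg_of_radial P.hΦ₁, neg_sub]

lemma AgreesWith.agentTerm_eq (h : AgreesWith P Ω K₁ K₂ R A) (hbd : Bornology.IsBounded Ω)
    (hΩ : MeasurableSet Ω)
    (hρ : IsVersion Ω a b (fun t => f (max a (min b t))) ρ) (hg : LipschitzWith C g) {s : ℝ}
    (hs : s ∈ Icc a b) (hd : ∀ m, ‖d s m‖ ≤ A) :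
    agentTerm Ω K₂ ρ (fun t => d (max a (min b t))) (gradV g) s
      = P.Dd Ω (f s) (d s) (slice Ω (gradV g) s) := by
  have e := clamp_of_mem hs
  rw [agentTerm, Model.Dd]
  congr 1
  funext m
  congr 1
  refine integral_congr_ae ?_
  filter_upwards [hρ.ae_eq s hs, ae_restrict_mem hΩ,
    coeFn_slice (memLp_slice hbd hΩ (measurable_gradV g) fun z _ => norm_gradV_le hg (s, z))]
    with z h1 h2 h3
  simp only [e] at h1 ⊢
  rw [h1, h3, (h.fderiv_K₂ h2 (hd m)).fderiv_eq]

/-- On `Ω` the regularised kernels and the truncated cost coincide with the original ones, so the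
almost everywhere equation for `g` is the adjoint equation. The function `φ` is defined as the
integral from `t` to `b`, which builds in both its derivative and its terminal value. -/
lemma isAdjoint_slice (h : AgreesWith P Ω K₁ K₂ R A) (hset : Setting Ω K₁ K₂ L₁ L₂ a b)
    (hd : ∀ t ∈ Icc a b, ∀ m, ‖d t m‖ ≤ A)
    (hdc : Continuous fun t => d (max a (min b t)))
    (hρ : IsVersion Ω a b (fun t => f (max a (min b t))) ρ) (hg : LipschitzWith C g)
    (hgb : ∀ z ∈ Ω, g (b, z) = 0)
    (hgeq : ∀ᵐ t : ℝ, t ∈ Icc a b → ∀ᵐ z ∂(volume.restrict Ω),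
        fderiv ℝ g (t, z) (1, (z.2, force Ω K₁ K₂ (fun t => f (max a (min b t)))
          (fun t => d (max a (min b t))) t z.1 - P.α • z.2))
          = adjointSource Ω K₁ ρ (fun t x => cutCost P Ω R (f (max a (min b t))) x)
            (gradV g) t z) :
    P.IsAdjoint Ω a b f d (slice Ω g) (fun t => ∫ s in t..b,
      agentTerm Ω K₂ ρ (fun t => d (max a (min b t))) (gradV g) s) := by
  have hab := hset.lt.le
  have hbd := hset.bdd
  have hΩ := hset.meas
  have hT := measurable_fderiv_time g
  have hX := measurable_gradX g
  have hV := measurable_gradV g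
  have nT := fun t z (_ : z ∈ Ω) => norm_fderiv_time_le hg (t, z)
  have nX := fun t z (_ : z ∈ Ω) => norm_gradX_le hg (t, z)
  have nV := fun t z (_ : z ∈ Ω) => norm_gradV_le hg (t, z)
  refine ⟨slice Ω fun p => fderiv ℝ g p (1, 0), slice Ω (gradX g), slice Ω (gradV g),
    isH1With_slice hbd hΩ hg, memLp_slices hbd hΩ hX C.coe_nonneg nX a b,
    memLp_slices hbd hΩ hV C.coe_nonneg nV a b,
    ae_restrict_of_ae (isWeakGradient_slice hbd hΩ hg), ?_, ?_, ?_, ?_⟩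
  · filter_upwards [ae_restrict_of_ae hgeq, ae_restrict_mem measurableSet_Icc] with t ht htm
    have cV := coeFn_slice (memLp_slice hbd hΩ hV (nV t))
    filter_upwards [ht htm, ae_restrict_mem hΩ, coeFn_slice (Φ := fun p => fderiv ℝ g p (1, 0)) (memLp_slice hbd hΩ hT (nT t)),
      coeFn_slice (memLp_slice hbd hΩ hX (nX t)), cV] with z h1 hz h2 h3 h4
    have e := clamp_of_mem htm
    have hS := h.S_eq hΩ (f := fun t => f (max a (min b t))) (d := fun t => d (max a (min b t)))
      (t := t) (fun m => hd _ (clamp_mem hab t) m) hz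
    rw [← hS, fderiv_apply_eq] at h1
    simp only [e, adjointSource] at h1
    rw [cutCost_eq h.bound _ hz] at h1
    have hDf : P.Df Ω (f t) (slice Ω (gradV g) t) z
        = ∫ y in Ω, ρ t y * ⟪K₁ (z.1 - y.1), gradV g (t, y)⟫ := by
      refine integral_congr_ae ?_
      filter_upwards [hρ.ae_eq t htm, cV, ae_restrict_mem hΩ] with y h5 h6 hy
      simp only [e] at h5
      rw [h5, h6, h.K₁_eq hy hz, mul_comm]
    have c1 := real_inner_comm (gradX g (t, z)) z.2
    have c2 := real_inner_comm (gradV g (t, z)) (P.S Ω (f t) (d t) z)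
    rw [h2, h3, h4, hDf]
    linarith
  · have hm := measurable_agentTerm (K := K₂) (Ω := Ω) hρ.meas hdc hV
    obtain ⟨N, hN⟩ := exists_bound_agentTerm (Ω := Ω) (d := fun t => d (max a (min b t)))
      hset.lip₂ (norm_gradV_le hg) hρ.int hρ.mass
    have hmem : MemLp (agentTerm Ω K₂ ρ (fun t => d (max a (min b t))) (gradV g)) 2
        (volume.restrict (Icc a b)) :=
      MemLp.of_bound hm.aestronglyMeasurable N (Eventually.of_forall hN)
    have heq : ∀ s ∈ Icc a b, - agentTerm Ω K₂ ρ (fun t => d (max a (min b t))) (gradV g) s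
        = - P.Dd Ω (f s) (d s) (slice Ω (gradV g) s) := fun s hs => by
      rw [h.agentTerm_eq hbd hΩ hρ hg hs (hd s hs)]
    refine ⟨hmem.neg.ae_eq ?_, fun t ht => ?_⟩
    · filter_upwards [ae_restrict_mem measurableSet_Icc] with s hs using heq s hs
    · have hi : ∀ c e, IntervalIntegrable
          (agentTerm Ω K₂ ρ (fun t => d (max a (min b t))) (gradV g)) volume c e := fun c e => by
        rw [intervalIntegrable_iff]
        exact Measure.integrableOn_of_bounded (M := N) measure_Ioc_lt_top.ne
          hm.aestronglyMeasurable (Eventually.of_forall hN)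
      have h1 : ∫ s in a..t, - P.Dd Ω (f s) (d s) (slice Ω (gradV g) s)
          = - ∫ s in a..t, agentTerm Ω K₂ ρ (fun t => d (max a (min b t))) (gradV g) s := by
        rw [← intervalIntegral.integral_neg]
        refine intervalIntegral.integral_congr fun s hs => ?_
        rw [uIcc_of_le ht.1] at hs
        exact (heq s ⟨hs.1, hs.2.trans ht.2⟩).symm
      simp only
      rw [h1, ← intervalIntegral.integral_add_adjacent_intervals (hi a t) (hi t b)]
      abel
  · rw [Lp.eq_zero_iff_ae_eq_zero]
    obtain ⟨N, hN⟩ := exists_bound_of_lipschitz hbd hg b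
    filter_upwards [coeFn_slice (memLp_slice hbd hΩ hg.continuous.measurable hN),
      ae_restrict_mem hΩ] with z h1 hz
    rw [h1, hgb z hz]
    rfl
  · exact intervalIntegral.integral_same

end Adjoint

/-! ### Second order expansion of the running cost. -/

section Expansion

variable {D : ℕ} {P : Model D} {Ω : Set (Phase D)} {R : ℝ}

/-- The cost per unit of time, without the cost of the control. -/
noncomputable def runCost (P : Model D) (Ω : Set (Phase D)) (f : Phase D → ℝ) : ℝ :=
  P.σ₁ / (4 * P.T) * |variance Ω f - P.Vdes| ^ 2
    + P.σ₂ / (2 * P.T) * ‖mean Ω f - P.Edes‖ ^ 2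

/-- The parallel axis identity: the cross term vanishes because deviations from the mean integrate
to zero against a density. -/
lemma integral_smul_sq (hbd : Bornology.IsBounded Ω) {q : L2 Ω ℝ} (hq : IsDensity Ω q)
    (m : Space D) :
    ∫ z in Ω, q z • ‖z.1 - m‖ ^ 2 = variance Ω q + ‖mean Ω q - m‖ ^ 2 := by
  set m₁ := mean Ω q with hm₁
  have i0 := IsPath.integrable hbd q
  have i1 := IsPath.integrable_smul hbd q (c := fun z => ‖z.1 - m₁‖ ^ 2) (by fun_prop)
  have i2 := IsPath.integrable_smul hbd q (c := fun z => z.1) (by fun_prop)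
  have e : ∀ z, q z • ‖z.1 - m‖ ^ 2 = q z • ‖z.1 - m₁‖ ^ 2 + (2 * ⟪m₁ - m, q z • z.1⟫
      + q z * (‖m₁ - m‖ ^ 2 - 2 * ⟪m₁ - m, m₁⟫)) := fun z => by
    have h1 : z.1 - m = (z.1 - m₁) + (m₁ - m) := by abel
    rw [h1, norm_add_sq_real, real_inner_smul_right, real_inner_comm, inner_sub_right]
    simp only [smul_eq_mul]
    ring
  have e1 : variance Ω q = ∫ z in Ω, q z • ‖z.1 - m₁‖ ^ 2 := by
    simp only [variance, smul_eq_mul, mul_comm, hm₁]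
  have e2 : ∫ z in Ω, q z • z.1 = m₁ := rfl
  simp only [e]
  rw [integral_add i1 (((i2.const_inner _).const_mul 2).fun_add (i0.mul_const _)),
    integral_add ((i2.const_inner _).const_mul 2) (i0.mul_const _), integral_const_mul,
    integral_inner i2, integral_mul_const, hq.2, e1, e2]
  ring

lemma integral_mul_dJ (hbd : Bornology.IsBounded Ω) {q : L2 Ω ℝ} (p : Phase D → ℝ) :
    ∫ z in Ω, q z * P.dJ Ω p z
      = P.σ₁ / (2 * P.T) * (variance Ω p - P.Vdes) * (∫ z in Ω, q z • ‖z.1 - mean Ω p‖ ^ 2)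
        + P.σ₂ / P.T * ⟪mean Ω p - P.Edes, mean Ω q⟫ := by
  have i1 := IsPath.integrable_smul hbd q (c := fun z => ‖z.1 - mean Ω p‖ ^ 2) (by fun_prop)
  have i2 := IsPath.integrable_smul hbd q (c := fun z => z.1) (by fun_prop)
  have e2 : ∫ z in Ω, q z • z.1 = mean Ω q := rfl
  rw [← e2, ← integral_inner i2, ← integral_const_mul, ← integral_const_mul,
    ← integral_add (i1.const_mul _) ((i2.const_inner _).const_mul _)]
  congr 1 with z
  rw [Model.dJ, real_inner_smul_right, smul_eq_mul]
  ring

/-- Second order expansion of the cost. -/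
lemma runCost_sub (hbd : Bornology.IsBounded Ω) {p q : L2 Ω ℝ} (hp : IsDensity Ω p)
    (hq : IsDensity Ω q) :
    runCost P Ω q - runCost P Ω p
      = ((∫ z in Ω, q z * P.dJ Ω p z) - ∫ z in Ω, p z * P.dJ Ω p z)
        + (P.σ₁ / (4 * P.T) * (variance Ω q - variance Ω p) ^ 2
          + (P.σ₂ / (2 * P.T) - P.σ₁ / (2 * P.T) * (variance Ω p - P.Vdes))
            * ‖mean Ω q - mean Ω p‖ ^ 2) := by
  have hT := P.hT.ne'
  rw [integral_mul_dJ hbd, integral_mul_dJ hbd, integral_smul_sq hbd hp, integral_smul_sq hbd hq,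
    sub_self, norm_zero]
  have h1 : mean Ω q - P.Edes = (mean Ω p - P.Edes) + (mean Ω q - mean Ω p) := by abel
  rw [runCost, runCost, h1, norm_add_sq_real, inner_sub_right, sq_abs, sq_abs]
  field_simp
  ring

variable {M : ℕ} {K₁ K₂ : Space D → Space D} {α a b : ℝ} {L₁ L₂ : ℝ≥0} {fa : L2 Ω ℝ}

/-- The second order terms in the expansion of the cost are quadratic in the perturbation. -/
lemma exists_runCost_sub_le (P : Model D) (h : Setting Ω K₁ K₂ L₁ L₂ a b)
    (hR : ∀ z ∈ Ω, ‖z‖ ≤ R) (fa : L2 Ω ℝ) (α : ℝ) :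
    ∃ c, 0 ≤ c ∧ ∀ (f f₁ : ℝ → L2 Ω ℝ) (d d₁ : ℝ → Agents M D),
      IsRegState Ω K₁ K₂ α a b fa f d → IsRegState Ω K₁ K₂ α a b fa f₁ d₁ →
      ∀ η, 0 < η → η ≤ 1 → (∀ t ∈ Icc a b, ∀ m, ‖d₁ t m - d t m‖ ≤ η) → ∀ t ∈ Icc a b,
        runCost P Ω (f₁ t) - runCost P Ω (f t)
          ≤ ((∫ z in Ω, f₁ t z * P.dJ Ω (f t) z) - ∫ z in Ω, f t z * P.dJ Ω (f t) z)
            + c * η ^ 2 := by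
  obtain ⟨B, hB0, hB⟩ := exists_bound_clampVec D R
  have hσ₁ := P.hσ₁
  have hσ₂ := P.hσ₂
  have hT := P.hT
  set F := flowConst L₁ L₂ α a b with hF
  have hF0 : 0 ≤ F := flowConst_nonneg h.lt.le
  set k := P.σ₁ / (2 * P.T) * ((2 * R) ^ 2 + |P.Vdes|) with hk
  have hk0 : 0 ≤ k := by positivity
  set N : ℝ≥0 := (2 * (B + |R|)).toNNReal with hN
  have hNr : (N : ℝ) = 2 * (B + |R|) := Real.coe_toNNReal _ (by positivity)
  refine ⟨P.σ₁ / (4 * P.T) * (N * F + F ^ 2) ^ 2 + (P.σ₂ / (2 * P.T) + k) * F ^ 2, by positivity,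
    fun f f₁ d d₁ hs hs₁ η hη0 hη1 hη t ht => ?_⟩
  have hp := hs.path.density t
  have hq := hs₁.path.density t
  have hcl : LipschitzWith 1 fun z : Phase D => clampVec R z.1 := by
    have := (lipschitzWith_clampVec (D := D) R).comp (LipschitzWith.prod_fst (α := Space D)
      (β := Space D))
    rw [one_mul] at this
    exact this
  have hmean : ∀ r : L2 Ω ℝ, ∫ z in Ω, r z • clampVec R z.1 = mean Ω r := fun r =>
    setIntegral_congr_fun h.meas fun z hz => by
      simp only [clampVec_of_norm_le ((norm_fst_le z).trans (hR z hz))]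
  have h1 : ‖mean Ω (f₁ t) - mean Ω (f t)‖ ≤ F * η := by
    have := hs₁.norm_integral_smul_sub_le hs h hη0 hη ht hcl
    rwa [hmean, hmean, NNReal.coe_one, one_mul] at this
  have hm : ‖mean Ω (f t)‖ ≤ |R| := (norm_mean_le hp h.meas hR).trans (le_abs_self R)
  have hyb : ∀ x, ‖clampVec R x - mean Ω (f t)‖ ≤ B + |R| := fun x =>
    (norm_sub_le _ _).trans (add_le_add (hB x) hm)
  -- The squared distance is not globally Lipschitz. Truncating the position does not alter it on
  -- `Ω` and makes the stability estimate for averages applicable.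
  have hsq : LipschitzWith N fun z : Phase D => ‖clampVec R z.1 - mean Ω (f t)‖ ^ 2 := by
    refine LipschitzWith.of_dist_le_mul fun y z => ?_
    rw [Real.dist_eq, sq_sub_sq, abs_mul, hNr, abs_of_nonneg (by positivity)]
    have h2 := abs_norm_sub_norm_le (clampVec R y.1 - mean Ω (f t)) (clampVec R z.1 - mean Ω (f t))
    rw [sub_sub_sub_cancel_right, ← dist_eq_norm] at h2
    have h3 := hcl.dist_le_mul y z
    rw [NNReal.coe_one, one_mul] at h3
    have h4 := hyb y.1
    have h5 := hyb z.1
    exact mul_le_mul (by linarith) (h2.trans h3) (abs_nonneg _) (by positivity)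
  have hvar : ∀ r : L2 Ω ℝ, ∫ z in Ω, r z • ‖clampVec R z.1 - mean Ω (f t)‖ ^ 2
      = ∫ z in Ω, r z • ‖z.1 - mean Ω (f t)‖ ^ 2 := fun r =>
    setIntegral_congr_fun h.meas fun z hz => by
      simp only [clampVec_of_norm_le ((norm_fst_le z).trans (hR z hz))]
  have h2 : |variance Ω (f₁ t) - variance Ω (f t)| ≤ (N * F + F ^ 2) * η := by
    have := hs₁.norm_integral_smul_sub_le hs h hη0 hη ht hsq
    rw [hvar, hvar, integral_smul_sq h.bdd hp, integral_smul_sq h.bdd hq, sub_self, norm_zero,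
      Real.norm_eq_abs] at this
    -- Here `η ≤ 1` allows one factor `η` to be dropped, so that the variance has a bound linear in
    -- `η`.
    have h3 : ‖mean Ω (f₁ t) - mean Ω (f t)‖ ^ 2 ≤ F ^ 2 * η := by
      calc _ ≤ (F * η) ^ 2 := by gcongr
        _ = F ^ 2 * η * η := by ring
        _ ≤ F ^ 2 * η * 1 := by gcongr
        _ = F ^ 2 * η := mul_one _
    have h4 : variance Ω (f₁ t) - variance Ω (f t)
        = (variance Ω (f₁ t) + ‖mean Ω (f₁ t) - mean Ω (f t)‖ ^ 2 - (variance Ω (f t) + 0 ^ 2))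
          - ‖mean Ω (f₁ t) - mean Ω (f t)‖ ^ 2 := by ring
    rw [h4]
    refine (abs_sub _ _).trans ?_
    rw [abs_of_nonneg (sq_nonneg ‖_‖)]
    calc _ ≤ N * (F * η) + F ^ 2 * η := add_le_add this h3
      _ = _ := by ring
  have h3 : (variance Ω (f₁ t) - variance Ω (f t)) ^ 2 ≤ ((N * F + F ^ 2) * η) ^ 2 := by
    rw [← sq_abs]; gcongr
  have h4 : ‖mean Ω (f₁ t) - mean Ω (f t)‖ ^ 2 ≤ (F * η) ^ 2 := by gcongr
  have h5 : P.σ₂ / (2 * P.T) - P.σ₁ / (2 * P.T) * (variance Ω (f t) - P.Vdes)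
      ≤ P.σ₂ / (2 * P.T) + k := by
    have := (abs_le.1 (abs_cost_coeff_le (P := P) hp h.meas hR)).1
    linarith
  rw [← sub_le_iff_le_add', runCost_sub h.bdd hp hq, add_sub_cancel_left]
  calc _ ≤ P.σ₁ / (4 * P.T) * ((N * F + F ^ 2) * η) ^ 2 + (P.σ₂ / (2 * P.T) + k) * (F * η) ^ 2 := by
        refine add_le_add (by gcongr) ?_
        exact mul_le_mul h5 h4 (sq_nonneg _) (by positivity)
    _ = _ := by ring

end Expansion

/-! ### The quadratic cost of the control. -/

section Quadratic

variable {X H : Type*} [MeasurableSpace X] {μ : Measure X} [NormedAddCommGroup H]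
  [InnerProductSpace ℝ H] {w e : X → H}

lemma integrable_inner_of_memLp (hw : MemLp w 2 μ) (he : MemLp e 2 μ) :
    Integrable (fun t => ⟪w t, e t⟫) μ := by
  refine Integrable.mono' ((hw.integrable_norm_pow two_ne_zero).add
    (he.integrable_norm_pow two_ne_zero)) (hw.1.inner he.1) (Eventually.of_forall fun t => ?_)
  refine (norm_inner_le_norm _ _).trans ?_
  simp only [Pi.add_apply]
  nlinarith [sq_nonneg (‖w t‖ - ‖e t‖), sq_nonneg ‖w t‖, sq_nonneg ‖e t‖]

lemma integral_norm_add_smul_sq (hw : MemLp w 2 μ) (he : MemLp e 2 μ) (ε : ℝ) :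
    ∫ t, ‖w t + ε • e t‖ ^ 2 ∂μ
      = (∫ t, ‖w t‖ ^ 2 ∂μ) + (2 * ε * (∫ t, ⟪w t, e t⟫ ∂μ) + ε ^ 2 * ∫ t, ‖e t‖ ^ 2 ∂μ) := by
  have i1 := hw.integrable_norm_pow two_ne_zero
  have i2 := he.integrable_norm_pow two_ne_zero
  have i3 := integrable_inner_of_memLp hw he
  rw [← integral_const_mul, ← integral_const_mul,
    ← integral_add (i3.const_mul _) (i2.const_mul _),
    ← integral_add i1 ((i3.const_mul _).fun_add (i2.const_mul _))]
  congr 1 with t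
  rw [norm_add_sq_real, real_inner_smul_right, norm_smul, mul_pow, Real.norm_eq_abs, sq_abs]
  ring

end Quadratic

/-! ### Expansion of the total cost along a variation of the control. -/

section Variation

variable {D M : ℕ} {P : Model D} {Ω : Set (Phase D)} {a b : ℝ} {fa : L2 Ω ℝ} {da : Agents M D}
  {f : ℝ → L2 Ω ℝ} {d w u : ℝ → Agents M D}

lemma continuous_runCost (hbd : Bornology.IsBounded Ω) (hf : Continuous f) :
    Continuous fun t => runCost P Ω (f t) := by
  have key : ∀ (m : ℝ → Space D) (v : ℝ → ℝ), Continuous m → Continuous v → Continuous fun t =>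
      P.σ₁ / (4 * P.T) * |v t - P.Vdes| ^ 2 + P.σ₂ / (2 * P.T) * ‖m t - P.Edes‖ ^ 2 :=
    fun m v hm hv => by fun_prop
  exact key _ _ (continuous_mean hbd hf) (continuous_variance hbd hf)

lemma J_eq (hab : a ≤ b) (hbd : Bornology.IsBounded Ω)
    (hf : Continuous fun t => f (max a (min b t))) (hw : MemLp w 2 (volume.restrict (Icc a b))) :
    P.J Ω a b f w = (∫ t in a..b, runCost P Ω (f (max a (min b t))))
      + P.σ₃ / (2 * M) * ∫ t in Icc a b, ‖w t‖ ^ 2 := by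
  have i1 : IntegrableOn (fun t => runCost P Ω (f (max a (min b t)))) (Icc a b) :=
    (continuous_runCost hbd hf).continuousOn.integrableOn_Icc
  have i2 := hw.integrable_norm_pow two_ne_zero
  rw [intervalIntegral.integral_of_le hab, ← integral_Icc_eq_integral_Ioc, ← integral_const_mul,
    ← integral_add i1 (i2.const_mul _)]
  refine setIntegral_congr_fun measurableSet_Icc fun t ht => ?_
  simp only [clamp_of_mem ht, runCost]

lemma Model.Admissible.add_smul_sub (hw : P.Admissible a b w) (hu : P.Admissible a b u) {ε : ℝ}
    (h0 : 0 ≤ ε) (h1 : ε ≤ 1) : P.Admissible a b (fun t => w t + ε • (u t - w t)) := by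
  refine ⟨hw.1.add ((hu.1.sub hw.1).const_smul ε), ?_⟩
  filter_upwards [hw.2, hu.2] with t hwt hut m
  have e : (w t + ε • (u t - w t)) m = (1 - ε) • w t m + ε • u t m := by
    simp only [PiLp.add_apply, PiLp.smul_apply, PiLp.sub_apply]
    module
  rw [e]
  refine (norm_add_le _ _).trans ?_
  rw [norm_smul, norm_smul, Real.norm_of_nonneg h0, Real.norm_of_nonneg (sub_nonneg.2 h1)]
  have := mul_le_mul_of_nonneg_left (hwt m) (sub_nonneg.2 h1)
  have := mul_le_mul_of_nonneg_left (hut m) h0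
  linarith

/-- The displacement of the agents caused by a variation of the control. -/
lemma agents_eq_add_smul {d₁ : ℝ → Agents M D} {f₁ : ℝ → L2 Ω ℝ} {e : ℝ → Agents M D} {ε : ℝ}
    (hs : P.IsState Ω a b fa da f d w)
    (he : IntegrableOn e (Icc a b))
    (hs₁ : P.IsState Ω a b fa da f₁ d₁ (fun t => w t + ε • e t)) {t : ℝ} (ht : t ∈ Icc a b) :
    d₁ t = d t + ε • ∫ s in a..t, e s := by
  have hi : IntervalIntegrable e volume a t := by
    rw [intervalIntegrable_iff_integrableOn_Icc_of_le ht.1]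
    exact he.mono_set (Icc_subset_Icc_right ht.2)
  have h1 : ∫ s in a..t, (w s + ε • e s) = (∫ s in a..t, w s) + ∫ s in a..t, ε • e s :=
    intervalIntegral.integral_add (hs.agents.intervalIntegrable ht) (hi.smul ε)
  rw [hs₁.agents.2 t ht, hs.agents.2 t ht, hs₁.agents_init, hs.agents_init, h1,
    intervalIntegral.integral_smul, add_assoc]

variable {K₁ K₂ : Space D → Space D} {L₁ L₂ LJ C : ℝ≥0} {B₁ BJ R c η θ : ℝ} {ρ : ℝ → Phase D → ℝ}
  {g : ℝ × Phase D → ℝ}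

/-- The first order expansion of the cost along an admissible variation. -/
lemma expansion_nonneg {d₁ w₁ : ℝ → Agents M D} {f₁ : ℝ → L2 Ω ℝ}
    (h : AgreesWith P Ω K₁ K₂ R (agentsBound P a b da)) (hset : Setting Ω K₁ K₂ L₁ L₂ a b)
    (hs : P.IsState Ω a b fa da f d w) (hw : P.Admissible a b w)
    (hs₁ : P.IsState Ω a b fa da f₁ d₁ w₁) (hw₁ : P.Admissible a b w₁)
    (hle : P.J Ω a b f w ≤ P.J Ω a b f₁ w₁)
    (hρ : IsVersion Ω a b (fun t => f (max a (min b t))) ρ)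
    (hA : AdjointData Ω K₁ ρ (fun t x => cutCost P Ω R (f (max a (min b t))) x) L₁ LJ B₁ BJ)
    (hg : LipschitzWith C g) (hgb : ∀ z ∈ Ω, g (b, z) = 0)
    (hgeq : ∀ᵐ t : ℝ, t ∈ Icc a b → ∀ᵐ z ∂(volume.restrict Ω),
        fderiv ℝ g (t, z) (1, (z.2, force Ω K₁ K₂ (fun t => f (max a (min b t)))
          (fun t => d (max a (min b t))) t z.1 - P.α • z.2))
          = adjointSource Ω K₁ ρ (fun t x => cutCost P Ω R (f (max a (min b t))) x)
            (gradV g) t z)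
    (hc : ∀ (p p₁ : ℝ → L2 Ω ℝ) (q q₁ : ℝ → Agents M D),
      IsRegState Ω K₁ K₂ P.α a b fa p q → IsRegState Ω K₁ K₂ P.α a b fa p₁ q₁ →
      ∀ η, 0 < η → η ≤ 1 → (∀ t ∈ Icc a b, ∀ m, ‖q₁ t m - q t m‖ ≤ η) → ∀ t ∈ Icc a b,
        runCost P Ω (p₁ t) - runCost P Ω (p t)
          ≤ ((∫ z in Ω, p₁ t z * P.dJ Ω (p t) z) - ∫ z in Ω, p t z * P.dJ Ω (p t) z)
            + c * η ^ 2)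
    (hη0 : 0 < η) (hη1 : η ≤ 1)
    (hη : ∀ t, ∀ m, ‖d₁ (max a (min b t)) m - d (max a (min b t)) m‖ ≤ η)
    (hθ : ∀ t ∈ Icc a b,
      ∫ z in Ω, |f₁ (max a (min b t)) z - f (max a (min b t)) z| ≤ θ) :
    0 ≤ (∫ s in a..b, ∫ z in Ω, ρ s z * ⟪gradV g (s, z),
          agentForce K₂ (d₁ (max a (min b s))) z.1 - agentForce K₂ (d (max a (min b s))) z.1⟫)
      + C * (fieldConst L₁ L₂ P.α a b * η) * θ * (b - a) + c * η ^ 2 * (b - a)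
      + P.σ₃ / (2 * M) * ((∫ t in Icc a b, ‖w₁ t‖ ^ 2) - ∫ t in Icc a b, ‖w t‖ ^ 2) := by
  have hab := hset.lt.le
  have hr := isRegState_of_isState h hset.lt hset.meas hs hw
  have hr₁ := isRegState_of_isState h hset.lt hset.meas hs₁ hw₁
  obtain ⟨ρ₁, hρ₁⟩ := hr₁.exists_version hset
  have hdual := abs_duality_le hr hr₁ hset hρ hρ₁ hA h.odd hg hgb hgeq hη0
    (fun t _ m => hη t m) hθ
  have hexp := hc _ _ _ _ hr hr₁ η hη0 hη1 (fun t _ m => hη t m)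
  rw [J_eq hab hset.bdd hr.path.contf hw.1, J_eq hab hset.bdd hr₁.path.contf hw₁.1] at hle
  have hcr := continuous_runCost (P := P) hset.bdd hr.path.contf
  have hcr₁ := continuous_runCost (P := P) hset.bdd hr₁.path.contf
  set Q : ℝ → ℝ := fun s => ∫ z in Ω, (ρ₁ s z - ρ s z) * cutCost P Ω R (f (max a (min b s))) z.1
    with hQ
  have hQeq : ∀ s ∈ Icc a b, (∫ z in Ω, f₁ (max a (min b s)) z * P.dJ Ω (f (max a (min b s))) z)
      - (∫ z in Ω, f (max a (min b s)) z * P.dJ Ω (f (max a (min b s))) z) = Q s := fun s hsm => by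
    have hJm : Measurable fun z : Phase D => cutCost P Ω R (f (max a (min b s))) z.1 :=
      hA.measJ.comp (f := fun z : Phase D => (s, z.1)) (by fun_prop)
    have hJb : ∀ᵐ z ∂(volume.restrict Ω), |cutCost P Ω R (f (max a (min b s))) z.1| ≤ BJ :=
      Eventually.of_forall fun z => hA.boundJ s z.1
    have e1 : ∫ z in Ω, f₁ (max a (min b s)) z * P.dJ Ω (f (max a (min b s))) z
        = ∫ z in Ω, ρ₁ s z * cutCost P Ω R (f (max a (min b s))) z.1 := by
      refine integral_congr_ae ?_
      filter_upwards [hρ₁.ae_eq s hsm, ae_restrict_mem hset.meas] with z h1 h2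
      rw [h1, cutCost_eq h.bound _ h2]
    have e2 : ∫ z in Ω, f (max a (min b s)) z * P.dJ Ω (f (max a (min b s))) z
        = ∫ z in Ω, ρ s z * cutCost P Ω R (f (max a (min b s))) z.1 := by
      refine integral_congr_ae ?_
      filter_upwards [hρ.ae_eq s hsm, ae_restrict_mem hset.meas] with z h1 h2
      rw [h1, cutCost_eq h.bound _ h2]
    rw [e1, e2, ← integral_sub (integrable_mul_of_bound (hρ₁.int s) hJm hJb)
      (integrable_mul_of_bound (hρ.int s) hJm hJb)]
    simp only [hQ, sub_mul]
  have hiQ : IntervalIntegrable Q volume a b := by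
    have hJm : Measurable fun q : ℝ × Phase D => cutCost P Ω R (f (max a (min b q.1))) q.2.1 :=
      hA.measJ.comp (f := fun q : ℝ × Phase D => (q.1, q.2.1)) (by fun_prop)
    refine intervalIntegrable_of_bounded_on (B := BJ * θ) hab
      (measurable_integral_mul (ρ := fun s z => ρ₁ s z - ρ s z) (hρ₁.meas.sub hρ.meas) hJm)
      fun s hsm => (abs_integral_mul_le_of_ae ((hρ₁.int s).sub (hρ.int s))
        (Eventually.of_forall fun z => hA.boundJ s z.1)).trans
        (mul_le_mul_of_nonneg_left (hρ.integral_abs_sub_le hρ₁ hsm (hθ s hsm))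
          ((abs_nonneg _).trans (hA.boundJ 0 0)))
  have hmono : ∫ s in a..b, (runCost P Ω (f₁ (max a (min b s)))
      - runCost P Ω (f (max a (min b s)))) ≤ ∫ s in a..b, (Q s + c * η ^ 2) :=
    intervalIntegral.integral_mono_on hab ((hcr₁.sub hcr).intervalIntegrable _ _)
      (hiQ.add intervalIntegrable_const) fun s hsm => by
        have := hexp s hsm
        rwa [hQeq s hsm] at this
  rw [intervalIntegral.integral_sub (hcr₁.intervalIntegrable _ _) (hcr.intervalIntegrable _ _),
    intervalIntegral.integral_add hiQ intervalIntegrable_const, intervalIntegral.integral_const,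
    smul_eq_mul] at hmono
  -- Optimality bounds the cost difference from below by zero, so only upper bounds on the state
  -- part are needed.
  have hup := (abs_le.1 hdual).2
  have e3 : P.σ₃ / (2 * M) * ((∫ t in Icc a b, ‖w₁ t‖ ^ 2) - ∫ t in Icc a b, ‖w t‖ ^ 2)
      = P.σ₃ / (2 * M) * (∫ t in Icc a b, ‖w₁ t‖ ^ 2)
        - P.σ₃ / (2 * M) * ∫ t in Icc a b, ‖w t‖ ^ 2 := mul_sub _ _ _
  rw [e3]
  have e4 : (b - a) * (c * η ^ 2) = c * η ^ 2 * (b - a) := by ring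
  rw [e4] at hmono
  linarith

end Variation

/-! ### The variational inequality. -/

section Inequality

variable {D M : ℕ} {P : Model D} {Ω : Set (Phase D)} {a b : ℝ} {fa : L2 Ω ℝ} {da : Agents M D}
  {f : ℝ → L2 Ω ℝ} {d w u : ℝ → Agents M D} {K₁ K₂ : Space D → Space D} {L₁ L₂ LJ C : ℝ≥0}
  {B₁ BJ R : ℝ} {ρ : ℝ → Phase D → ℝ} {g : ℝ × Phase D → ℝ}

lemma Model.Admissible.norm_sub_apply_le (hw : P.Admissible a b w) (hu : P.Admissible a b u) :
    ∀ᵐ t ∂(volume.restrict (Icc a b)), ∀ m, ‖(u t - w t) m‖ ≤ 2 * |P.umax| := by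
  filter_upwards [hw.2, hu.2] with t h1 h2 m
  have := norm_sub_le (u t m) (w t m)
  have h3 := h1 m
  have h4 := h2 m
  have h5 := le_abs_self P.umax
  rw [PiLp.sub_apply]
  linarith

lemma isH1With_primitive {e : ℝ → Agents M D} (he : MemLp e 2 (volume.restrict (Icc a b))) :
    IsH1With a b (fun t => ∫ s in a..t, e s) e :=
  ⟨he, fun t _ => by simp⟩

/-- The first order optimality condition, in terms of the displacement of the agents. -/
lemma variation_nonneg (h : AgreesWith P Ω K₁ K₂ R (agentsBound P a b da))
    (hset : Setting Ω K₁ K₂ L₁ L₂ a b)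
    (hreg : ∀ w : ℝ → Agents M D, P.Admissible a b w →
      ∃ (f : ℝ → L2 Ω ℝ) (d : ℝ → Agents M D), P.IsState Ω a b fa da f d w)
    (hopt : P.IsOptimal Ω a b fa da f d w)
    (hρ : IsVersion Ω a b (fun t => f (max a (min b t))) ρ)
    (hA : AdjointData Ω K₁ ρ (fun t x => cutCost P Ω R (f (max a (min b t))) x) L₁ LJ B₁ BJ)
    (hg : LipschitzWith C g) (hgb : ∀ z ∈ Ω, g (b, z) = 0)
    (hgeq : ∀ᵐ t : ℝ, t ∈ Icc a b → ∀ᵐ z ∂(volume.restrict Ω),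
        fderiv ℝ g (t, z) (1, (z.2, force Ω K₁ K₂ (fun t => f (max a (min b t)))
          (fun t => d (max a (min b t))) t z.1 - P.α • z.2))
          = adjointSource Ω K₁ ρ (fun t x => cutCost P Ω R (f (max a (min b t))) x)
            (gradV g) t z)
    (hu : P.Admissible a b u) :
    0 ≤ -(∫ s in a..b, ⟪∫ r in a..max a (min b s), (u r - w r),
          agentTerm Ω K₂ ρ (fun t => d (max a (min b t))) (gradV g) s⟫)
        + P.σ₃ / M * ∫ t in Icc a b, ⟪w t, u t - w t⟫ := by
  obtain ⟨⟨hs, hw⟩, hmin⟩ := hopt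
  have hab := hset.lt.le
  have hr := isRegState_of_isState h hset.lt hset.meas hs hw
  obtain ⟨c, hc0, hc⟩ := exists_runCost_sub_le (M := M) P hset h.bound fa P.α
  set e : ℝ → Agents M D := fun t => u t - w t with he
  have heL : MemLp e 2 (volume.restrict (Icc a b)) := hu.1.sub hw.1
  have hei : IntegrableOn e (Icc a b) := heL.integrable one_le_two
  set δ : ℝ → Agents M D := fun s => ∫ r in a..max a (min b s), e r with hδ
  have hδc : Continuous δ := (isH1With_primitive heL).continuous_clamp hab
  -- The summand `1` keeps the bound positive when `umax = 0`, because the stability estimates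
  -- require `η > 0`.
  set B : ℝ := 2 * |P.umax| * (b - a) + 1 with hB
  have hB0 : 0 < B := by
    have : 0 ≤ b - a := sub_nonneg.2 hab
    positivity
  have hδB : ∀ s m, ‖δ s m‖ ≤ B := fun s m =>
    (norm_agents_integral_apply_le (clamp_mem hab s) (hw.norm_sub_apply_le hu)
      ((isH1With_primitive heL).intervalIntegrable (clamp_mem hab s)) (by positivity) m).trans
      (by rw [hB]; linarith)
  set ε : ℕ → ℝ := fun n => 1 / ((n : ℝ) + 1) with hε
  have hεpos : ∀ n, 0 < ε n := fun n => Nat.one_div_pos_of_nat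
  have hεle : ∀ n, ε n ≤ 1 := fun n => by
    rw [hε]
    simp only
    rw [div_le_one (by positivity)]
    have : (0 : ℝ) ≤ n := n.cast_nonneg
    linarith
  have hεlim : Tendsto ε atTop (𝓝 0) := tendsto_one_div_add_atTop_nhds_zero_nat
  have hεlim' : Tendsto ε atTop (𝓝[>] 0) :=
    tendsto_nhdsWithin_iff.2 ⟨hεlim, Eventually.of_forall hεpos⟩
  have hwn : ∀ n, P.Admissible a b fun t => w t + ε n • e t := fun n =>
    hw.add_smul_sub hu (hεpos n).le (hεle n)
  -- Any state for the perturbed control will do: the stability estimates hold for arbitrary states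
  -- and need no continuous selection.
  choose fn dn hsn using fun n => hreg _ (hwn n)
  have hdn : ∀ n s, dn n (max a (min b s)) = d (max a (min b s)) + ε n • δ s := fun n s =>
    agents_eq_add_smul hs hei (hsn n) (clamp_mem hab s)
  have hdnη : ∀ n s m, ‖dn n (max a (min b s)) m - d (max a (min b s)) m‖ ≤ ε n * B :=
    fun n s m => by
      have : dn n (max a (min b s)) m - d (max a (min b s)) m = ε n • δ s m := by
        rw [hdn n s]; simp
      rw [this, norm_smul, Real.norm_of_nonneg (hεpos n).le]
      exact mul_le_mul_of_nonneg_left (hδB s m) (hεpos n).le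
  set U : ℕ → ℝ := fun n => ∫ s in a..b, ∫ z in Ω, ρ s z * ⟪gradV g (s, z),
    agentForce K₂ (d (max a (min b s)) + ε n • δ s) z.1
      - agentForce K₂ (d (max a (min b s))) z.1⟫ with hU
  have hUlim := tendsto_coupling (Ω := Ω) (ρ := ρ) (V := gradV g)
    (d := fun s => d (max a (min b s))) hab hset.lip₂ hr.path.contd hδc hB0.le
    (fun s _ m => hδB s m) (measurable_gradV g) (norm_gradV_le hg) hρ.meas hρ.int hρ.mass
    (fun s _ => h.ae_symmetric hset.meas hset.lip₂ fun m =>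
      norm_agents_le hs hw (clamp_mem hab s) m) hεlim' hεpos
  set I₁ := ∫ t in Icc a b, ⟪w t, e t⟫ with hI₁
  set I₂ := ∫ t in Icc a b, ‖e t‖ ^ 2 with hI₂
  set Λ := C * (fieldConst L₁ L₂ P.α a b * B) * (b - a) with hΛ
  have hΛ0 : 0 ≤ Λ := by
    have : 0 ≤ b - a := sub_nonneg.2 hab
    have := fieldConst_nonneg (L₁ := L₁) (L₂ := L₂) (α := P.α) (a := a) (b := b)
    positivity
  refine le_of_forall_pos_le_add fun κ' hκ' => ?_
  -- The `L¹` continuity has no rate, so the tolerance `κ` is fixed before `n` tends to infinity.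
  -- The limit then leaves the error `Λ κ ≤ κ'`, where `κ'` is arbitrary.
  set κ := κ' / (Λ + 1) with hκdef
  have hκ : 0 < κ := by positivity
  obtain ⟨τ, hτ0, hτ⟩ := IsRegState.exists_integral_abs_sub_le (M := M) hset fa P.α hκ
  have hev : ∀ᶠ n in atTop, ε n * B ≤ min τ 1 := by
    have h1 : Tendsto (fun n => ε n * B) atTop (𝓝 (0 * B)) := hεlim.mul_const B
    rw [zero_mul] at h1
    exact (h1.eventually_lt_const (lt_min hτ0 one_pos)).mono fun n hn => hn.le
  have hineq : ∀ᶠ n in atTop, 0 ≤ (ε n)⁻¹ * U n + Λ * κ + c * B ^ 2 * (b - a) * ε n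
      + P.σ₃ / (2 * M) * (2 * I₁ + ε n * I₂) := by
    filter_upwards [hev] with n hn
    have hrn := isRegState_of_isState h hset.lt hset.meas (hsn n) (hwn n)
    have h1 := expansion_nonneg h hset hs hw (hsn n) (hwn n) (hmin _ _ _ (hsn n) (hwn n)) hρ hA
      hg hgb hgeq hc (mul_pos (hεpos n) hB0) (hn.trans (min_le_right _ _)) (hdnη n)
      (hτ _ _ _ _ hrn hr fun t _ m => (hdnη n t m).trans (hn.trans (min_le_left _ _)))
    rw [integral_norm_add_smul_sq hw.1 heL] at h1
    simp only [hdn] at h1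
    have h2 := mul_nonneg (inv_nonneg.2 (hεpos n).le) h1
    refine h2.trans (le_of_eq ?_)
    have hne := (hεpos n).ne'
    rw [hΛ]
    simp only [hU]
    field_simp
    ring
  have hlim := (((hUlim.add_const (Λ * κ)).add (hεlim.const_mul (c * B ^ 2 * (b - a)))).add
    (((hεlim.mul_const I₂).const_add (2 * I₁)).const_mul (P.σ₃ / (2 * M))))
  have hfin := ge_of_tendsto hlim hineq
  have hκle : Λ * κ ≤ κ' := by
    rw [hκdef, mul_div_assoc', div_le_iff₀ (by positivity)]
    nlinarith
  have e1 : P.σ₃ / (2 * M) * (2 * I₁ + 0 * I₂) = P.σ₃ / M * I₁ := by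
    rw [zero_mul, add_zero]
    rcases eq_or_ne (M : ℝ) 0 with hM | hM
    · simp [hM]
    · field_simp
  rw [mul_zero, add_zero, e1] at hfin
  linarith

/-- Integration by parts in time moves the primitive off `u - w`, and the backward primitive of `A`,
which is the agents' adjoint variable, appears in its place. -/
lemma inner_control_nonneg {A : ℝ → Agents M D} {N k : ℝ} (hab : a ≤ b)
    (hA : Measurable A) (hN : ∀ s, ‖A s‖ ≤ N) (hw : MemLp w 2 (volume.restrict (Icc a b)))
    (hu : MemLp u 2 (volume.restrict (Icc a b)))
    (h : 0 ≤ -(∫ s in a..b, ⟪∫ r in a..max a (min b s), (u r - w r), A s⟫)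
      + k * ∫ t in Icc a b, ⟪w t, u t - w t⟫) :
    0 ≤ ∫ t in Icc a b, ⟪k • w t - ∫ s in t..b, A s, u t - w t⟫ := by
  have he : MemLp (fun t => u t - w t) 2 (volume.restrict (Icc a b)) := hu.sub hw
  have hi : ∀ c e, IntervalIntegrable A volume c e := fun c e => by
    rw [intervalIntegrable_iff]
    exact Measure.integrableOn_of_bounded (M := N) measure_Ioc_lt_top.ne
      hA.aestronglyMeasurable (Eventually.of_forall hN)
  have hφc : Continuous fun t => ∫ s in t..b, A s := by
    have := (intervalIntegral.continuous_primitive hi b).neg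
    refine this.congr fun t => ?_
    rw [intervalIntegral.integral_symm, Pi.neg_apply]
  obtain ⟨Nφ, hNφ⟩ := (isCompact_Icc (a := a) (b := b)).exists_bound_of_continuousOn
    hφc.continuousOn
  have hφ : MemLp (fun t => ∫ s in t..b, A s) 2 (volume.restrict (Icc a b)) :=
    MemLp.of_bound hφc.aestronglyMeasurable Nφ (by
      filter_upwards [ae_restrict_mem measurableSet_Icc] with t ht using hNφ t ht)
  have e1 : ∫ s in a..b, ⟪∫ r in a..max a (min b s), (u r - w r), A s⟫
      = ∫ s in a..b, ⟪∫ r in a..s, (u r - w r), A s⟫ :=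
    intervalIntegral.integral_congr fun s hs => by
      rw [uIcc_of_le hab] at hs
      simp only [clamp_of_mem hs]
  have hec : IntegrableOn (fun t => u t - w t) (Icc a b) := he.integrable one_le_two
  have heo := hec.mono_set Ioc_subset_Icc_self
  rw [e1, integral_inner_primitive hab heo ((intervalIntegrable_iff_integrableOn_Ioc_of_le hab).1
    (hi a b)), intervalIntegral.integral_of_le hab, ← integral_Icc_eq_integral_Ioc] at h
  have e2 : ∫ t in Icc a b, ⟪k • w t - ∫ s in t..b, A s, u t - w t⟫
      = k * (∫ t in Icc a b, ⟪w t, u t - w t⟫)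
        - ∫ t in Icc a b, ⟪u t - w t, ∫ s in t..b, A s⟫ := by
    rw [← integral_const_mul, ← integral_sub ((integrable_inner_of_memLp hw he).const_mul k)
      (integrable_inner_of_memLp he hφ)]
    congr 1 with t
    rw [inner_sub_left, real_inner_smul_left, real_inner_comm (u t - w t) (∫ s in t..b, A s)]
  rw [e2]
  linarith

end Inequality

end MeanFieldControl

theorem proposition4p2 {D M : ℕ} (hD : 1 ≤ D) (hM : 1 ≤ M) (P : MeanFieldControl.Model D)
    (Ω : Set (MeanFieldControl.Phase D)) (hΩ_open : IsOpen Ω) (hΩ_bdd : Bornology.IsBounded Ω)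
    (hΩ_conv : Convex ℝ Ω)
    (a b : ℝ) (ha : 0 ≤ a) (hab : a < b) (hb : b ≤ P.T)
    (fa : MeanFieldControl.L2 Ω ℝ) (hfa : MeanFieldControl.IsDensity Ω fa)
    (da : MeanFieldControl.Agents M D)
    (hreg : ∀ w : ℝ → MeanFieldControl.Agents M D, P.Admissible a b w →
      ∃ (f : ℝ → MeanFieldControl.L2 Ω ℝ) (d : ℝ → MeanFieldControl.Agents M D),
        P.IsState Ω a b fa da f d w)
    (f : ℝ → MeanFieldControl.L2 Ω ℝ) (d w : ℝ → MeanFieldControl.Agents M D)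
    (hopt : P.IsOptimal Ω a b fa da f d w) :
    ∃ (g : ℝ → MeanFieldControl.L2 Ω ℝ) (φ : ℝ → MeanFieldControl.Agents M D),
      P.IsAdjoint Ω a b f d g φ ∧
      ∀ u : ℝ → MeanFieldControl.Agents M D, P.Admissible a b u →
        0 ≤ ∫ t in Icc a b, ⟪(P.σ₃ / (M : ℝ)) • w t - φ t, u t - w t⟫ := by
  open MeanFieldControl in
  obtain ⟨hs, hw⟩ := hopt.1
  -- The radius `agentsBound` works for all admissible controls, so one choice of kernels serves the
  -- optimal state and every perturbed one.
  obtain ⟨K₁, K₂, L₁, L₂, B₁, R, h, hL₁, hL₂, hB₁⟩ :=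
    exists_agreesWith P hΩ_bdd (agentsBound P a b da)
  have hset : Setting Ω K₁ K₂ L₁ L₂ a b := ⟨hab, hΩ_open.measurableSet, hΩ_bdd, hL₁, hL₂⟩
  have hr := isRegState_of_isState h hab hset.meas hs hw
  obtain ⟨ρ, hρ⟩ := hr.exists_version hset
  obtain ⟨BJ, LJ, hJ⟩ := exists_lipschitz_cutCost (P := P) hset.meas h.bound
  have hA : AdjointData Ω K₁ ρ (fun t x => cutCost P Ω R (f (max a (min b t))) x) L₁ LJ B₁ BJ :=
    ⟨hΩ_bdd, hset.meas, hL₁, hB₁, hρ.meas, hρ.int, hρ.mass,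
      measurable_cutCost hΩ_bdd hr.path.contf, fun t => (hJ _ (hr.path.density t)).1,
      fun t => (hJ _ (hr.path.density t)).2⟩
  obtain ⟨X, Y, hfl⟩ := hr.exists_flow hset
  obtain ⟨g, C, hg, hgb, hgeq⟩ := hA.exists_solution
    (S := force Ω K₁ K₂ (fun t => f (max a (min b t))) fun t => d (max a (min b t))) hfl
    (hr.lip_force hset)
  -- The adjoint pair is built from the optimal state alone, before any competitor `u` is chosen.
  refine ⟨slice Ω g, fun t => ∫ s in t..b,
    agentTerm Ω K₂ ρ (fun t => d (max a (min b t))) (gradV g) s,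
    isAdjoint_slice h hset (fun t ht m => norm_agents_le hs hw ht m) hr.path.contd hρ hg hgb hgeq,
    fun u hu => ?_⟩
  obtain ⟨N, hN⟩ := exists_bound_agentTerm (Ω := Ω) (d := fun t => d (max a (min b t)))
    hL₂ (norm_gradV_le hg) hρ.int hρ.mass
  exact inner_control_nonneg hab.le
    (measurable_agentTerm hρ.meas hr.path.contd (measurable_gradV g)) hN hw.1 hu.1
    (variation_nonneg h hset hreg hopt hρ hA hg hgb hgeq hu)
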